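/- Let $d\ge 1$, let $\Omega\subset\mathbb R^d$ be a bounded open set (for instance a bounded Lipschitz domain), let $\gamma\in(-1,1)\setminus\{0\}$, $\alpha_0>0$, $T>0$, and $$a_\gamma=-\alpha_0\tfrac4\pi\,\Gamma(-\gamma-1)\,\Gamma(\gamma+2)\cos\bigl((\gamma+1)\tfrac{\pi}{2}\bigr).$$ Let $(\cdot,\cdot)$ and $\|\cdot\|$ be the $L^2(\Omega)$ inner product and norm, $\|\cdot\|_1$ the $H^1(\Omega)$ norm, $H^1_0(\Omega)$ the closure of $C_c^\infty(\Omega)$ in $H^1(\Omega)$, and $\partial_t^{\beta}$ the Caputo derivative of order $\beta>-1$ based at $t=0$ (for $\beta<0$, the Riemann–Liouville integral of order $-\beta$). **Solution.** Let $f:[0,T]\to L^2(\Omega)$ and let $u:[0,T]\to H^1_0(\Omega)$ satisfy $u(0)=u_0$, $\partial_tu(0)=v_0$ and, for $0<t\le T$, $$(\partial_t^2u,v)+(\nabla u,\nabla v)+(a_\gamma\partial_t^{\gamma+1}u,v)=(f,v)\qquad\text{for all }v\in H_0^1(\Omega).$$ Assume that $u\in C^2([0,T];H^1(\Omega))\cap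 C^4((0,T];H^1(\Omega))$ and $$\|\partial_t^{k}u(t)\|_1\le C_0\,(1+c_kt^{2+\alpha-k}),\qquad 0<t\le T,\quad k=0,\dots,4,$$ with constants $C_0>0$, $c_k\ge0$ and $\alpha\ne1$, where $\alpha\ge-\gamma$ if $\gamma\in(-1,0)$ and $\alpha\ge1-\gamma$ if $\gamma\in(0,1)$. **Scheme.** Let $V_h\subset H_0^1(\Omega)$ be a finite-dimensional subspace with $\|\nabla v\|\le C_{\rm inv}h^{-1}\|v\|$ for all $v\in V_h$ (with $h,C_{\rm inv}>0$). Let $R_h:H_0^1(\Omega)\to V_h$ be the Ritz projection, $(\nabla R_hw,\nabla v)=(\nabla w,\nabla v)$ for all $v\in V_h$, and $P_h:L^2(\Omega)\to V_h$ the $L^2$ projection. Let $N\in\mathbb N$, $\kappa=T/N$, $t_n=n\kappa$. Define the weights $\omega_j$ by $$\Bigl(\frac{\delta(\zeta)}{\kappa}\Bigr)^{\gamma}=\sum_{j\ge0}\omega_j\zeta^j,\qquad \delta(\zeta)=\tfrac32-2\zeta+\tfrac12\zeta^2,$$ and the correction weights, exact on constants and, if $\gamma\in(0,1)$, also on linear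 functions, by $$w_{n1}=0,\quad w_{n0}=\frac{t_n^{-\gamma}}{\Gamma(1-\gamma)}-\sum_{j=0}^n\omega_j\qquad(\gamma<0),$$ $$w_{n1}=\kappa^{-1}\Bigl(\frac{t_n^{1-\gamma}}{\Gamma(2-\gamma)}-\sum_{j=0}^n(t_n-t_j)\omega_j\Bigr),\quad w_{n0}=-\sum_{j=0}^n\omega_j-w_{n1}\qquad(\gamma>0).$$ For a sequence $g$ put $\tilde\partial_t^{\gamma}g(t_n)=\sum_{j=0}^n\omega_{n-j}g_j+w_{n0}g_0+w_{n1}g_1$. The discrete solution $u_0^h,\dots,u_N^h\in V_h$ satisfies $u^h_0=R_hu_0$, $u^h_1=R_h(u_0+\kappa v_0)+\frac{\kappa^2}2P_h\partial_t^2u(0)$ and, for $n=1,\dots,N-1$ and all $v\in V_h$, $$\tfrac1{\kappa^2}(u^h_{n+1}-2u^h_n+u^h_{n-1},v)+(\nabla u^h_n,\nabla v)+(a_\gamma\tilde\partial_t^{\gamma}\bar\partial_tu^h(t_n),v)=(f(t_n),v),$$ where $\bar\partial_tu^h(t_0)=R_hv_0$ and $\bar\partial_tu^h(t_n)=\frac1{2\kappa}(u^h_{n+1}-u^h_{n-1})$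 for $n\ge1$. Put $$\mathcal E_h=\kappa\sum_{j=1}^{N-1}\|(R_h-I)\partial_t^2u(t_j)\|+\|(R_h-I)v_0\|+\tfrac\kappa2\|(R_h-I)\partial_t^2u(0)\|+\kappa\sum_{j=1}^{N-1}\|(R_h-I)\partial_t^{\gamma}\partial_tu(t_j)\|.$$ **Theorem.** There are constants $\bar\kappa,K>0$ depending only on $\Omega,\gamma,\alpha_0,T$, a constant $C>0$ depending only on these and on $\alpha,C_0$, and a constant $\tilde C>0$ depending only on these and on $c_1,\dots,c_4$ (so none of them depends on $\kappa$, $h$, $C_{\rm inv}$ or $V_h$, nor otherwise on $u$ and $f$), such that whenever $0<\kappa<\bar\kappa$ and the CFL condition $\kappa\le\sqrt2\,h/C_{\rm inv}$ holds, for all $n=1,\dots,N$, with $t_{n-\frac12}=t_n-\frac12\kappa$, $$\Bigl\|\frac{u^h_n-u^h_{n-1}}{\kappa}-\partial_tu(t_{n-\frac12})\Bigr\|+\Bigl\|\frac{u^h_n+u^h_{n-1}}2-u(t_{n-\frac12})\Bigr\|\le K\mathcal E_h+\|(R_h-I)\partial_tu(t_{n-\frac12})\|+\|(R_h-I)u(t_{n-\frac12})\|+C(c_3+c_4)\kappa^{1+\alpha}+\tilde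 C\kappa^2$$ and $$\Bigl\|\frac{u^h_n+u^h_{n-1}}2-u(t_{n-\frac12})\Bigr\|_1\le K\mathcal E_h+\|(R_h-I)u(t_{n-\frac12})\|_1+C(c_3+c_4)\kappa^{1+\alpha}+\tilde C\kappa^2.$$ In particular, if $c_3=c_4=0$, the temporal error is $O(\kappa^2)$. -/

import Mathlib

open MeasureTheory
open scoped ContDiff

namespace FracWave

/-- The real Lebesgue space `L²(Ω)` of scalar functions. -/
abbrev L2 {d : ℕ} (Ω : Set (EuclideanSpace ℝ (Fin d))) : Type :=
  Lp ℝ 2 (volume.restrict Ω)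

/-- The Lebesgue space `L²(Ω; ℝᵈ)` of vector fields. -/
abbrev L2Vec {d : ℕ} (Ω : Set (EuclideanSpace ℝ (Fin d))) : Type :=
  Lp (EuclideanSpace ℝ (Fin d)) 2 (volume.restrict Ω)

/-- Pairs (function, vector field) with the Hilbert norm `(‖w‖² + ‖G‖²)^(1/2)`. On a pair
`(w, ∇w)` this is the `H¹(Ω)` norm. -/
abbrev L2Pair {d : ℕ} (Ω : Set (EuclideanSpace ℝ (Fin d))) : Type :=
  WithLp 2 (L2 Ω × L2Vec Ω)

/-- The pairs `(φ, ∇φ)` with `φ ∈ C_c^∞(Ω)`. -/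
def testPairs {d : ℕ} (Ω : Set (EuclideanSpace ℝ (Fin d))) : Set (L2Pair Ω) :=
  {w | ∃ φ : EuclideanSpace ℝ (Fin d) → ℝ, ContDiff ℝ ∞ φ ∧ HasCompactSupport φ ∧
    tsupport φ ⊆ Ω ∧ w.fst =ᵐ[volume.restrict Ω] φ ∧ w.snd =ᵐ[volume.restrict Ω] gradient φ}

/-- The Sobolev space `H₀¹(Ω)`: the closure of `C_c^∞(Ω)` in the `H¹(Ω)` norm, an element `w`
being stored together with its weak gradient as the pair `(w, ∇w)`. The norm of the space is the
`H¹(Ω)` norm `(‖w‖² + ‖∇w‖²)^(1/2)`. -/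
noncomputable abbrev H10 {d : ℕ} (Ω : Set (EuclideanSpace ℝ (Fin d))) : Submodule ℝ (L2Pair Ω) :=
  (Submodule.span ℝ (testPairs Ω)).topologicalClosure

/-- The inclusion `H₀¹(Ω) → L²(Ω)`. -/
noncomputable def toL2 {d : ℕ} (Ω : Set (EuclideanSpace ℝ (Fin d))) : H10 Ω →ₗ[ℝ] L2 Ω where
  toFun w := (w : L2Pair Ω).fst
  map_add' _ _ := rfl
  map_smul' _ _ := rfl

/-- The gradient `H₀¹(Ω) → L²(Ω; ℝᵈ)`. -/
noncomputable def grad {d : ℕ} (Ω : Set (EuclideanSpace ℝ (Fin d))) : H10 Ω →ₗ[ℝ] L2Vec Ω where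
  toFun w := (w : L2Pair Ω).snd
  map_add' _ _ := rfl
  map_smul' _ _ := rfl

theorem exists_galerkin {X E : Type*} [AddCommGroup X] [Module ℝ X] [NormedAddCommGroup E]
    [InnerProductSpace ℝ E] (L : X →ₗ[ℝ] E) (V : Submodule ℝ X) [FiniteDimensional ℝ V] (e : E) :
    ∃ r : V, ∀ v : V, inner ℝ (L r) (L v) = inner ℝ e (L v) := by
  obtain ⟨r, hr, hre⟩ := Submodule.mem_map.1 ((V.map L).starProjection_apply_mem e)
  refine ⟨⟨r, hr⟩, fun v => ?_⟩
  have h := (V.map L).starProjection_inner_eq_zero e (L v) (Submodule.mem_map_of_mem v.2)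
  rw [inner_sub_left, sub_eq_zero] at h
  rw [h, ← hre]

/-- The Ritz projection `R_h w ∈ V`: `(∇ R_h w, ∇ v) = (∇ w, ∇ v)` for all `v ∈ V`. -/
noncomputable def ritz {d : ℕ} {Ω : Set (EuclideanSpace ℝ (Fin d))} (V : Submodule ℝ (H10 Ω))
    [FiniteDimensional ℝ V] (w : H10 Ω) : V :=
  Classical.choose (exists_galerkin (grad Ω) V (grad Ω w))

/-- The `L²(Ω)` projection `P_h g ∈ V`: `(P_h g, v) = (g, v)` for all `v ∈ V`. -/
noncomputable def l2Proj {d : ℕ} {Ω : Set (EuclideanSpace ℝ (Fin d))} (V : Submodule ℝ (H10 Ω))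
    [FiniteDimensional ℝ V] (g : L2 Ω) : V :=
  Classical.choose (exists_galerkin (toL2 Ω) V g)

theorem ritz_spec {d : ℕ} {Ω : Set (EuclideanSpace ℝ (Fin d))} (V : Submodule ℝ (H10 Ω))
    [FiniteDimensional ℝ V] (w : H10 Ω) (v : V) :
    inner ℝ (grad Ω (ritz V w)) (grad Ω v) = inner ℝ (grad Ω w) (grad Ω v) :=
  Classical.choose_spec (exists_galerkin (grad Ω) V (grad Ω w)) v

theorem l2Proj_spec {d : ℕ} {Ω : Set (EuclideanSpace ℝ (Fin d))} (V : Submodule ℝ (H10 Ω))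
    [FiniteDimensional ℝ V] (g : L2 Ω) (v : V) :
    inner ℝ (toL2 Ω (l2Proj V g)) (toL2 Ω v) = inner ℝ g (toL2 Ω v) :=
  Classical.choose_spec (exists_galerkin (toL2 Ω) V g) v

/-- The Riemann-Liouville integral `I_t^β g (t) = Γ(β)⁻¹ ∫₀ᵗ (t - τ)^(β - 1) g(τ) dτ`. -/
noncomputable def rlIntegral {E : Type*} [NormedAddCommGroup E] [NormedSpace ℝ E]
    (β : ℝ) (g : ℝ → E) (t : ℝ) : E :=
  (Real.Gamma β)⁻¹ • ∫ τ in (0 : ℝ)..t, ((t - τ) ^ (β - 1)) • g τ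

/-- The Caputo derivative `∂_t^β g (t)` of order `β > -1` of a function `g` on `[0, T]`. -/
noncomputable def caputo {E : Type*} [NormedAddCommGroup E] [NormedSpace ℝ E]
    (T β : ℝ) (g : ℝ → E) (t : ℝ) : E :=
  if β < 0 then rlIntegral (-β) g t
  else if β = (⌈β⌉₊ : ℝ) then iteratedDerivWithin ⌈β⌉₊ g (Set.Icc 0 T) t
  else rlIntegral ((⌈β⌉₊ : ℝ) - β) (iteratedDerivWithin ⌈β⌉₊ g (Set.Icc 0 T)) t

/-- The damping coefficient `a_γ = -α₀ (4/π) Γ(-γ-1) Γ(γ+2) cos((γ+1)π/2)`. -/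
noncomputable def dampingCoeff (α₀ γ : ℝ) : ℝ :=
  -α₀ * (4 / Real.pi) * Real.Gamma (-γ - 1) * Real.Gamma (γ + 2) *
    Real.cos ((γ + 1) * Real.pi / 2)

/-- `u : [0, T] → H₀¹(Ω)` is a solution, twice differentiable in time, of the weak formulation
`(∂_t² u, v) + (∇u, ∇v) + (a_γ ∂_t^(γ+1) u, v) = (f, v)` for all `v ∈ H₀¹(Ω)`, with
`u(0) = u₀` and `∂_t u(0) = v₀`. -/
structure IsWeakSolution {d : ℕ} (Ω : Set (EuclideanSpace ℝ (Fin d))) (γ α₀ T : ℝ)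
    (f : ℝ → L2 Ω) (u₀ v₀ : H10 Ω) (u : ℝ → H10 Ω) : Prop where
  initial : u 0 = u₀
  initial_deriv : derivWithin u (Set.Icc 0 T) 0 = v₀
  equation : ∀ t ∈ Set.Ioc 0 T, ∀ v : H10 Ω,
    inner ℝ (toL2 Ω (iteratedDerivWithin 2 u (Set.Icc 0 T) t)) (toL2 Ω v) +
      inner ℝ (grad Ω (u t)) (grad Ω v) +
      dampingCoeff α₀ γ * inner ℝ (toL2 Ω (caputo T (γ + 1) u t)) (toL2 Ω v) =
    inner ℝ (f t) (toL2 Ω v)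

/-- The smoothness assumption: `u ∈ C²([0,T]; H¹)`, `u ∈ C⁴((0,T]; H¹)` and
`‖∂_t^k u(t)‖₁ ≤ C₀ (1 + c_k t^(2+α-k))` for `0 < t ≤ T` and `k = 0, …, 4`. -/
structure IsSmooth {d : ℕ} {Ω : Set (EuclideanSpace ℝ (Fin d))} (T α C₀ : ℝ) (c : Fin 5 → ℝ)
    (u : ℝ → H10 Ω) : Prop where
  contDiffOn_two : ContDiffOn ℝ 2 u (Set.Icc 0 T)
  contDiffOn_four : ContDiffOn ℝ 4 u (Set.Ioc 0 T)
  bound : ∀ k : Fin 5, ∀ t ∈ Set.Ioc 0 T,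
    ‖iteratedDerivWithin (k : ℕ) u (Set.Ioc 0 T) t‖ ≤
      C₀ * (1 + c k * t ^ (2 + α - ((k : ℕ) : ℝ)))

/-- The BDF2 convolution quadrature weight `ω_j`: the coefficient of `ζ^j` in the Taylor series
at `0` of `(δ(ζ)/κ)^γ`, where `δ(ζ) = 3/2 - 2ζ + ζ²/2`. -/
noncomputable def cqWeight (κ γ : ℝ) (j : ℕ) : ℝ :=
  iteratedDeriv j (fun ζ : ℝ => ((3 / 2 - 2 * ζ + 1 / 2 * ζ ^ 2) / κ) ^ γ) 0 / (j.factorial : ℝ)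

/-- The correction weight `w_{n1}` (at `t_n = nκ`), which makes the quadrature exact on linear
functions if `γ ∈ (0, 1)`, and is not used if `γ < 0`. -/
noncomputable def corrWeight1 (κ γ : ℝ) (n : ℕ) : ℝ :=
  if γ < 0 then 0
  else κ⁻¹ * ((n * κ) ^ (1 - γ) / Real.Gamma (2 - γ) -
    ∑ j ∈ Finset.range (n + 1), (n * κ - j * κ) * cqWeight κ γ j)

/-- The correction weight `w_{n0}` (at `t_n = nκ`), which makes the quadrature exact on
constants. -/
noncomputable def corrWeight0 (κ γ : ℝ) (n : ℕ) : ℝ :=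
  if γ < 0 then
    (n * κ) ^ (-γ) / Real.Gamma (1 - γ) - ∑ j ∈ Finset.range (n + 1), cqWeight κ γ j
  else -(∑ j ∈ Finset.range (n + 1), cqWeight κ γ j) - corrWeight1 κ γ n

/-- The corrected convolution quadrature approximation of `∂_t^γ g (t_n)` for a sequence `g`:
`∑_{j=0}^n ω_{n-j} g_j + w_{n0} g_0 + w_{n1} g_1`. -/
noncomputable def correctedCQ {E : Type*} [AddCommGroup E] [Module ℝ E]
    (κ γ : ℝ) (g : ℕ → E) (n : ℕ) : E :=
  ∑ j ∈ Finset.range (n + 1), cqWeight κ γ (n - j) • g j +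
    corrWeight0 κ γ n • g 0 + corrWeight1 κ γ n • g 1

/-- The central difference of a sequence `U`, with the prescribed value `z` at time `0`. -/
noncomputable def centralDiff {E : Type*} [AddCommGroup E] [Module ℝ E]
    (κ : ℝ) (z : E) (U : ℕ → E) : ℕ → E
  | 0 => z
  | n + 1 => (2 * κ)⁻¹ • (U (n + 2) - U n)

/-- `U 0, …, U N ∈ V` is the solution of the corrected fully discrete system with time step `κ`:
for `n = 1, …, N - 1` and all `v ∈ V`
`κ⁻² (U_{n+1} - 2 U_n + U_{n-1}, v) + (∇U_n, ∇v) + (a_γ ∂̃_t^γ ∂̄_t U(t_n), v) = (f(t_n), v)`,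
started from `U_0 = R_h u₀`, `U_1 = R_h (u₀ + κ v₀) + κ²/2 P_h ∂_t² u(0)`, with
`∂̄_t U(0) = R_h v₀`. The argument `z₀` stands for `∂_t² u(0)`. -/
structure IsCorrectedScheme {d : ℕ} {Ω : Set (EuclideanSpace ℝ (Fin d))}
    (γ α₀ κ : ℝ) (N : ℕ) (f : ℝ → L2 Ω) (u₀ v₀ z₀ : H10 Ω) (V : Submodule ℝ (H10 Ω))
    [FiniteDimensional ℝ V] (U : ℕ → V) : Prop where
  start_zero : U 0 = ritz V u₀
  start_one : U 1 = ritz V (u₀ + κ • v₀) + (κ ^ 2 / 2) • l2Proj V (toL2 Ω z₀)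
  step : ∀ n : ℕ, 1 ≤ n → n ≤ N - 1 → ∀ v : V,
    (κ ^ 2)⁻¹ * inner ℝ (toL2 Ω (U (n + 1) - (2 : ℝ) • U n + U (n - 1) : V)) (toL2 Ω v) +
      inner ℝ (grad Ω (U n)) (grad Ω v) +
      dampingCoeff α₀ γ *
        inner ℝ (toL2 Ω (correctedCQ κ γ (centralDiff κ (ritz V v₀) U) n : V)) (toL2 Ω v) =
    inner ℝ (f (n * κ)) (toL2 Ω v)

/-- The `L²(Ω)` norm `‖(R_h - I) w‖`. -/
noncomputable def ritzErrL2 {d : ℕ} {Ω : Set (EuclideanSpace ℝ (Fin d))}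
    (V : Submodule ℝ (H10 Ω)) [FiniteDimensional ℝ V] (w : H10 Ω) : ℝ :=
  ‖toL2 Ω ((ritz V w : H10 Ω) - w)‖

/-- The `H¹(Ω)` norm `‖(R_h - I) w‖₁`. -/
noncomputable def ritzErrH1 {d : ℕ} {Ω : Set (EuclideanSpace ℝ (Fin d))}
    (V : Submodule ℝ (H10 Ω)) [FiniteDimensional ℝ V] (w : H10 Ω) : ℝ :=
  ‖(ritz V w : H10 Ω) - w‖

/-- The spatial error
`κ ∑_{j=1}^{N-1} ‖(R_h-I) ∂_t² u(t_j)‖ + ‖(R_h-I) v₀‖ + κ/2 ‖(R_h-I) u''(0)‖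
  + κ ∑_{j=1}^{N-1} ‖(R_h-I) ∂_t^γ ∂_t u(t_j)‖`. -/
noncomputable def spatialError {d : ℕ} {Ω : Set (EuclideanSpace ℝ (Fin d))}
    (γ T κ : ℝ) (N : ℕ) (v₀ : H10 Ω) (u : ℝ → H10 Ω) (V : Submodule ℝ (H10 Ω))
    [FiniteDimensional ℝ V] : ℝ :=
  κ * ∑ j ∈ Finset.Icc 1 (N - 1),
      ritzErrL2 V (iteratedDerivWithin 2 u (Set.Icc 0 T) (j * κ)) +
    ritzErrL2 V v₀ +
    κ / 2 * ritzErrL2 V (iteratedDerivWithin 2 u (Set.Icc 0 T) 0) +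
    κ * ∑ j ∈ Finset.Icc 1 (N - 1),
      ritzErrL2 V (caputo T γ (derivWithin u (Set.Icc 0 T)) (j * κ))

end FracWave

open FracWave

/-!
The error `e_n = U_n - R_h u(t_n)` against the Ritz projection solves the scheme itself, with
`e_0 = 0` and with the consistency error and the Ritz error as right-hand side
(`IsCorrectedScheme.error_equation`). The estimate is thus a stability bound for the scheme plus a
bound for the consistency error, and the constants have to be uniform in the step size.

*Stability* (`energy_estimate`). The error equation is tested with the central difference of `e`.
The leapfrog part telescopes to the energy `‖v_n‖² / 2 + (∇e_n, ∇e_{n+1}) / 2`, which the CFL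
condition makes coercive. The damping term has a favourable sign, because
`a_γ = 2 α₀ / sin ((γ + 1) π / 2) > 0` (`dampingCoeff_pos`) and because `δ(ζ)^γ` has nonnegative
real part in the unit disc, so that its Toeplitz form is nonnegative (`re_bdf_nonneg`,
`bdfWeight_positive`). The correction term has no sign, but it is a small multiple of the kinetic
energy as soon as `κ` is small (`exists_corrWeight1_small`); this is where `κ̄` comes from.

*The quadrature weights.* As `δ(ζ) = (1 - ζ) (3 - ζ) / 2`, the weights are the Taylor coefficients
of `(1 - ζ)^γ` times those of a function which is analytic in `|ζ| < 3` (`cqWeight_eq`). The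
singularity at `ζ = 1` alone decides their asymptotics; `cesaro_conv_expansion` turns this into
`∑ ω_{n-j} t_j^k / k! = t_n^{k-γ} / Γ(k + 1 - γ) + …` with a remainder two powers of `n` smaller
than the main term, for `k = 1, 2` (one power smaller for `k = 0`). The quadrature errors for `t`
and `t² / 2` are the Peano kernels of the quadrature, and these decay like `n^{-γ-1}` and `n^{-γ}`
(`exists_peano_bound`, `exists_peano₂_bound`).

*Consistency* (`exists_consistency_bound`). The corrected quadrature is exact on constants, and on
linear functions if `γ > 0`, so its error is the integral of the Peano kernel against `∂_t³u`
(`caputo_sub_correctedCQ_neg`, `caputo_sub_correctedCQ_pos`). For `γ < 0` a discrete Young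
inequality gives `O(κ²)` directly. For `γ > 0` the kernel has to be integrated once more, which
needs `∂_t⁴u`; as this need not be integrable at `t = 0`, the first time step is kept apart. The
error of the central difference inside the quadrature is treated in the same way, with a summation
by parts in place of the integration by parts (`exists_defect_bound_pos`).

The regularity hypothesis enters only through four numbers, collected in `GridBounds`, which are
bounded in `TimeReg.exists_gridBounds`: the singularity at `t = 0` accounts for `κ^{1+α}`, with a
factor `c₃ + c₄`, and everything else for `κ²`. The Poincaré inequality (`exists_poincare`) makes
the Ritz projection linear and bounded, and `midpoint_error` passes from `e_n` to the errors at
the midpoints.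
-/

namespace FracWave

/-! ### Cesàro numbers -/

open Filter Topology Asymptotics Finset

/-- The Taylor coefficients `(β)_n / n!` of `(1 - ζ)^(-β)`. -/
noncomputable def cesaro (β : ℝ) (n : ℕ) : ℝ := ∏ i ∈ range n, (β + i) / (i + 1)

@[simp] lemma cesaro_zero (β : ℝ) : cesaro β 0 = 1 := by simp [cesaro]

lemma cesaro_succ (β : ℝ) (n : ℕ) : cesaro β (n + 1) = cesaro β n * ((β + n) / (n + 1)) := by
  rw [cesaro, cesaro, prod_range_succ]

lemma cesaro_pos {β : ℝ} (hβ : 0 < β) (n : ℕ) : 0 < cesaro β n :=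
  prod_pos fun i _ => by positivity

lemma cesaro_sub_one (β : ℝ) (n : ℕ) :
    (β - 1) * cesaro β n = (β - 1 + n) * cesaro (β - 1) n := by
  induction n with
  | zero => simp
  | succ n ih =>
    have h : ((n : ℝ) + 1) ≠ 0 := by positivity
    rw [cesaro_succ, cesaro_succ, ← mul_assoc, ih]
    push_cast
    field_simp
    ring

/-- The coefficient form of `(1 - ζ) (1 - ζ)^(-β) = (1 - ζ)^(1-β)`. -/
lemma cesaro_pascal (β : ℝ) (n : ℕ) :
    cesaro β (n + 1) - cesaro β n = cesaro (β - 1) (n + 1) := by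
  have h : ((n : ℝ) + 1) ≠ 0 := by positivity
  have h1 := cesaro_sub_one β n
  rw [cesaro_succ, cesaro_succ]
  have : cesaro (β - 1) n * ((β - 1 + n) / (n + 1)) = (β - 1) * cesaro β n / (n + 1) := by
    rw [h1]; ring
  rw [this]
  field_simp
  ring

lemma prod_eq_factorial_mul_cesaro (β : ℝ) (n : ℕ) :
    ∏ j ∈ range n, (β + j) = n.factorial * cesaro β n := by
  induction n with
  | zero => simp
  | succ n ih =>
    have h : ((n : ℝ) + 1) ≠ 0 := by positivity
    rw [prod_range_succ, ih, cesaro_succ, Nat.factorial_succ]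
    push_cast
    field_simp

/-- Euler's limit formula for the Gamma function: `cesaro β n ~ n^(β-1) / Γ(β)`. -/
lemma tendsto_cesaro {β : ℝ} (hβ : 0 < β) :
    Tendsto (fun n : ℕ => Real.Gamma β * cesaro β n / (n : ℝ) ^ (β - 1)) atTop (𝓝 1) := by
  have hG := Real.Gamma_pos_of_pos hβ
  have h1 := Real.GammaSeq_tendsto_Gamma β
  have h2 : Tendsto (fun n : ℕ => (n : ℝ) / (n + β)) atTop (𝓝 1) :=
    tendsto_natCast_div_add_atTop β
  have h3 := (h2.div h1 hG.ne').const_mul (Real.Gamma β)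
  rw [one_div, mul_inv_cancel₀ hG.ne'] at h3
  refine h3.congr' ?_
  filter_upwards [eventually_gt_atTop 0] with n hn
  have hn' : (0 : ℝ) < n := by exact_mod_cast hn
  have hc := cesaro_pos hβ n
  have hf : (0 : ℝ) < n.factorial := by exact_mod_cast n.factorial_pos
  simp only [Pi.div_apply, Real.GammaSeq]
  rw [prod_range_succ, prod_eq_factorial_mul_cesaro, Real.rpow_sub_one hn'.ne']
  have := Real.rpow_pos_of_pos hn' β
  field_simp
  ring

lemma log_one_add_div_expansion (a : ℝ) :
    (fun n : ℕ => Real.log (1 + a / n) - a / n + a ^ 2 / (2 * (n : ℝ) ^ 2)) =O[atTop]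
      fun n : ℕ => ((n : ℝ) ^ 3)⁻¹ := by
  refine IsBigO.of_bound (2 * |a| ^ 3) ?_
  filter_upwards [eventually_gt_atTop 0, eventually_ge_atTop ⌈2 * |a|⌉₊] with n hn hna
  have hn' : (0 : ℝ) < n := by exact_mod_cast hn
  have hna' : 2 * |a| ≤ n := Nat.ceil_le.1 hna
  have hx : |-(a / n)| ≤ 1 / 2 := by
    rw [abs_neg, abs_div, abs_of_pos hn', div_le_div_iff₀ hn' (by norm_num)]; linarith
  have h := Real.abs_log_sub_add_sum_range_le (x := -(a / n)) (by linarith) 2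
  rw [show (∑ i ∈ range 2, (-(a / n)) ^ (i + 1) / ((i : ℝ) + 1)) + Real.log (1 - -(a / n)) =
    Real.log (1 + a / n) - a / n + a ^ 2 / (2 * (n : ℝ) ^ 2) by
      simp only [sum_range_succ, range_zero, sum_empty]
      push_cast
      rw [sub_neg_eq_add]; field_simp; ring] at h
  rw [Real.norm_eq_abs]
  refine h.trans ?_
  rw [Real.norm_of_nonneg (by positivity), div_le_iff₀ (by linarith)]
  have e : |-(a / n)| ^ (2 + 1) = |a| ^ 3 * ((n : ℝ) ^ 3)⁻¹ := by
    rw [abs_neg, abs_div, abs_of_pos hn', div_pow, div_eq_mul_inv]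
  rw [e]
  have : 0 ≤ |a| ^ 3 * ((n : ℝ) ^ 3)⁻¹ := by positivity
  nlinarith

/-- Telescoping: a null sequence with increments `O(n⁻³)` is `O(n⁻²)`. -/
lemma isBigO_of_increment {f : ℕ → ℝ} (h0 : Tendsto f atTop (𝓝 0))
    (hf : (fun n => f (n + 1) - f n) =O[atTop] fun n : ℕ => ((n : ℝ) ^ 3)⁻¹) :
    f =O[atTop] fun n : ℕ => ((n : ℝ) ^ 2)⁻¹ := by
  obtain ⟨C, hC, hb⟩ := hf.exists_pos
  obtain ⟨N, hN⟩ := eventually_atTop.1 hb.bound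
  refine IsBigO.of_bound (2 * C) (eventually_atTop.2 ⟨N + 1, fun n hn => ?_⟩)
  have key : ∀ M : ℕ, n ≤ M → |f n - f M| ≤ 2 * C * (((n : ℝ) ^ 2)⁻¹ - ((M : ℝ) ^ 2)⁻¹) := by
    intro M hM
    induction M, hM using Nat.le_induction with
    | base => simp
    | succ M hM ih =>
      have h1 := hN M (by omega)
      have hM' : (1 : ℝ) ≤ M := by exact_mod_cast (by omega : 1 ≤ M)
      rw [Real.norm_eq_abs, Real.norm_of_nonneg (by positivity)] at h1
      have h2 : ((M : ℝ) ^ 3)⁻¹ ≤ 2 * (((M : ℝ) ^ 2)⁻¹ - (((M + 1 : ℕ) : ℝ) ^ 2)⁻¹) := by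
        push_cast
        rw [inv_sub_inv (by positivity) (by positivity), inv_eq_one_div, mul_div_assoc',
          div_le_div_iff₀ (by positivity) (by positivity)]
        have : 0 ≤ (M : ℝ) ^ 2 * (3 * (M : ℝ) ^ 2 - 1) :=
          mul_nonneg (by positivity) (by nlinarith)
        nlinarith
      calc |f n - f (M + 1)| ≤ |f n - f M| + |f (M + 1) - f M| := by
            rw [abs_sub_comm (f (M + 1))]; exact abs_sub_le _ _ _
        _ ≤ _ := by nlinarith
  have lim : Tendsto (fun M => |f n - f M|) atTop (𝓝 |f n - 0|) :=
    (tendsto_const_nhds.sub h0).abs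
  rw [sub_zero] at lim
  rw [Real.norm_eq_abs, Real.norm_of_nonneg (by positivity)]
  refine le_of_tendsto lim (eventually_atTop.2 ⟨n, fun M hM => (key M hM).trans ?_⟩)
  have : 0 ≤ ((M : ℝ) ^ 2)⁻¹ := by positivity
  nlinarith

/-- Half a step of `cesaro (β - 1)` is exactly what turns `Γ(β)⁻¹ n^(β-1)` into a second order
approximation of `cesaro β`. -/
lemma cesaro_expansion {β : ℝ} (hβ : 0 < β) :
    (fun n : ℕ => cesaro β n - β / 2 * cesaro (β - 1) n - (n : ℝ) ^ (β - 1) / Real.Gamma β)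
      =O[atTop] fun n : ℕ => (n : ℝ) ^ (β - 3) := by
  have hG := Real.Gamma_pos_of_pos hβ
  set σ : ℝ := β * (β - 1) / 2 with hσ
  -- the logarithm of the quotient of the two sides
  set f : ℕ → ℝ := fun n => Real.log (Real.Gamma β * cesaro β n / (n : ℝ) ^ (β - 1)) +
    (Real.log (1 + (β - 1 - σ) / n) - Real.log (1 + (β - 1) / n)) with hf
  have tl : ∀ a : ℝ, Tendsto (fun n : ℕ => 1 + a / (n : ℝ)) atTop (𝓝 1) := fun a => by
    simpa using (tendsto_const_nhds (x := (1 : ℝ))).add (tendsto_const_div_atTop_nhds_zero_nat a)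
  have tlog : ∀ a : ℝ, Tendsto (fun n : ℕ => Real.log (1 + a / (n : ℝ))) atTop (𝓝 0) := fun a => by
    simpa using (tl a).log one_ne_zero
  have pos : ∀ a : ℝ, ∀ᶠ n : ℕ in atTop, 0 < 1 + a / (n : ℝ) := fun a =>
    (tl a).eventually (lt_mem_nhds one_pos)
  have f0 : Tendsto f atTop (𝓝 0) := by
    simpa using ((tendsto_cesaro hβ).log one_ne_zero).add
      ((tlog (β - 1 - σ)).sub (tlog (β - 1)))
  have fO : f =O[atTop] fun n : ℕ => ((n : ℝ) ^ 2)⁻¹ := by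
    refine isBigO_of_increment f0 ?_
    have e := ((log_one_add_div_expansion (β - σ)).sub
      (log_one_add_div_expansion (β - 1 - σ))).add
      ((log_one_add_div_expansion (β - 1)).sub ((log_one_add_div_expansion 1).const_mul_left β))
    refine e.congr' ?_ EventuallyEq.rfl
    have pos' := (tendsto_add_atTop_nat 1).eventually (pos (β - 1 - σ))
    filter_upwards [eventually_gt_atTop 0, pos (β - σ), pos (β - 1 - σ), pos (β - 1), pos']
      with n hn p1 p2 p3 p4
    have hn' : (0 : ℝ) < n := by exact_mod_cast hn
    have hc := cesaro_pos hβ n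
    have hn1 : (0 : ℝ) < n + 1 := by positivity
    have L : ∀ a : ℝ, 0 < 1 + a / (n : ℝ) →
        Real.log (n + a) = Real.log n + Real.log (1 + a / n) := fun a ha => by
      rw [← Real.log_mul hn'.ne' ha.ne']; congr 1; field_simp
    have np : ∀ a : ℝ, 0 < 1 + a / (n : ℝ) → 0 < (n : ℝ) + a := fun a ha => by
      have := mul_pos hn' ha
      rwa [mul_add, mul_one, mul_div_cancel₀ _ hn'.ne'] at this
    simp only [hf]
    push_cast
    rw [cesaro_succ, Real.log_div (by positivity) (by positivity),
      Real.log_div (by positivity) (by positivity), Real.log_mul hG.ne' (by positivity),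
      Real.log_mul hc.ne' (by positivity), Real.log_mul hG.ne' hc.ne', Real.log_rpow hn',
      Real.log_rpow hn1, Real.log_div (by positivity) hn1.ne',
      show 1 + (β - 1 - σ) / ((n : ℝ) + 1) = (n + (β - σ)) / (n + 1) by field_simp; ring,
      show 1 + (β - 1) / ((n : ℝ) + 1) = (β + n) / (n + 1) by field_simp; ring,
      Real.log_div (np _ p1).ne' hn1.ne', Real.log_div (by positivity) hn1.ne',
      L _ p1, L 1 (by positivity)]
    have hs : σ = β * (β - 1) / 2 := hσ
    have hq : (β - σ) ^ 2 - (β - 1 - σ) ^ 2 + (β - 1) ^ 2 - β = 0 := by rw [hs]; ring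
    field_simp
    linear_combination hq
  have qO : (fun n => Real.exp (f n) - 1) =O[atTop] fun n : ℕ => ((n : ℝ) ^ 2)⁻¹ := by
    refine IsBigO.trans (IsBigO.of_bound 2 ?_) fO
    filter_upwards [f0.eventually (Metric.ball_mem_nhds 0 one_pos)] with n hn
    have hn : |f n| ≤ 1 := by simpa using (Metric.mem_ball.1 hn).le
    exact Real.abs_exp_sub_one_le hn
  have h := (isBigO_refl (fun n : ℕ => (n : ℝ) ^ (β - 1) / Real.Gamma β) atTop).mul qO
  refine (h.congr' ?_ EventuallyEq.rfl).trans ?_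
  · filter_upwards [eventually_gt_atTop 0, pos (β - 1 - σ), pos (β - 1)] with n hn p2 p3
    have hn' : (0 : ℝ) < n := by exact_mod_cast hn
    have hc := cesaro_pos hβ n
    have hp := Real.rpow_pos_of_pos hn' (β - 1)
    have h1 : 0 < β - 1 + n := by
      have := mul_pos hn' p3
      rw [mul_add, mul_one, mul_div_cancel₀ _ hn'.ne'] at this; linarith
    have hs := cesaro_sub_one β n
    have hb : cesaro (β - 1) n = (β - 1) * cesaro β n / (β - 1 + n) := by
      rw [hs]; field_simp
    simp only [hf]
    rw [Real.exp_add, Real.exp_sub, Real.exp_log (by positivity), Real.exp_log p2,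
      Real.exp_log p3, hb, mul_sub, mul_one]
    have p3' := p3.ne'
    have e1 : 1 + (β - 1) / (n : ℝ) = (β - 1 + n) / n := by field_simp; ring
    rw [e1, hσ]
    field_simp
    ring
  · refine IsBigO.of_bound (1 / Real.Gamma β) ?_
    filter_upwards [eventually_gt_atTop 0] with n hn
    have hn' : (0 : ℝ) < n := by exact_mod_cast hn
    rw [Real.norm_of_nonneg (by positivity), Real.norm_of_nonneg (by positivity),
      show β - 3 = β - 1 - (2 : ℕ) by push_cast; ring, Real.rpow_sub_natCast hn'.ne']
    apply le_of_eq
    field_simp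

lemma cesaro_isBigO {β : ℝ} (hβ : 0 < β) :
    cesaro β =O[atTop] fun n : ℕ => (n : ℝ) ^ (β - 1) := by
  have hG := Real.Gamma_pos_of_pos hβ
  refine IsBigO.of_bound (2 / Real.Gamma β) ?_
  filter_upwards [eventually_gt_atTop 0, (tendsto_cesaro hβ).eventually (gt_mem_nhds one_lt_two)]
    with n hn h
  have hn' : (0 : ℝ) < n := by exact_mod_cast hn
  have hp := Real.rpow_pos_of_pos hn' (β - 1)
  rw [Real.norm_of_nonneg (cesaro_pos hβ n).le, Real.norm_of_nonneg hp.le]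
  rw [div_lt_iff₀ hp] at h
  rw [div_mul_eq_mul_div, le_div_iff₀ hG]
  linarith

lemma cesaro_sub_one_isBigO {β : ℝ} (hβ : 0 < β) :
    cesaro (β - 1) =O[atTop] fun n : ℕ => (n : ℝ) ^ (β - 2) := by
  refine IsBigO.trans (IsBigO.of_bound (2 * |β - 1|) ?_ :
    cesaro (β - 1) =O[atTop] fun n : ℕ => cesaro β n * (n : ℝ)⁻¹)
    (((cesaro_isBigO hβ).mul (isBigO_refl _ _)).trans ?_)
  · filter_upwards [eventually_ge_atTop 2] with n hn
    have hn' : (2 : ℝ) ≤ n := by exact_mod_cast hn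
    have hc := cesaro_pos hβ n
    have h1 : 0 < β - 1 + n := by linarith
    have hb : cesaro (β - 1) n = (β - 1) * cesaro β n / (β - 1 + n) := by
      rw [cesaro_sub_one β n]; field_simp
    rw [hb, Real.norm_eq_abs, abs_div, abs_mul, abs_of_pos hc, abs_of_pos h1,
      Real.norm_of_nonneg (by positivity), div_le_iff₀ h1]
    have : 1 ≤ 2 * (n : ℝ)⁻¹ * (β - 1 + n) := by
      have : (n : ℝ) * (n : ℝ)⁻¹ = 1 := mul_inv_cancel₀ (by positivity)
      have h3 : 0 < (n : ℝ)⁻¹ := by positivity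
      nlinarith
    have h0 : 0 ≤ |β - 1| * cesaro β n := by positivity
    nlinarith
  · refine IsBigO.of_bound 1 ?_
    filter_upwards [eventually_gt_atTop 0] with n hn
    have hn' : (0 : ℝ) < n := by exact_mod_cast hn
    rw [show β - 2 = β - 1 - 1 by ring, Real.rpow_sub_one hn'.ne' (β - 1), one_mul, div_eq_mul_inv]

end FracWave

namespace FracWave

/-! ### Decay of discrete convolutions with exponentially small sequences -/

open Filter Topology Asymptotics Finset

/-- The bracket `max(1, n)^e`, a version of `n^e` without the singularity at `n = 0`. -/
noncomputable def brk (e : ℝ) (n : ℕ) : ℝ := (max 1 (n : ℝ)) ^ e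

lemma brk_pos (e : ℝ) (n : ℕ) : 0 < brk e n :=
  Real.rpow_pos_of_pos (lt_max_of_lt_left one_pos) _

@[simp] lemma brk_zero (e : ℝ) : brk e 0 = 1 := by simp [brk]

lemma brk_of_pos (e : ℝ) {n : ℕ} (hn : 1 ≤ n) : brk e n = (n : ℝ) ^ e := by
  rw [brk, max_eq_right (by exact_mod_cast hn)]

lemma exists_bound_brk {f : ℕ → ℝ} {e : ℝ} (h : f =O[atTop] fun n : ℕ => (n : ℝ) ^ e) :
    ∃ C > 0, ∀ n, |f n| ≤ C * brk e n := by
  have h' : f =O[atTop] brk e := by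
    refine h.congr' EventuallyEq.rfl ?_
    filter_upwards [eventually_ge_atTop 1] with n hn
    rw [brk_of_pos e hn]
  obtain ⟨C, hC, hb⟩ := bound_of_isBigO_nat_atTop h'
  refine ⟨C, hC, fun n => ?_⟩
  have := hb (brk_pos e n).ne'
  rwa [Real.norm_eq_abs, Real.norm_of_nonneg (brk_pos e n).le] at this

lemma isBigO_of_bound_brk {f : ℕ → ℝ} {e C : ℝ} (h : ∀ n, |f n| ≤ C * brk e n) :
    f =O[atTop] fun n : ℕ => (n : ℝ) ^ e := by
  refine IsBigO.of_bound C ?_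
  filter_upwards [eventually_ge_atTop 1] with n hn
  rw [← brk_of_pos e hn, Real.norm_eq_abs, Real.norm_of_nonneg (brk_pos e n).le]
  exact h n

/-- A power series whose coefficients are `O(3⁻ⁿ)`. -/
def ExpSmall (P : PowerSeries ℝ) : Prop := ∃ C, ∀ n, |P.coeff n| ≤ C * (1 / 3) ^ n

lemma ExpSmall.summable {P : PowerSeries ℝ} (h : ExpSmall P) : Summable fun n => P.coeff n := by
  obtain ⟨C, hC⟩ := h
  exact Summable.of_norm_bounded
    ((summable_geometric_of_lt_one (by norm_num) (by norm_num : (1 / 3 : ℝ) < 1)).mul_left C) hC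

lemma ExpSmall.summable_mul {P : PowerSeries ℝ} (h : ExpSmall P) :
    Summable fun n : ℕ => (n : ℝ) * P.coeff n := by
  obtain ⟨C, hC⟩ := h
  have hs := (summable_pow_mul_geometric_of_norm_lt_one 1
    (by norm_num : ‖(1 / 3 : ℝ)‖ < 1)).mul_left C
  refine Summable.of_norm_bounded hs fun n => ?_
  rw [Real.norm_eq_abs, abs_mul, Nat.abs_cast, pow_one]
  nlinarith [hC n, (Nat.cast_nonneg n : (0 : ℝ) ≤ n)]

lemma ExpSmall.add {P Q : PowerSeries ℝ} (hP : ExpSmall P) (hQ : ExpSmall Q) :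
    ExpSmall (P + Q) := by
  obtain ⟨C, hC⟩ := hP
  obtain ⟨D, hD⟩ := hQ
  refine ⟨C + D, fun n => ?_⟩
  rw [map_add, add_mul]
  exact (abs_add_le _ _).trans (add_le_add (hC n) (hD n))

lemma ExpSmall.C_mul {P : PowerSeries ℝ} (hP : ExpSmall P) (a : ℝ) :
    ExpSmall (PowerSeries.C a * P) := by
  obtain ⟨C, hC⟩ := hP
  refine ⟨|a| * C, fun n => ?_⟩
  rw [PowerSeries.coeff_C_mul, abs_mul, mul_assoc]
  exact mul_le_mul_of_nonneg_left (hC n) (abs_nonneg a)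

lemma ExpSmall.X_mul {P : PowerSeries ℝ} (hP : ExpSmall P) : ExpSmall (PowerSeries.X * P) := by
  obtain ⟨C, hC⟩ := hP
  have hC0 : 0 ≤ C := by simpa using (abs_nonneg _).trans (hC 0)
  refine ⟨3 * C, fun n => ?_⟩
  cases n with
  | zero => simpa using hC0
  | succ n =>
    rw [mul_comm, PowerSeries.coeff_succ_mul_X, pow_succ]
    linarith [hC n]

lemma ExpSmall.one : ExpSmall 1 := by
  refine ⟨1, fun n => ?_⟩
  rw [PowerSeries.coeff_one]
  split_ifs with h
  · simp [h]
  · simp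

/-- A rapidly decaying power series which vanishes at `1` is divisible by `1 - X`. -/
lemma ExpSmall.exists_div {P : PowerSeries ℝ} (h : ExpSmall P)
    (h0 : HasSum (fun n => P.coeff n) 0) :
    ∃ D : PowerSeries ℝ, ExpSmall D ∧ (1 - PowerSeries.X) * D = P ∧
      ∀ n, D.coeff n = ∑ m ∈ range (n + 1), P.coeff m := by
  have hs := h.summable
  obtain ⟨C, hC⟩ := h
  refine ⟨PowerSeries.mk fun n => ∑ m ∈ range (n + 1), P.coeff m, ⟨C / 2, fun n => ?_⟩, ?_,
    fun n => by simp⟩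
  · have h1 := hs.sum_add_tsum_nat_add (n + 1)
    rw [h0.tsum_eq] at h1
    rw [PowerSeries.coeff_mk, eq_neg_of_add_eq_zero_left h1, abs_neg]
    have hg : HasSum (fun i : ℕ => C * (1 / 3 : ℝ) ^ (i + (n + 1))) (C / 2 * (1 / 3) ^ n) := by
      have h2 := (hasSum_geometric_of_lt_one (by norm_num)
        (by norm_num : (1 / 3 : ℝ) < 1)).mul_left (C * (1 / 3) ^ (n + 1))
      have e1 : (fun i : ℕ => C * (1 / 3 : ℝ) ^ (i + (n + 1))) =
          fun i => C * (1 / 3) ^ (n + 1) * (1 / 3) ^ i := by funext i; ring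
      have e2 : C / 2 * (1 / 3 : ℝ) ^ n = C * (1 / 3) ^ (n + 1) * (1 - 1 / 3)⁻¹ := by ring
      rw [e1, e2]
      exact h2
    refine (Real.norm_eq_abs _).symm.le.trans (tsum_of_norm_bounded hg fun i => ?_)
    exact hC (i + (n + 1))
  · ext n
    rw [sub_mul, one_mul, map_sub, PowerSeries.coeff_mk]
    cases n with
    | zero => simp
    | succ n =>
      rw [mul_comm, PowerSeries.coeff_succ_mul_X, PowerSeries.coeff_mk, sum_range_succ]
      ring

/-- A rapidly decaying power series with a double zero at `1` is divisible by `(1 - X)²`. The second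
hypothesis says that the derivative vanishes at `1`; by summation by parts it is the vanishing at
`1` of the first quotient. -/
lemma ExpSmall.exists_div_sq {P : PowerSeries ℝ} (h : ExpSmall P)
    (h0 : HasSum (fun n => P.coeff n) 0) (h1 : HasSum (fun n : ℕ => (n : ℝ) * P.coeff n) 0) :
    ∃ D : PowerSeries ℝ, ExpSmall D ∧ (1 - PowerSeries.X) ^ 2 * D = P := by
  obtain ⟨E, hE, hEP, hEc⟩ := h.exists_div h0
  have key : ∀ N : ℕ, ∑ n ∈ range N, E.coeff n =
      N * E.coeff N - ∑ m ∈ range (N + 1), (m : ℝ) * P.coeff m := by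
    intro N
    induction N with
    | zero => simp
    | succ N ih =>
      have e : E.coeff (N + 1) = E.coeff N + P.coeff (N + 1) := by
        rw [hEc, hEc, sum_range_succ]
      rw [sum_range_succ, ih, sum_range_succ _ (N + 1), e]
      push_cast
      ring
  have hE0 : HasSum (fun n => E.coeff n) 0 := by
    refine (hE.summable.hasSum_iff_tendsto_nat).2 ?_
    simp_rw [key]
    have t1 := hE.summable_mul.tendsto_atTop_zero
    have t2 := (tendsto_add_atTop_iff_nat 1).2 h1.tendsto_sum_nat
    simpa using t1.sub t2
  obtain ⟨D, hD, hDE, -⟩ := hE.exists_div hE0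
  exact ⟨D, hD, by rw [pow_two, mul_assoc, hDE, hEP]⟩

/-- Convolution with a rapidly decaying sequence preserves algebraic decay. -/
lemma ExpSmall.conv_isBigO {D : PowerSeries ℝ} (hD : ExpSmall D) {b : ℕ → ℝ} {e : ℝ}
    (he : e ≤ 0) (he2 : -2 ≤ e) (hb : b =O[atTop] fun n : ℕ => (n : ℝ) ^ e) :
    (fun n => (PowerSeries.mk b * D).coeff n) =O[atTop] fun n : ℕ => (n : ℝ) ^ e := by
  obtain ⟨C, hC⟩ := hD
  obtain ⟨B, hB0, hB⟩ := exists_bound_brk hb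
  have hC0 : 0 ≤ C := by simpa using (abs_nonneg _).trans (hC 0)
  have hs : Summable fun j : ℕ => ((j : ℝ) + 1) ^ 2 * (1 / 3 : ℝ) ^ j := by
    have h2 := summable_pow_mul_geometric_of_norm_lt_one 2 (by norm_num : ‖(1 / 3 : ℝ)‖ < 1)
    have h1 := summable_pow_mul_geometric_of_norm_lt_one 1 (by norm_num : ‖(1 / 3 : ℝ)‖ < 1)
    have h0 := summable_pow_mul_geometric_of_norm_lt_one 0 (by norm_num : ‖(1 / 3 : ℝ)‖ < 1)
    refine ((h2.add (h1.mul_left 2)).add h0).congr fun j => ?_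
    ring
  refine isBigO_of_bound_brk (C := B * C * ∑' j : ℕ, ((j : ℝ) + 1) ^ 2 * (1 / 3 : ℝ) ^ j)
    fun n => ?_
  have brkle : ∀ j ≤ n, brk e (n - j) ≤ brk e n * ((j : ℝ) + 1) ^ 2 := by
    intro j hj
    have m1 : (0 : ℝ) < max 1 ((n - j : ℕ) : ℝ) := lt_max_of_lt_left one_pos
    have hle : max 1 (n : ℝ) ≤ max 1 ((n - j : ℕ) : ℝ) * ((j : ℝ) + 1) := by
      have a1 : (1 : ℝ) ≤ max 1 ((n - j : ℕ) : ℝ) := le_max_left _ _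
      have a2 : ((n - j : ℕ) : ℝ) ≤ max 1 ((n - j : ℕ) : ℝ) := le_max_right _ _
      rw [Nat.cast_sub hj] at a1 a2 ⊢
      have a3 : (0 : ℝ) ≤ j := Nat.cast_nonneg j
      refine max_le (by nlinarith) (by nlinarith)
    have h1 := Real.rpow_le_rpow_of_nonpos (lt_max_of_lt_left one_pos) hle he
    rw [Real.mul_rpow m1.le (by positivity)] at h1
    have h2 : ((j : ℝ) + 1) ^ e * ((j : ℝ) + 1) ^ (2 : ℝ) ≥ 1 := by
      rw [← Real.rpow_add (by positivity)]
      exact Real.one_le_rpow (by linarith [(Nat.cast_nonneg j : (0 : ℝ) ≤ j)]) (by linarith)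
    have h3 : (0 : ℝ) < brk e (n - j) := brk_pos _ _
    rw [Real.rpow_two] at h2
    calc brk e (n - j) ≤ brk e (n - j) * (((j : ℝ) + 1) ^ e * ((j : ℝ) + 1) ^ 2) := by
          nlinarith
      _ = (brk e (n - j) * ((j : ℝ) + 1) ^ e) * ((j : ℝ) + 1) ^ 2 := by ring
      _ ≤ _ := mul_le_mul_of_nonneg_right h1 (by positivity)
  rw [mul_comm, PowerSeries.coeff_mul,
    Finset.Nat.sum_antidiagonal_eq_sum_range_succ_mk]
  simp only [PowerSeries.coeff_mk]
  calc |∑ j ∈ range n.succ, D.coeff j * b (n - j)|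
      ≤ ∑ j ∈ range n.succ, (B * C * brk e n) * (((j : ℝ) + 1) ^ 2 * (1 / 3 : ℝ) ^ j) := by
        refine (abs_sum_le_sum_abs _ _).trans (sum_le_sum fun j hj => ?_)
        have hj' : j ≤ n := by simpa [Nat.lt_succ_iff] using hj
        rw [abs_mul]
        calc |D.coeff j| * |b (n - j)| ≤ (C * (1 / 3) ^ j) * (B * (brk e n * ((j : ℝ) + 1) ^ 2)) :=
              mul_le_mul (hC j) ((hB _).trans (mul_le_mul_of_nonneg_left (brkle j hj') hB0.le))
                (abs_nonneg _) (by positivity)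
          _ = _ := by ring
    _ ≤ (B * C * brk e n) * ∑' j : ℕ, ((j : ℝ) + 1) ^ 2 * (1 / 3 : ℝ) ^ j := by
        rw [← mul_sum]
        refine mul_le_mul_of_nonneg_left (hs.sum_le_tsum _ fun j _ => by positivity) ?_
        have := brk_pos e n
        positivity
    _ = _ := by ring

/-- `(1 - ζ) (1 - ζ)^(-β) = (1 - ζ)^(1-β)` for the generating functions. -/
lemma mk_cesaro_mul (β : ℝ) :
    (1 - PowerSeries.X) * PowerSeries.mk (cesaro β) = PowerSeries.mk (cesaro (β - 1)) := by
  ext n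
  rw [sub_mul, one_mul, map_sub, PowerSeries.coeff_mk, PowerSeries.coeff_mk]
  cases n with
  | zero => simp
  | succ n =>
    rw [mul_comm, PowerSeries.coeff_succ_mul_X, PowerSeries.coeff_mk, cesaro_pascal]

/-- The coefficients of `(1 - ζ)^(-β) P(ζ)` are `n^(β-1) / Γ(β)` up to a factor `1 + O(n⁻²)` if
`P(1) = 1` and `P'(1) = β / 2`. The two conditions make `P` agree with `1 - (β / 2) (1 - ζ)` up to a
multiple of `(1 - ζ)²`, and this polynomial is the one of `cesaro_expansion`. -/
lemma cesaro_conv_expansion {β : ℝ} (hβ : 1 < β) (hβ3 : β ≤ 3) {P : PowerSeries ℝ}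
    (hP : ExpSmall P) (h0 : HasSum (fun n => P.coeff n) 1)
    (h1 : HasSum (fun n : ℕ => (n : ℝ) * P.coeff n) (β / 2)) :
    (fun n : ℕ => (PowerSeries.mk (cesaro β) * P).coeff n - (n : ℝ) ^ (β - 1) / Real.Gamma β)
      =O[atTop] fun n : ℕ => (n : ℝ) ^ (β - 3) := by
  have hX : ExpSmall (PowerSeries.X : PowerSeries ℝ) := by simpa using ExpSmall.one.X_mul
  -- `P - 1 + (β / 2) (1 - X)` has a double zero at `1`
  set Q : PowerSeries ℝ := P + (PowerSeries.C (-1 + β / 2) * 1 +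
    PowerSeries.C (-(β / 2)) * PowerSeries.X) with hQ
  have Qc : ∀ n, Q.coeff n = P.coeff n + ((if n = 0 then (-1 + β / 2) else 0) +
      (if n = 1 then -(β / 2) else 0)) := fun n => by
    rw [hQ, map_add, map_add, PowerSeries.coeff_C_mul, PowerSeries.coeff_C_mul,
      PowerSeries.coeff_one, PowerSeries.coeff_X]
    simp
  have hQs : ExpSmall Q := hP.add ((ExpSmall.one.C_mul _).add (hX.C_mul _))
  obtain ⟨D, hD, hDQ⟩ := hQs.exists_div_sq (by
    have := h0.add ((hasSum_ite_eq (0 : ℕ) (-1 + β / 2)).add (hasSum_ite_eq (1 : ℕ) (-(β / 2))))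
    simp_rw [Qc]
    convert this using 1
    ring) (by
    have := h1.add (hasSum_ite_eq (1 : ℕ) (-(β / 2)))
    convert this using 1
    · ext n
      rw [Qc]
      rcases n with _ | _ | n
      · simp
      · simp
      · simp
    · ring)
  have hPe : PowerSeries.mk (cesaro β) * P = PowerSeries.mk (cesaro β) -
      PowerSeries.C (β / 2) * PowerSeries.mk (cesaro (β - 1)) +
      PowerSeries.mk (cesaro (β - 1 - 1)) * D := by
    have e : P = 1 - PowerSeries.C (β / 2) * (1 - PowerSeries.X) +
        (1 - PowerSeries.X) ^ 2 * D := by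
      rw [hDQ, hQ]
      simp only [map_add, map_neg, map_one]
      ring
    rw [← mk_cesaro_mul (β - 1), ← mk_cesaro_mul β]
    nth_rewrite 1 [e]
    ring
  have c2 : cesaro (β - 1 - 1) =O[atTop] fun n : ℕ => (n : ℝ) ^ (β - 3) := by
    have := cesaro_sub_one_isBigO (β := β - 1) (by linarith)
    rwa [show β - 1 - 2 = β - 3 by ring] at this
  have := (cesaro_expansion (β := β) (by linarith)).add
    (hD.conv_isBigO (by linarith) (by linarith) c2)
  refine this.congr_left fun n => ?_
  rw [hPe]
  simp only [map_add, map_sub, PowerSeries.coeff_C_mul, PowerSeries.coeff_mk]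
  ring

end FracWave

namespace FracWave

/-! ### Asymptotics of the BDF2 weights -/

open Filter Topology Asymptotics Finset

/-- The Taylor coefficients of the smooth factor `((3 - ζ) / 2)^γ` of `δ(ζ)^γ`. -/
noncomputable def smoothCoeff (γ : ℝ) (m : ℕ) : ℝ :=
  (3 / 2 : ℝ) ^ γ * ((1 / 3) ^ m * cesaro (-γ) m)

/-- The Taylor coefficients of `δ(ζ)^γ = (1 - ζ)^γ ((3 - ζ) / 2)^γ`: the convolution quadrature
weights for step size `1`. -/
noncomputable def bdfWeight (γ : ℝ) (n : ℕ) : ℝ :=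
  (PowerSeries.mk (cesaro (-γ)) * PowerSeries.mk (smoothCoeff γ)).coeff n

lemma choose_eq_cesaro (β : ℝ) (n : ℕ) : Ring.choose (β + n - 1) n = cesaro β n := by
  have h := Ring.factorial_nsmul_multichoose_eq_ascPochhammer β n
  have h2 : (ascPochhammer ℕ n).smeval β = n.factorial * cesaro β n := by
    rw [Polynomial.ascPochhammer_smeval_eq_eval, ← prod_eq_factorial_mul_cesaro]
    induction n with
    | zero => simp
    | succ n ih =>
      rw [ascPochhammer_succ_eval, prod_range_succ, ih]
      exact Ring.factorial_nsmul_multichoose_eq_ascPochhammer β n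
  rw [h2, nsmul_eq_mul] at h
  have h3 : (n.factorial : ℝ) ≠ 0 := by exact_mod_cast n.factorial_ne_zero
  rw [Ring.choose, show β + n - 1 - n + 1 = β by ring]
  exact mul_left_cancel₀ h3 h

lemma hasSum_cesaro (β : ℝ) {z : ℂ} (hz : ‖z‖ < 1) :
    HasSum (fun n => (cesaro β n : ℂ) * z ^ n) ((1 - z) ^ (-(β : ℂ))) := by
  have h := (Complex.one_div_one_sub_cpow_hasFPowerSeriesOnBall_zero (β : ℂ)).hasSum
    (y := z) (by simpa [Metric.mem_eball, edist_zero_right, enorm_eq_nnnorm] using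
      (by exact_mod_cast hz : ‖z‖₊ < 1))
  simp only [FormalMultilinearSeries.ofScalars_apply_eq, zero_add, one_div] at h
  rw [Complex.cpow_neg]
  refine h.congr_fun fun n => ?_
  rw [← choose_eq_cesaro, Complex.ofReal_choose]
  simp

lemma abs_cesaro_le_one {β : ℝ} (h1 : -1 ≤ β) (h2 : β ≤ 1) (n : ℕ) : |cesaro β n| ≤ 1 := by
  rw [cesaro, abs_prod]
  refine prod_le_one (fun _ _ => abs_nonneg _) fun i _ => ?_
  have : (0 : ℝ) ≤ i := Nat.cast_nonneg i
  rw [abs_div, abs_of_pos (by positivity : (0 : ℝ) < i + 1), div_le_one (by positivity), abs_le]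
  constructor <;> linarith

lemma expSmall_smoothCoeff {γ : ℝ} (h1 : -1 ≤ γ) (h2 : γ ≤ 1) :
    ExpSmall (PowerSeries.mk (smoothCoeff γ)) := by
  refine ⟨(3 / 2 : ℝ) ^ γ, fun n => ?_⟩
  have h := abs_cesaro_le_one (β := -γ) (by linarith) (by linarith) n
  rw [PowerSeries.coeff_mk, smoothCoeff, abs_mul, abs_mul,
    abs_of_pos (by positivity : (0 : ℝ) < (3 / 2 : ℝ) ^ γ),
    abs_of_pos (by positivity : (0 : ℝ) < (1 / 3 : ℝ) ^ n)]
  refine mul_le_mul_of_nonneg_left ?_ (by positivity)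
  exact mul_le_of_le_one_right (by positivity) h

lemma hasSum_smoothCoeff (γ : ℝ) : HasSum (smoothCoeff γ) 1 := by
  have h := hasSum_cesaro (-γ) (z := ((1 / 3 : ℝ) : ℂ)) (by
    rw [Complex.norm_real]; norm_num)
  have e : (1 - ((1 / 3 : ℝ) : ℂ)) ^ (-((-γ : ℝ) : ℂ)) = (((2 / 3 : ℝ) ^ γ : ℝ) : ℂ) := by
    rw [Complex.ofReal_cpow (by norm_num)]
    push_cast
    norm_num
  rw [e] at h
  have h' : HasSum (fun n => cesaro (-γ) n * (1 / 3 : ℝ) ^ n) ((2 / 3 : ℝ) ^ γ) := by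
    exact_mod_cast h
  have h2 := h'.mul_left ((3 / 2 : ℝ) ^ γ)
  rw [← Real.mul_rpow (by norm_num) (by norm_num),
    show (3 / 2 * (2 / 3) : ℝ) = 1 by norm_num, Real.one_rpow] at h2
  refine h2.congr_fun fun n => ?_
  rw [smoothCoeff, mul_comm ((1 / 3 : ℝ) ^ n)]

/-- The first moment follows from the differential equation
`(1 - ζ/3) s'(ζ) = -(γ/3) s(ζ)` of the generating function `s`, evaluated at `ζ = 1`. -/
lemma hasSum_mul_smoothCoeff {γ : ℝ} (h1 : -1 ≤ γ) (h2 : γ ≤ 1) :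
    HasSum (fun n : ℕ => (n : ℝ) * smoothCoeff γ n) (-γ / 2) := by
  have hs := (expSmall_smoothCoeff h1 h2).summable_mul
  simp only [PowerSeries.coeff_mk] at hs
  obtain ⟨M, hM⟩ := hs
  have e : ∀ n : ℕ, ((n + 1 : ℕ) : ℝ) * smoothCoeff γ (n + 1) =
      1 / 3 * ((n : ℝ) * smoothCoeff γ n) + -γ / 3 * smoothCoeff γ n := by
    intro n
    have h : ((n : ℝ) + 1) ≠ 0 := by positivity
    simp only [smoothCoeff, cesaro_succ, pow_succ]
    push_cast
    field_simp
    ring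
  have h3 := (hasSum_nat_add_iff' 1).2 hM
  simp only [e] at h3
  have h4 := (hM.mul_left (1 / 3)).add ((hasSum_smoothCoeff γ).mul_left (-γ / 3))
  have h5 := h3.unique h4
  simp only [range_one, sum_singleton, Nat.cast_zero, zero_mul, sub_zero] at h5
  have : M = -γ / 2 := by linarith
  rwa [← this]

lemma bdfWeight_isBigO {γ : ℝ} (hγ : γ ∈ Set.Ioo (-1 : ℝ) 1) :
    bdfWeight γ =O[atTop] fun n : ℕ => (n : ℝ) ^ (-γ - 1) := by
  have h := cesaro_sub_one_isBigO (β := 1 - γ) (by linarith [hγ.2])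
  rw [show 1 - γ - 1 = -γ by ring, show 1 - γ - 2 = -γ - 1 by ring] at h
  exact (expSmall_smoothCoeff hγ.1.le hγ.2.le).conv_isBigO (by linarith [hγ.1])
    (by linarith [hγ.2]) h

lemma mk_bdfWeight (γ : ℝ) : PowerSeries.mk (bdfWeight γ) =
    PowerSeries.mk (cesaro (-γ)) * PowerSeries.mk (smoothCoeff γ) := by
  ext n; simp [bdfWeight]

lemma coeff_mk_mul_mk (a b : ℕ → ℝ) (n : ℕ) :
    (PowerSeries.mk a * PowerSeries.mk b).coeff n = ∑ i ∈ range (n + 1), a i * b (n - i) := by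
  rw [PowerSeries.coeff_mul, Finset.Nat.sum_antidiagonal_eq_sum_range_succ_mk]
  simp

/-- The quadrature of the constant `1` at integer times. Only the value of `((3 - ζ) / 2)^γ` at `ζ =
1` fits here, not its derivative, and so the remainder is one power of `n` larger than in
`cesaro_conv_expansion`. -/
lemma sum_bdfWeight_isBigO {γ : ℝ} (hγ : γ ∈ Set.Ioo (-1 : ℝ) 1) :
    (fun n : ℕ => ∑ i ∈ range (n + 1), bdfWeight γ i - (n : ℝ) ^ (-γ) / Real.Gamma (1 - γ))
      =O[atTop] fun n : ℕ => (n : ℝ) ^ (-γ - 1) := by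
  have hQ := (expSmall_smoothCoeff hγ.1.le hγ.2.le).add (ExpSmall.one.C_mul (-1))
  have c1 := cesaro_sub_one_isBigO (β := 1 - γ) (by linarith [hγ.2])
  rw [show 1 - γ - 1 = -γ by ring, show 1 - γ - 2 = -γ - 1 by ring] at c1
  obtain ⟨D, hD, hDQ, -⟩ := hQ.exists_div (by
    have := (hasSum_smoothCoeff γ).add (hasSum_ite_eq (0 : ℕ) (-1 : ℝ))
    rw [add_neg_cancel] at this
    refine this.congr_fun fun n => ?_
    rw [map_add, PowerSeries.coeff_C_mul, PowerSeries.coeff_one, PowerSeries.coeff_mk]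
    simp)
  have e : PowerSeries.mk (bdfWeight γ) * PowerSeries.mk (fun _ => (1 : ℝ)) =
      PowerSeries.mk (cesaro (1 - γ)) + PowerSeries.mk (cesaro (-γ)) * D := by
    have e1 : PowerSeries.mk (smoothCoeff γ) = 1 + (1 - PowerSeries.X) * D := by
      rw [hDQ]; simp
    have e2 := mk_cesaro_mul (1 - γ)
    rw [show 1 - γ - 1 = -γ by ring] at e2
    have e3 : (1 - PowerSeries.X) * PowerSeries.mk (fun _ => (1 : ℝ)) = 1 := by
      rw [mul_comm]; exact PowerSeries.mk_one_mul_one_sub_eq_one ℝ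
    rw [mk_bdfWeight, ← e2, e1]
    linear_combination (PowerSeries.mk (cesaro (1 - γ)) * (1 + (1 - PowerSeries.X) * D)) * e3
  have h1 := cesaro_expansion (β := 1 - γ) (by linarith [hγ.2])
  rw [show 1 - γ - 1 = -γ by ring, show 1 - γ - 3 = -γ - 2 by ring] at h1
  have h1' : _ =O[atTop] fun n : ℕ => (n : ℝ) ^ (-γ - 1) := h1.trans (by
    refine IsBigO.of_bound 1 ?_
    filter_upwards [eventually_ge_atTop 1] with n hn
    have hn' : (1 : ℝ) ≤ n := by exact_mod_cast hn
    rw [Real.norm_of_nonneg (by positivity), Real.norm_of_nonneg (by positivity), one_mul]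
    exact Real.rpow_le_rpow_of_exponent_le hn' (by linarith))
  have h2 := h1'.add ((c1.const_mul_left ((1 - γ) / 2)).add
    (hD.conv_isBigO (by linarith [hγ.1]) (by linarith [hγ.2]) c1))
  refine h2.congr_left fun n => ?_
  have := congrArg (PowerSeries.coeff n) e
  rw [coeff_mk_mul_mk, map_add, PowerSeries.coeff_mk] at this
  simp only [mul_one] at this
  rw [this]
  ring

lemma X_mul_mk_cesaro_two :
    PowerSeries.X * PowerSeries.mk (cesaro 2) = PowerSeries.mk fun n : ℕ => (n : ℝ) := by
  have c2 : ∀ n, cesaro 2 n = n + 1 := fun n => by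
    induction n with
    | zero => simp
    | succ n ih =>
      have h : ((n : ℝ) + 1) ≠ 0 := by positivity
      rw [cesaro_succ, ih]; push_cast; field_simp; ring
  ext n
  cases n with
  | zero => simp
  | succ n => rw [mul_comm, PowerSeries.coeff_succ_mul_X]; simp [c2]

lemma X_mul_mk_cesaro_three :
    PowerSeries.C (1 / 2 : ℝ) * (PowerSeries.X * (PowerSeries.mk (cesaro 3) +
      PowerSeries.X * PowerSeries.mk (cesaro 3))) =
      PowerSeries.mk fun n : ℕ => (n : ℝ) ^ 2 / 2 := by
  have c3 : ∀ n, cesaro 3 n = (n + 1) * (n + 2) / 2 := fun n => by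
    induction n with
    | zero => simp
    | succ n ih =>
      have h : ((n : ℝ) + 1) ≠ 0 := by positivity
      rw [cesaro_succ, ih]; push_cast; field_simp; ring
  ext n
  rw [PowerSeries.coeff_C_mul, PowerSeries.coeff_mk]
  rcases n with _ | _ | n
  · simp
  · rw [mul_comm PowerSeries.X, PowerSeries.coeff_succ_mul_X]; simp
  · rw [mul_comm PowerSeries.X, PowerSeries.coeff_succ_mul_X, map_add,
      mul_comm PowerSeries.X, PowerSeries.coeff_succ_mul_X]
    simp only [PowerSeries.coeff_mk, c3]
    push_cast
    ring

lemma cesaro_one : cesaro 1 = fun _ => 1 := by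
  funext n
  induction n with
  | zero => simp
  | succ n ih =>
    have h : ((n : ℝ) + 1) ≠ 0 := by positivity
    rw [cesaro_succ, ih]; field_simp; ring

lemma hasSum_coeff_X_mul {P : PowerSeries ℝ} {s : ℝ} (h : HasSum (fun n => P.coeff n) s) :
    HasSum (fun n => (PowerSeries.X * P).coeff n) s := by
  rw [← hasSum_nat_add_iff' 1]
  simpa [mul_comm PowerSeries.X, PowerSeries.coeff_succ_mul_X] using h

lemma hasSum_mul_coeff_X_mul {P : PowerSeries ℝ} {s m : ℝ} (h : HasSum (fun n => P.coeff n) s)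
    (h1 : HasSum (fun n : ℕ => (n : ℝ) * P.coeff n) m) :
    HasSum (fun n : ℕ => (n : ℝ) * (PowerSeries.X * P).coeff n) (m + s) := by
  rw [← hasSum_nat_add_iff' 1]
  simp only [mul_comm PowerSeries.X, PowerSeries.coeff_succ_mul_X]
  simpa [add_mul] using h1.add h

/-- The quadrature of the function `t` at integer times. Its generating function is
`(1 - ζ)^(γ-2) ζ ((3 - ζ) / 2)^γ`, and the last two factors satisfy the moment conditions of
`cesaro_conv_expansion` because the BDF2 method has order two. -/
lemma first_moment_bdfWeight_isBigO {γ : ℝ} (hγ : γ ∈ Set.Ioo (-1 : ℝ) 1) :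
    (fun n : ℕ => ∑ i ∈ range (n + 1), bdfWeight γ i * ((n - i : ℕ) : ℝ) -
      (n : ℝ) ^ (1 - γ) / Real.Gamma (2 - γ)) =O[atTop] fun n : ℕ => (n : ℝ) ^ (-γ - 1) := by
  have hs := expSmall_smoothCoeff hγ.1.le hγ.2.le
  have h0 : HasSum (fun n => (PowerSeries.mk (smoothCoeff γ)).coeff n) 1 := by
    simpa using hasSum_smoothCoeff γ
  have h1 : HasSum (fun n : ℕ => (n : ℝ) * (PowerSeries.mk (smoothCoeff γ)).coeff n) (-γ / 2) := by
    simpa using hasSum_mul_smoothCoeff hγ.1.le hγ.2.le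
  have h := cesaro_conv_expansion (β := 2 - γ) (by linarith [hγ.2]) (by linarith [hγ.1]) hs.X_mul
    (hasSum_coeff_X_mul h0) (by
      have := hasSum_mul_coeff_X_mul h0 h1
      rwa [show -γ / 2 + 1 = (2 - γ) / 2 by ring] at this)
  rw [show 2 - γ - 1 = 1 - γ by ring, show 2 - γ - 3 = -γ - 1 by ring] at h
  refine h.congr_left fun n => ?_
  have e : PowerSeries.mk (cesaro (2 - γ)) * (PowerSeries.X * PowerSeries.mk (smoothCoeff γ)) =
      PowerSeries.mk (bdfWeight γ) * PowerSeries.mk fun n : ℕ => (n : ℝ) := by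
    have e2 := mk_cesaro_mul (2 - γ)
    have e1 := mk_cesaro_mul (2 - γ - 1)
    have e3 := mk_cesaro_mul 2
    have e4 := mk_cesaro_mul (2 - 1)
    rw [show 2 - γ - 1 - 1 = -γ by ring] at e1
    rw [show (2 : ℝ) - 1 = 1 by norm_num] at e3 e4
    have e5 : PowerSeries.mk (cesaro (1 - 1)) = 1 := by
      rw [← e4, cesaro_one, mul_comm]; exact PowerSeries.mk_one_mul_one_sub_eq_one ℝ
    rw [← e3, e5] at e4
    rw [mk_bdfWeight, ← X_mul_mk_cesaro_two, ← e1, ← e2]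
    linear_combination -(PowerSeries.mk (cesaro (2 - γ)) * PowerSeries.X *
      PowerSeries.mk (smoothCoeff γ)) * e4
  rw [e, coeff_mk_mul_mk]

/-- The quadrature of the function `t² / 2` at integer times, with generating function
`(1 - ζ)^(γ-3) (ζ (1 + ζ) / 2) ((3 - ζ) / 2)^γ`. -/
lemma second_moment_bdfWeight_isBigO {γ : ℝ} (hγ : γ ∈ Set.Ioo (0 : ℝ) 1) :
    (fun n : ℕ => ∑ i ∈ range (n + 1), bdfWeight γ i * (((n - i : ℕ) : ℝ) ^ 2 / 2) -
      (n : ℝ) ^ (2 - γ) / Real.Gamma (3 - γ)) =O[atTop] fun n : ℕ => (n : ℝ) ^ (-γ) := by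
  have hs := expSmall_smoothCoeff (γ := γ) (by linarith [hγ.1]) hγ.2.le
  have h0 : HasSum (fun n => (PowerSeries.mk (smoothCoeff γ)).coeff n) 1 := by
    simpa using hasSum_smoothCoeff γ
  have h1 : HasSum (fun n : ℕ => (n : ℝ) * (PowerSeries.mk (smoothCoeff γ)).coeff n) (-γ / 2) := by
    simpa using hasSum_mul_smoothCoeff (γ := γ) (by linarith [hγ.1]) hγ.2.le
  set S := PowerSeries.mk (smoothCoeff γ)
  have k0 := hasSum_coeff_X_mul h0
  have k1 := hasSum_mul_coeff_X_mul h0 h1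
  have l0 := hasSum_coeff_X_mul k0
  have l1 := hasSum_mul_coeff_X_mul k0 k1
  have h := cesaro_conv_expansion (β := 3 - γ) (by linarith [hγ.2]) (by linarith [hγ.1])
    ((hs.X_mul.add hs.X_mul.X_mul).C_mul (1 / 2))
    (by
      have := (k0.add l0).mul_left (1 / 2)
      simp only [PowerSeries.coeff_C_mul, map_add]
      rwa [show (1 : ℝ) / 2 * (1 + 1) = 1 by norm_num] at this) (by
      have := (k1.add l1).mul_left (1 / 2)
      rw [show (1 : ℝ) / 2 * (-γ / 2 + 1 + (-γ / 2 + 1 + 1)) = (3 - γ) / 2 by ring] at this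
      refine this.congr_fun fun n => ?_
      simp only [PowerSeries.coeff_C_mul, map_add]
      ring)
  rw [show 3 - γ - 1 = 2 - γ by ring, show 3 - γ - 3 = -γ by ring] at h
  refine h.congr_left fun n => ?_
  have e : PowerSeries.mk (cesaro (3 - γ)) * (PowerSeries.C (1 / 2) *
      (PowerSeries.X * S + PowerSeries.X * (PowerSeries.X * S))) =
      PowerSeries.mk (bdfWeight γ) * PowerSeries.mk fun n : ℕ => (n : ℝ) ^ 2 / 2 := by
    have e3 := mk_cesaro_mul (3 - γ)
    have e2 := mk_cesaro_mul (3 - γ - 1)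
    have e1 := mk_cesaro_mul (3 - γ - 1 - 1)
    have f3 := mk_cesaro_mul 3
    have f2 := mk_cesaro_mul (3 - 1)
    have f1 := mk_cesaro_mul (3 - 1 - 1)
    rw [show 3 - γ - 1 - 1 - 1 = -γ by ring] at e1
    rw [show (3 : ℝ) - 1 - 1 = 1 by norm_num] at f1 f2
    have f0 : PowerSeries.mk (cesaro (1 - 1)) = 1 := by
      rw [← f1, cesaro_one, mul_comm]; exact PowerSeries.mk_one_mul_one_sub_eq_one ℝ
    rw [← f2, ← f3, f0] at f1
    rw [mk_bdfWeight, ← X_mul_mk_cesaro_three, ← e1, ← e2, ← e3]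
    linear_combination -(PowerSeries.mk (cesaro (3 - γ)) * PowerSeries.C (1 / 2) *
      (PowerSeries.X + PowerSeries.X * PowerSeries.X) * S) * f1
  rw [e, coeff_mk_mul_mk]

end FracWave

namespace FracWave

/-! ### The Peano kernels of the quadrature -/

open Filter Topology Asymptotics Finset

lemma iteratedDeriv_sub_rpow (c γ : ℝ) (hc : 0 < c) (k : ℕ) :
    iteratedDeriv k (fun x : ℝ => (c - x) ^ γ) 0 / k.factorial =
      c ^ γ * (c⁻¹ ^ k * cesaro (-γ) k) := by
  have h := congrFun (iteratedDeriv_comp_const_sub k (fun x : ℝ => x ^ γ) c) 0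
  have h2 : (-1 : ℝ) ^ k * (descPochhammer ℝ k).eval γ = k.factorial * cesaro (-γ) k := by
    rw [← prod_eq_factorial_mul_cesaro]
    induction k with
    | zero => simp
    | succ k ih =>
      rw [prod_range_succ, ← ih (by
          simpa using congrFun (iteratedDeriv_comp_const_sub k (fun x : ℝ => x ^ γ) c) 0),
        descPochhammer_succ_eval, pow_succ]
      ring
  have h3 : (k.factorial : ℝ) ≠ 0 := by exact_mod_cast k.factorial_ne_zero
  rw [h]
  simp only [sub_zero, smul_eq_mul]
  rw [iteratedDeriv_eq_iterate, Real.iter_deriv_rpow_const, ← mul_assoc, h2,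
    Real.rpow_sub_natCast hc.ne', inv_pow]
  field_simp

/-- The weights for step size `κ`, from the factorisation `δ(ζ) = (1 - ζ) (3 - ζ) / 2`. -/
lemma cqWeight_eq {κ : ℝ} (hκ : 0 < κ) (γ : ℝ) (n : ℕ) :
    cqWeight κ γ n = κ ^ (-γ) * bdfWeight γ n := by
  have hev : (fun ζ : ℝ => ((3 / 2 - 2 * ζ + 1 / 2 * ζ ^ 2) / κ) ^ γ) =ᶠ[𝓝 0]
      fun ζ => (κ ^ (-γ) * 2 ^ (-γ)) *
        ((fun x : ℝ => (1 - x) ^ γ) * fun x : ℝ => (3 - x) ^ γ) ζ := by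
    filter_upwards [gt_mem_nhds (zero_lt_one (α := ℝ))] with x hx
    have h1 : 0 < 1 - x := by linarith
    have h3 : 0 < 3 - x := by linarith
    simp only [Pi.mul_apply]
    rw [show (3 / 2 - 2 * x + 1 / 2 * x ^ 2) / κ = κ⁻¹ * (2⁻¹ * ((1 - x) * (3 - x))) by
        field_simp; ring,
      Real.mul_rpow (by positivity) (by positivity), Real.mul_rpow (by positivity) (by positivity),
      Real.mul_rpow h1.le h3.le, Real.inv_rpow hκ.le, Real.inv_rpow (by norm_num),
      Real.rpow_neg hκ.le, Real.rpow_neg (by norm_num)]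
    ring
  have hcd : ∀ c : ℝ, 0 < c → ContDiffAt ℝ n (fun x : ℝ => (c - x) ^ γ) 0 := fun c hc =>
    (contDiffAt_const.sub contDiffAt_id).rpow_const_of_ne (by simpa using hc.ne')
  rw [cqWeight, hev.iteratedDeriv_eq, iteratedDeriv_const_mul_field,
    iteratedDeriv_mul (hcd 1 one_pos) (hcd 3 three_pos), bdfWeight, coeff_mk_mul_mk, mul_div_assoc,
    sum_div, mul_assoc, mul_sum]
  congr 1
  refine sum_congr rfl fun i hi => ?_
  have hi' : i ≤ n := by simpa [Nat.lt_succ_iff] using hi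
  have e1 := iteratedDeriv_sub_rpow 1 γ one_pos i
  have e2 := iteratedDeriv_sub_rpow 3 γ three_pos (n - i)
  have f0 : (n.factorial : ℝ) ≠ 0 := by exact_mod_cast n.factorial_ne_zero
  have f1 : (i.factorial : ℝ) ≠ 0 := by exact_mod_cast i.factorial_ne_zero
  have f2 : ((n - i).factorial : ℝ) ≠ 0 := by exact_mod_cast (n - i).factorial_ne_zero
  rw [div_eq_iff f1] at e1
  rw [div_eq_iff f2] at e2
  rw [e1, e2, Nat.cast_choose ℝ hi', smoothCoeff, Real.div_rpow (by norm_num) (by norm_num),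
    Real.rpow_neg (by norm_num)]
  simp only [Real.one_rpow, inv_one, one_pow, one_mul, one_div]
  field_simp

/-- The error at time `s` of the convolution quadrature with step size `1` for the function `t`.
It is the Peano kernel of the quadrature. -/
noncomputable def peano (γ : ℝ) (n : ℕ) (s : ℝ) : ℝ :=
  s ^ (1 - γ) / Real.Gamma (2 - γ) - ∑ i ∈ range (n + 1), bdfWeight γ i * max (s - i) 0

/-- The error at time `s` of the convolution quadrature with step size `1` for `t² / 2`, an
antiderivative of the Peano kernel. -/
noncomputable def peano₂ (γ : ℝ) (n : ℕ) (s : ℝ) : ℝ :=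
  s ^ (2 - γ) / Real.Gamma (3 - γ) - ∑ i ∈ range (n + 1), bdfWeight γ i * (max (s - i) 0 ^ 2 / 2)

/-- At a time in `[m, m + 1]` only the first `m + 1` weights contribute. -/
lemma sum_bdfWeight_truncate (γ : ℝ) (φ : ℝ → ℝ) (hφ : φ 0 = 0) {m n : ℕ} (hmn : m ≤ n) {θ : ℝ}
    (h0 : 0 ≤ θ) (h1 : θ ≤ 1) :
    ∑ i ∈ range (n + 1), bdfWeight γ i * φ (max ((m + θ) - i) 0) =
      ∑ i ∈ range (m + 1), bdfWeight γ i * φ (((m - i : ℕ) : ℝ) + θ) := by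
  rw [← sum_subset (range_subset_range.2 (by omega : m + 1 ≤ n + 1))]
  · refine sum_congr rfl fun i hi => ?_
    have hi' : i ≤ m := by simpa [Nat.lt_succ_iff] using hi
    have hi2 : (i : ℝ) ≤ m := by exact_mod_cast hi'
    rw [Nat.cast_sub hi', max_eq_left (by linarith)]
    congr 2
    ring
  · intro i _ hi
    have hi' : m + 1 ≤ i := by simpa using hi
    have hi2 : (m : ℝ) + 1 ≤ i := by exact_mod_cast hi'
    rw [max_eq_right (by linarith), hφ, mul_zero]

lemma rpow_taylor {p m θ : ℝ} (hp0 : 0 ≤ p) (hp : p ≤ 2) (hm : 1 ≤ m) (h0 : 0 ≤ θ) (h1 : θ ≤ 1) :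
    |(m + θ) ^ p - m ^ p - θ * (p * m ^ (p - 1))| ≤ 2 * m ^ (p - 2) := by
  have hpos : ∀ x ∈ Set.Icc (0 : ℝ) θ, 0 < m + x := fun x hx => by linarith [hx.1]
  have hd2 : ∀ x ∈ Set.Icc (0 : ℝ) θ, |(m + x) ^ (p - 1) - m ^ (p - 1)| ≤ m ^ (p - 2) := by
    intro x hx
    have hd : ∀ y ∈ Set.Icc (0 : ℝ) x, HasDerivWithinAt (fun y => (m + y) ^ (p - 1))
        ((p - 1) * (m + y) ^ (p - 2)) (Set.Icc 0 x) y := fun y hy => by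
      have := ((hasDerivAt_id y).const_add m).rpow_const (p := p - 1)
        (Or.inl (hpos y ⟨hy.1, hy.2.trans hx.2⟩).ne')
      rw [show p - 1 - 1 = p - 2 by ring] at this
      simpa using this.hasDerivWithinAt
    have := norm_image_sub_le_of_norm_deriv_le_segment' (C := m ^ (p - 2)) hd (fun y hy => by
      have hy' := hpos y ⟨hy.1, hy.2.le.trans hx.2⟩
      rw [Real.norm_eq_abs, abs_mul, abs_of_pos (Real.rpow_pos_of_pos hy' _)]
      have a1 : |p - 1| ≤ 1 := abs_le.2 ⟨by linarith, by linarith⟩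
      have a2 := Real.rpow_le_rpow_of_nonpos (by linarith : (0 : ℝ) < m)
        (by linarith [hy.1] : m ≤ m + y) (by linarith : p - 2 ≤ 0)
      have a3 := Real.rpow_pos_of_pos hy' (p - 2)
      nlinarith [abs_nonneg (p - 1)]) x ⟨hx.1, le_rfl⟩
    simp only [add_zero, sub_zero, Real.norm_eq_abs] at this
    have h3 : (0 : ℝ) ≤ m ^ (p - 2) := by positivity
    have h4 : x ≤ 1 := hx.2.trans h1
    nlinarith
  have hd : ∀ x ∈ Set.Icc (0 : ℝ) θ,
      HasDerivWithinAt (fun x => (m + x) ^ p - x * (p * m ^ (p - 1)))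
        (p * ((m + x) ^ (p - 1) - m ^ (p - 1))) (Set.Icc 0 θ) x := fun x hx => by
    have := (((hasDerivAt_id x).const_add m).rpow_const (p := p) (Or.inl (hpos x hx).ne')).sub
      ((hasDerivAt_id x).mul_const (p * m ^ (p - 1)))
    refine (this.congr_deriv ?_).hasDerivWithinAt
    simp only [id]; ring
  have := norm_image_sub_le_of_norm_deriv_le_segment' (C := 2 * m ^ (p - 2)) hd (fun x hx => by
    rw [Real.norm_eq_abs, abs_mul, abs_of_nonneg hp0]
    exact mul_le_mul hp (hd2 x ⟨hx.1, hx.2.le⟩) (abs_nonneg _) (by norm_num)) θ ⟨h0, le_rfl⟩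
  simp only [add_zero, sub_zero, Real.norm_eq_abs, zero_mul] at this
  have h3 : (0 : ℝ) ≤ m ^ (p - 2) := by positivity
  rw [show (m + θ) ^ p - m ^ p - θ * (p * m ^ (p - 1)) =
    (m + θ) ^ p - θ * (p * m ^ (p - 1)) - m ^ p by ring]
  nlinarith

lemma Gamma_two_sub {γ : ℝ} (hγ : γ < 1) :
    Real.Gamma (2 - γ) = (1 - γ) * Real.Gamma (1 - γ) := by
  rw [← Real.Gamma_add_one (by linarith)]; congr 1; ring

/-- Decay of the Peano kernel. At an integer it is the remainder in the quadrature of `t`; between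
integers the sum is linear, with slope the quadrature of `1`, and `s^(1-γ)` is compared with its
first order Taylor polynomial. -/
lemma exists_peano_bound {γ : ℝ} (hγ : γ ∈ Set.Ioo (-1 : ℝ) 1) :
    ∃ C > 0, ∀ (n m : ℕ) (θ : ℝ), m ≤ n → 0 ≤ θ → θ ≤ 1 →
      |peano γ n (m + θ)| ≤ C * brk (-γ - 1) m := by
  obtain ⟨A, hA0, hA⟩ := exists_bound_brk (first_moment_bdfWeight_isBigO hγ)
  obtain ⟨B, hB0, hB⟩ := exists_bound_brk (sum_bdfWeight_isBigO hγ)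
  have hG1 : 0 < Real.Gamma (1 - γ) := Real.Gamma_pos_of_pos (by linarith [hγ.2])
  have hG2 : 0 < Real.Gamma (2 - γ) := Real.Gamma_pos_of_pos (by linarith [hγ.2])
  have hG := Gamma_two_sub hγ.2
  refine ⟨A + B + 2 / Real.Gamma (2 - γ) + (1 / Real.Gamma (2 - γ) + |bdfWeight γ 0|),
    by positivity, fun n m θ hmn h0 h1 => ?_⟩
  rw [peano, sum_bdfWeight_truncate γ (fun x => x) rfl hmn h0 h1]
  have hbr := brk_pos (-γ - 1) m
  rcases Nat.eq_zero_or_pos m with rfl | hm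
  · simp only [Nat.cast_zero, zero_add, range_one, sum_singleton, Nat.sub_self, brk_zero, mul_one]
    have e1 : θ ^ (1 - γ) ≤ 1 := Real.rpow_le_one h0 h1 (by linarith [hγ.2])
    have e0 : 0 ≤ θ ^ (1 - γ) := by positivity
    calc |θ ^ (1 - γ) / Real.Gamma (2 - γ) - bdfWeight γ 0 * θ|
        ≤ |θ ^ (1 - γ) / Real.Gamma (2 - γ)| + |bdfWeight γ 0 * θ| := abs_sub _ _
      _ ≤ 1 / Real.Gamma (2 - γ) + |bdfWeight γ 0| := by
          rw [abs_of_nonneg (by positivity), abs_mul, abs_of_nonneg h0]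
          gcongr
          exact mul_le_of_le_one_right (abs_nonneg _) h1
      _ ≤ _ := le_add_of_nonneg_left (by positivity)
  · have hm' : (1 : ℝ) ≤ m := by exact_mod_cast hm
    have hT := rpow_taylor (p := 1 - γ) (by linarith [hγ.2]) (by linarith [hγ.1]) hm' h0 h1
    rw [show 1 - γ - 1 = -γ by ring, show 1 - γ - 2 = -γ - 1 by ring,
      ← brk_of_pos (-γ - 1) hm] at hT
    have hAm := hA m
    have hBm := hB m
    have e : ((m : ℝ) + θ) ^ (1 - γ) / Real.Gamma (2 - γ) -
        ∑ i ∈ range (m + 1), bdfWeight γ i * (((m - i : ℕ) : ℝ) + θ) =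
        (((m : ℝ) + θ) ^ (1 - γ) - (m : ℝ) ^ (1 - γ) - θ * ((1 - γ) * (m : ℝ) ^ (-γ))) /
          Real.Gamma (2 - γ) -
        (∑ i ∈ range (m + 1), bdfWeight γ i * ((m - i : ℕ) : ℝ) -
          (m : ℝ) ^ (1 - γ) / Real.Gamma (2 - γ)) -
        θ * (∑ i ∈ range (m + 1), bdfWeight γ i - (m : ℝ) ^ (-γ) / Real.Gamma (1 - γ)) := by
      have h1γ : 1 - γ ≠ 0 := by linarith [hγ.2]
      simp only [mul_add, sum_add_distrib, ← sum_mul]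
      rw [hG]
      field_simp
      ring
    rw [e]
    refine (abs_sub _ _).trans ((add_le_add (abs_sub _ _) le_rfl).trans ?_)
    rw [abs_div, abs_of_pos hG2, abs_mul, abs_of_nonneg h0]
    have c1 : |((m : ℝ) + θ) ^ (1 - γ) - (m : ℝ) ^ (1 - γ) - θ * ((1 - γ) * (m : ℝ) ^ (-γ))| /
        Real.Gamma (2 - γ) ≤ 2 / Real.Gamma (2 - γ) * brk (-γ - 1) m := by
      rw [div_mul_eq_mul_div]; gcongr
    have c2 : θ * |∑ i ∈ range (m + 1), bdfWeight γ i - (m : ℝ) ^ (-γ) / Real.Gamma (1 - γ)| ≤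
        B * brk (-γ - 1) m := (mul_le_of_le_one_left (abs_nonneg _) h1).trans hBm
    have c3 : 0 ≤ (1 / Real.Gamma (2 - γ) + |bdfWeight γ 0|) * brk (-γ - 1) m := by positivity
    nlinarith

lemma hasDerivAt_max_sq (x : ℝ) : HasDerivAt (fun x : ℝ => max x 0 ^ 2 / 2) (max x 0) x := by
  rcases lt_trichotomy x 0 with hx | rfl | hx
  · rw [max_eq_right hx.le]
    refine (hasDerivAt_const x (0 : ℝ)).congr_of_eventuallyEq ?_
    filter_upwards [gt_mem_nhds hx] with y hy
    simp [max_eq_right (le_of_lt hy)]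
  · rw [max_self, hasDerivAt_iff_isLittleO]
    simp only [max_self, sub_zero, smul_zero, ne_eq, OfNat.ofNat_ne_zero, not_false_eq_true,
      zero_pow, zero_div]
    have h1 : (fun x : ℝ => max x 0 ^ 2 / 2) =O[𝓝 0] fun x => x ^ 2 := by
      refine IsBigO.of_bound 1 (Eventually.of_forall fun y => ?_)
      rw [Real.norm_of_nonneg (by positivity), Real.norm_of_nonneg (by positivity), one_mul]
      rcases le_total y 0 with hy | hy
      · rw [max_eq_right hy]; nlinarith [sq_nonneg y]
      · rw [max_eq_left hy]; nlinarith [sq_nonneg y]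
    refine h1.trans_isLittleO ?_
    simpa using (isLittleO_pow_pow (𝕜 := ℝ) one_lt_two)
  · rw [max_eq_left hx.le]
    have := ((hasDerivAt_id x).pow 2).div_const 2
    refine (this.congr_deriv (by simp)).congr_of_eventuallyEq ?_
    filter_upwards [lt_mem_nhds hx] with y hy
    simp [max_eq_left (le_of_lt hy)]

lemma hasDerivAt_peano₂ {γ : ℝ} (hγ : γ < 1) (n : ℕ) (s : ℝ) :
    HasDerivAt (peano₂ γ n) (peano γ n s) s := by
  have hG : Real.Gamma (3 - γ) = (2 - γ) * Real.Gamma (2 - γ) := by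
    rw [← Real.Gamma_add_one (by linarith)]; congr 1; ring
  have hG2 : 0 < Real.Gamma (2 - γ) := Real.Gamma_pos_of_pos (by linarith)
  have h1 := (Real.hasDerivAt_rpow_const (x := s) (p := 2 - γ) (Or.inr (by linarith))).div_const
    (Real.Gamma (3 - γ))
  have h2 := HasDerivAt.fun_sum (u := range (n + 1)) fun i _ =>
    ((hasDerivAt_max_sq (s - i)).comp s ((hasDerivAt_id s).sub_const (i : ℝ))).const_mul
      (bdfWeight γ i)
  refine (h1.sub h2).congr_deriv ?_
  rw [peano, hG, show 2 - γ - 1 = 1 - γ by ring]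
  have : 2 - γ ≠ 0 := by linarith
  simp only [mul_one]
  field_simp

/-- Decay of the second Peano kernel: the quadrature of `t² / 2` at integers, and
`exists_peano_bound` in between. -/
lemma exists_peano₂_bound {γ : ℝ} (hγ : γ ∈ Set.Ioo (0 : ℝ) 1) :
    ∃ C > 0, ∀ (n m : ℕ) (θ : ℝ), m ≤ n → 0 ≤ θ → θ ≤ 1 →
      |peano₂ γ n (m + θ)| ≤ C * brk (-γ) m := by
  obtain ⟨A, hA0, hA⟩ := exists_bound_brk (second_moment_bdfWeight_isBigO hγ)
  obtain ⟨B, hB0, hB⟩ := exists_peano_bound (γ := γ) ⟨by linarith [hγ.1], hγ.2⟩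
  refine ⟨A + B, by positivity, fun n m θ hmn h0 h1 => ?_⟩
  have e0 : |peano₂ γ n m| ≤ A * brk (-γ) m := by
    have := sum_bdfWeight_truncate γ (fun x => x ^ 2 / 2) (by simp) hmn le_rfl zero_le_one
    simp only [add_zero] at this
    rw [peano₂, this, abs_sub_comm]
    exact hA m
  have hb : brk (-γ - 1) m ≤ brk (-γ) m :=
    Real.rpow_le_rpow_of_exponent_le (le_max_left _ _) (by linarith)
  have e1 : |peano₂ γ n (m + θ) - peano₂ γ n m| ≤ B * brk (-γ) m := by
    have := norm_image_sub_le_of_norm_deriv_le_segment' (f := fun x => peano₂ γ n (m + x))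
      (f' := fun x => peano γ n (m + x)) (a := 0) (b := θ) (C := B * brk (-γ) m)
      (fun x _ => by
        have := (hasDerivAt_peano₂ hγ.2 n (m + x)).comp x ((hasDerivAt_id x).const_add (m : ℝ))
        simpa [Function.comp_def] using this.hasDerivWithinAt)
      (fun x hx => (hB n m x hmn hx.1 (hx.2.le.trans h1)).trans
        (mul_le_mul_of_nonneg_left hb hB0.le)) θ ⟨h0, le_rfl⟩
    simp only [add_zero, sub_zero, Real.norm_eq_abs] at this
    have h3 : 0 ≤ B * brk (-γ) m := mul_nonneg hB0.le (brk_pos _ _).le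
    nlinarith
  calc |peano₂ γ n (m + θ)| = |peano₂ γ n m + (peano₂ γ n (m + θ) - peano₂ γ n m)| := by
        rw [add_sub_cancel]
    _ ≤ _ := (abs_add_le _ _).trans (by linarith)

lemma exists_sum_brk_bound {e : ℝ} (he : e < -1) :
    ∃ C > 0, ∀ N : ℕ, ∑ m ∈ range N, brk e m ≤ C := by
  have hs : Summable (brk e) := by
    refine (summable_nat_add_iff 1).1 (((summable_nat_add_iff 1).2
      (Real.summable_nat_rpow.2 he)).congr fun n => ?_)
    rw [brk_of_pos e (by omega)]
  refine ⟨∑' m, brk e m + 1, by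
    have : 0 ≤ ∑' m, brk e m := tsum_nonneg fun m => (brk_pos e m).le
    linarith, fun N => ?_⟩
  have := hs.sum_le_tsum (range N) fun m _ => (brk_pos e m).le
  linarith

lemma sum_brk_le {e : ℝ} (he : -1 < e) (he0 : e ≤ 0) {N : ℕ} (hN : 1 ≤ N) :
    ∑ m ∈ range N, brk e m ≤ (1 + 1 / (e + 1)) * (N : ℝ) ^ (e + 1) := by
  have h1 : 0 < e + 1 := by linarith
  have key : ∀ N : ℕ, ∑ m ∈ range (N + 1), brk e m ≤ 1 + 1 / (e + 1) * (N : ℝ) ^ (e + 1) := by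
    intro N
    induction N with
    | zero => simp [Real.zero_rpow h1.ne']
    | succ N ih =>
      rw [sum_range_succ, brk_of_pos e (by omega)]
      have hp : (0 : ℝ) < ((N + 1 : ℕ) : ℝ) := by positivity
      have hB := rpow_one_add_le_one_add_mul_self (s := -((N + 1 : ℕ) : ℝ)⁻¹) (p := e + 1)
        (by
          rw [neg_le_neg_iff]
          exact inv_le_one_of_one_le₀ (by
            push_cast; linarith [(Nat.cast_nonneg N : (0 : ℝ) ≤ N)])) h1.le (by linarith)
      have e1 : 1 + -((N + 1 : ℕ) : ℝ)⁻¹ = (N : ℝ) / ((N + 1 : ℕ) : ℝ) := by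
        push_cast at hp ⊢; field_simp; ring
      rw [e1, Real.div_rpow (Nat.cast_nonneg N) hp.le, div_le_iff₀ (by positivity)] at hB
      have e2 : ((N + 1 : ℕ) : ℝ) ^ (e + 1) = ((N + 1 : ℕ) : ℝ) ^ e * ((N + 1 : ℕ) : ℝ) := by
        rw [Real.rpow_add hp, Real.rpow_one]
      have e3 : (1 + (e + 1) * -((N + 1 : ℕ) : ℝ)⁻¹) * ((N + 1 : ℕ) : ℝ) ^ (e + 1) =
          ((N + 1 : ℕ) : ℝ) ^ (e + 1) - (e + 1) * ((N + 1 : ℕ) : ℝ) ^ e := by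
        rw [e2]; field_simp; ring
      rw [e3] at hB
      have h4 : 1 / (e + 1) * (N : ℝ) ^ (e + 1) ≤
          1 / (e + 1) * (((N + 1 : ℕ) : ℝ) ^ (e + 1) - (e + 1) * ((N + 1 : ℕ) : ℝ) ^ e) := by
        gcongr
      have h5 : 1 / (e + 1) * (((N + 1 : ℕ) : ℝ) ^ (e + 1) - (e + 1) * ((N + 1 : ℕ) : ℝ) ^ e) =
          1 / (e + 1) * ((N + 1 : ℕ) : ℝ) ^ (e + 1) - ((N + 1 : ℕ) : ℝ) ^ e := by
        field_simp
      linarith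
  obtain ⟨M, rfl⟩ : ∃ M, N = M + 1 := ⟨N - 1, by omega⟩
  refine (key M).trans ?_
  have h2 : (1 : ℝ) ≤ ((M + 1 : ℕ) : ℝ) ^ (e + 1) :=
    Real.one_le_rpow (by push_cast; linarith [(Nat.cast_nonneg M : (0 : ℝ) ≤ M)]) h1.le
  have h3 : (M : ℝ) ^ (e + 1) ≤ ((M + 1 : ℕ) : ℝ) ^ (e + 1) := by
    gcongr; simp
  have h4 : 1 / (e + 1) * (M : ℝ) ^ (e + 1) ≤ 1 / (e + 1) * ((M + 1 : ℕ) : ℝ) ^ (e + 1) := by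
    gcongr
  linarith

end FracWave

namespace FracWave

/-! ### Positivity of the quadrature -/

open Filter Topology Asymptotics Finset

lemma hasSum_bdfWeight (γ : ℝ) {z : ℂ} (hz : ‖z‖ < 1) :
    HasSum (fun n => (bdfWeight γ n : ℂ) * z ^ n)
      ((1 - z) ^ (γ : ℂ) * (((3 / 2 : ℝ) ^ γ : ℝ) * (1 - z / 3) ^ (γ : ℂ))) := by
  have h1 := hasSum_cesaro (-γ) hz
  have h2 := (hasSum_cesaro (-γ) (z := z / 3) (by
    rw [norm_div, Complex.norm_ofNat]
    have := norm_nonneg z; linarith)).mul_left (((3 / 2 : ℝ) ^ γ : ℝ) : ℂ)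
  have e : (-((-γ : ℝ) : ℂ)) = (γ : ℂ) := by push_cast; ring
  rw [e] at h1 h2
  have s := summable_norm_sum_mul_range_of_summable_norm h1.summable.norm h2.summable.norm
  have t := tsum_mul_tsum_eq_tsum_sum_range_of_summable_norm h1.summable.norm h2.summable.norm
  rw [h1.tsum_eq, h2.tsum_eq] at t
  rw [t]
  refine s.of_norm.hasSum.congr_fun fun n => ?_
  rw [bdfWeight, coeff_mk_mul_mk]
  push_cast
  rw [sum_mul]
  refine sum_congr rfl fun i hi => ?_
  have hi' : i ≤ n := by simpa [Nat.lt_succ_iff] using hi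
  rw [smoothCoeff]
  push_cast
  have : z ^ n = z ^ i * z ^ (n - i) := by rw [← pow_add]; congr 1; omega
  rw [this, div_pow z 3, div_pow 1 3, one_pow]
  field_simp

/-- A-stability of the BDF2 method, `Re δ(ζ) ≥ 0` in the unit disc, for fractional powers. -/
lemma re_bdf_nonneg {γ : ℝ} (h1 : -1 ≤ γ) (h2 : γ ≤ 1) {z : ℂ} (hz : ‖z‖ < 1) :
    0 ≤ ((1 - z) ^ (γ : ℂ) * (((3 / 2 : ℝ) ^ γ : ℝ) * (1 - z / 3) ^ (γ : ℂ))).re := by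
  have hre : z.re < 1 := (Complex.re_le_norm z).trans_lt hz
  have hre' : |z.re| < 1 := (Complex.abs_re_le_norm z).trans_lt hz
  have hsq : z.re ^ 2 + z.im ^ 2 < 1 := by
    have := Complex.sq_norm z
    rw [Complex.normSq_apply] at this
    have h0 := norm_nonneg z
    nlinarith
  have ha : 0 < (1 - z).re := by simpa using hre
  have hb : 0 < (1 - z / 3).re := by
    have : (z / 3).re = z.re / 3 := by
      rw [show z / 3 = z / ((3 : ℝ) : ℂ) by norm_num, Complex.div_ofReal_re]
    rw [Complex.sub_re, this, Complex.one_re]; linarith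
  have ha0 : 1 - z ≠ 0 := fun h => by simp [h] at ha
  have hb0 : 1 - z / 3 ≠ 0 := fun h => by simp [h] at hb
  set a := 1 - z
  set b := 1 - z / 3
  have hA := Complex.abs_arg_lt_pi_div_two_iff.2 (Or.inl ha)
  have hB := Complex.abs_arg_lt_pi_div_two_iff.2 (Or.inl hb)
  rw [abs_lt] at hA hB
  -- up to a factor, `a b` is `δ(z)`: its argument `arg a + arg b` is at most `π / 2` in absolute
  -- value, and stays so after multiplication by `γ`
  have hab : 0 ≤ (a * b).re := by
    have e : (a * b).re = 1 - 4 / 3 * z.re + (z.re ^ 2 - z.im ^ 2) / 3 := by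
      have : a * b = 1 - (4 / 3 : ℝ) * z + (1 / 3 : ℝ) * z ^ 2 := by
        simp only [a, b]; push_cast; ring
      rw [this, Complex.add_re, Complex.sub_re, Complex.re_ofReal_mul, Complex.re_ofReal_mul,
        pow_two z, Complex.mul_re, Complex.one_re]
      ring
    rw [e]
    nlinarith [sq_nonneg (z.re - 1)]
  have hcos : 0 ≤ Real.cos (a.arg + b.arg) := by
    have : a * b = (‖a‖ * ‖b‖ : ℝ) * Complex.exp ((a.arg + b.arg : ℝ) * Complex.I) := by
      nth_rewrite 1 [← Complex.norm_mul_exp_arg_mul_I a, ← Complex.norm_mul_exp_arg_mul_I b]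
      push_cast
      rw [add_mul, Complex.exp_add]
      ring
    rw [this, Complex.re_ofReal_mul, Complex.exp_ofReal_mul_I_re] at hab
    exact nonneg_of_mul_nonneg_right hab (by positivity)
  have harg : |a.arg + b.arg| ≤ Real.pi / 2 := by
    by_contra! h
    have hlt : |a.arg + b.arg| < Real.pi := abs_lt.2 ⟨by linarith, by linarith⟩
    have h3 : Real.cos |a.arg + b.arg| < 0 :=
      Real.cos_neg_of_pi_div_two_lt_of_lt h (by linarith)
    rw [Real.cos_abs] at h3
    linarith
  have hcpow : ∀ w : ℂ, w ≠ 0 → w ^ (γ : ℂ) =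
      ((‖w‖ ^ γ : ℝ) : ℂ) * Complex.exp ((γ * w.arg : ℝ) * Complex.I) := by
    intro w hw
    rw [Complex.cpow_def_of_ne_zero hw, Real.rpow_def_of_pos (norm_pos_iff.2 hw), Complex.log]
    push_cast
    rw [← Complex.exp_add]
    congr 1
    ring
  rw [hcpow a ha0, hcpow b hb0]
  have e : ((‖a‖ ^ γ : ℝ) : ℂ) * Complex.exp ((γ * a.arg : ℝ) * Complex.I) *
      (((3 / 2 : ℝ) ^ γ : ℝ) * (((‖b‖ ^ γ : ℝ) : ℂ) * Complex.exp ((γ * b.arg : ℝ) * Complex.I))) =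
      ((‖a‖ ^ γ * ((3 / 2 : ℝ) ^ γ * ‖b‖ ^ γ) : ℝ) : ℂ) *
        Complex.exp ((γ * (a.arg + b.arg) : ℝ) * Complex.I) := by
    push_cast
    rw [mul_add, add_mul, Complex.exp_add]
    ring
  rw [e, Complex.re_ofReal_mul, Complex.exp_ofReal_mul_I_re]
  refine mul_nonneg (by positivity) (Real.cos_nonneg_of_mem_Icc ?_)
  have hγ : |γ| ≤ 1 := abs_le.2 ⟨h1, h2⟩
  have : |γ * (a.arg + b.arg)| ≤ Real.pi / 2 := by
    rw [abs_mul]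
    have := abs_nonneg (a.arg + b.arg)
    nlinarith [abs_nonneg γ]
  exact ⟨(abs_le.1 this).1, (abs_le.1 this).2⟩

lemma integral_cos_int_mul (m : ℤ) :
    ∫ θ in (0 : ℝ)..2 * Real.pi, Real.cos (m * θ) = if m = 0 then 2 * Real.pi else 0 := by
  split_ifs with h
  · simp [h]
  · have hm : (m : ℝ) ≠ 0 := by exact_mod_cast h
    rw [intervalIntegral.integral_comp_mul_left _ hm, integral_cos]
    have : Real.sin ((m : ℝ) * (2 * Real.pi)) = 0 := by
      rw [show (m : ℝ) * (2 * Real.pi) = ((2 * m : ℤ) : ℝ) * Real.pi by push_cast; ring]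
      exact Real.sin_int_mul_pi _
    simp [this]

/-- The Fourier coefficients of an absolutely convergent cosine series. -/
lemma integral_cosine_series_mul_cos {a : ℕ → ℝ} (ha : Summable fun k => |a k|) (n j : ℕ) :
    ∫ θ in (0 : ℝ)..2 * Real.pi, (∑' k, a k * Real.cos (k * θ)) * Real.cos (n * θ - j * θ) =
      Real.pi * ((if j ≤ n then a (n - j) else 0) + (if n ≤ j then a (j - n) else 0)) := by
  set F : ℕ → C(ℝ, ℝ) := fun k =>
    ⟨fun θ => a k * Real.cos (k * θ) * Real.cos (n * θ - j * θ), by fun_prop⟩ with hF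
  have hbd : ∀ k θ, ‖F k θ‖ ≤ |a k| := fun k θ => by
    simp only [hF, ContinuousMap.coe_mk, norm_mul, Real.norm_eq_abs]
    have h1 := Real.abs_cos_le_one (k * θ)
    have h2 := Real.abs_cos_le_one (n * θ - j * θ)
    calc |a k| * |Real.cos (k * θ)| * |Real.cos (n * θ - j * θ)| ≤ |a k| * 1 * 1 := by gcongr
      _ = |a k| := by ring
  have h := intervalIntegral.hasSum_intervalIntegral_of_summable_norm (a := 0) (b := 2 * Real.pi)
    (f := F) (Summable.of_nonneg_of_le (fun k => norm_nonneg _) (fun k =>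
      (ContinuousMap.norm_le _ (abs_nonneg (a k))).2 fun x => hbd k x) ha)
  have hint : ∀ k, ∫ θ in (0 : ℝ)..2 * Real.pi, F k θ =
      (if k = n - j ∧ j ≤ n then Real.pi * a k else 0) +
        (if k = j - n ∧ n ≤ j then Real.pi * a k else 0) := by
    intro k
    have e : ∀ θ : ℝ, F k θ = a k / 2 * Real.cos (((k + n - j : ℤ) : ℝ) * θ) +
        a k / 2 * Real.cos (((k - n + j : ℤ) : ℝ) * θ) := by
      intro θ
      simp only [hF, ContinuousMap.coe_mk]
      push_cast
      have e1 : ((k : ℝ) + n - j) * θ = k * θ + (n * θ - j * θ) := by ring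
      have e2 : ((k : ℝ) - n + j) * θ = k * θ - (n * θ - j * θ) := by ring
      rw [e1, e2, Real.cos_add (k * θ), Real.cos_sub (k * θ)]
      ring
    simp only [e]
    rw [intervalIntegral.integral_add (Continuous.intervalIntegrable (by fun_prop) _ _)
        (Continuous.intervalIntegrable (by fun_prop) _ _),
      intervalIntegral.integral_const_mul, intervalIntegral.integral_const_mul,
      integral_cos_int_mul, integral_cos_int_mul]
    rw [add_comm]
    congr 1
    · by_cases hk : k = n - j ∧ j ≤ n
      · rw [if_pos hk, if_pos (by omega)]; ring
      · rw [if_neg hk, if_neg (by omega)]; ring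
    · by_cases hk : k = j - n ∧ n ≤ j
      · rw [if_pos hk, if_pos (by omega)]; ring
      · rw [if_neg hk, if_neg (by omega)]; ring
  simp only [hint] at h
  have h2 : HasSum (fun k => (if k = n - j ∧ j ≤ n then Real.pi * a k else 0) +
        (if k = j - n ∧ n ≤ j then Real.pi * a k else 0))
      ((if j ≤ n then Real.pi * a (n - j) else 0) + (if n ≤ j then Real.pi * a (j - n) else 0)) := by
    refine HasSum.add ?_ ?_
    · convert hasSum_single (n - j) (f := fun k => if k = n - j ∧ j ≤ n then Real.pi * a k else 0)
        (fun k hk => if_neg fun h => hk h.1) using 1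
      simp
    · convert hasSum_single (j - n) (f := fun k => if k = j - n ∧ n ≤ j then Real.pi * a k else 0)
        (fun k hk => if_neg fun h => hk h.1) using 1
      simp
  have h3 := h.unique h2
  rw [mul_add, mul_ite, mul_ite, mul_zero, ← h3]
  refine intervalIntegral.integral_congr fun θ _ => ?_
  simp only [hF, ContinuousMap.coe_mk]
  rw [tsum_mul_right]

variable {E : Type*} [NormedAddCommGroup E] [InnerProductSpace ℝ E]

/-- A Toeplitz form whose symbol has nonnegative real part is nonnegative: it is the integral of
the real part against `‖∑ exp(i n θ) g_n‖²`. -/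
lemma toeplitz_nonneg_of_summable {a : ℕ → ℝ} (ha : Summable fun k => |a k|)
    (hpos : ∀ θ : ℝ, 0 ≤ ∑' k, a k * Real.cos (k * θ)) (g : ℕ → E) (N : ℕ) :
    0 ≤ ∑ n ∈ range N, ∑ j ∈ range (n + 1), a (n - j) * inner ℝ (g j) (g n) := by
  set Φ : ℝ → ℝ := fun θ => ∑' k, a k * Real.cos (k * θ)
  have hΦc : Continuous Φ := by
    refine continuous_tsum (fun k => by fun_prop) ha fun k θ => ?_
    rw [norm_mul, Real.norm_eq_abs]
    exact mul_le_of_le_one_right (abs_nonneg _) (Real.abs_cos_le_one _)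
  have hH : ∀ θ : ℝ, 0 ≤ ∑ n ∈ range N, ∑ j ∈ range N,
      inner ℝ (g j) (g n) * Real.cos (n * θ - j * θ) := by
    intro θ
    have e : ∑ n ∈ range N, ∑ j ∈ range N, inner ℝ (g j) (g n) * Real.cos (n * θ - j * θ) =
        ‖∑ n ∈ range N, Real.cos (n * θ) • g n‖ ^ 2 +
          ‖∑ n ∈ range N, Real.sin (n * θ) • g n‖ ^ 2 := by
      rw [← real_inner_self_eq_norm_sq, ← real_inner_self_eq_norm_sq]
      simp only [sum_inner, inner_sum, real_inner_smul_left, real_inner_smul_right]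
      rw [← sum_add_distrib]
      refine sum_congr rfl fun n _ => ?_
      rw [← sum_add_distrib]
      refine sum_congr rfl fun j _ => ?_
      rw [Real.cos_sub, real_inner_comm]
      ring
    rw [e]; positivity
  have hI : 0 ≤ ∫ θ in (0 : ℝ)..2 * Real.pi, Φ θ * ∑ n ∈ range N, ∑ j ∈ range N,
      inner ℝ (g j) (g n) * Real.cos (n * θ - j * θ) :=
    intervalIntegral.integral_nonneg (by positivity) fun θ _ => mul_nonneg (hpos θ) (hH θ)
  have hI2 : ∫ θ in (0 : ℝ)..2 * Real.pi, Φ θ * ∑ n ∈ range N, ∑ j ∈ range N,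
      inner ℝ (g j) (g n) * Real.cos (n * θ - j * θ) =
      Real.pi * ∑ n ∈ range N, ∑ j ∈ range N, inner ℝ (g j) (g n) *
        ((if j ≤ n then a (n - j) else 0) + (if n ≤ j then a (j - n) else 0)) := by
    simp only [mul_sum]
    rw [intervalIntegral.integral_finsetSum fun n _ =>
      (Continuous.intervalIntegrable (by fun_prop) _ _)]
    refine sum_congr rfl fun n _ => ?_
    rw [intervalIntegral.integral_finsetSum fun n _ =>
      (Continuous.intervalIntegrable (by fun_prop) _ _)]
    refine sum_congr rfl fun j _ => ?_
    have := integral_cosine_series_mul_cos ha n j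
    rw [← mul_assoc, mul_comm Real.pi, mul_assoc, ← this, ← intervalIntegral.integral_const_mul]
    refine intervalIntegral.integral_congr fun θ _ => ?_
    simp only [Φ]
    ring
  have hs : ∑ n ∈ range N, ∑ j ∈ range N, inner ℝ (g j) (g n) *
      ((if j ≤ n then a (n - j) else 0) + (if n ≤ j then a (j - n) else 0)) =
      2 * ∑ n ∈ range N, ∑ j ∈ range (n + 1), a (n - j) * inner ℝ (g j) (g n) := by
    have e1 : ∑ n ∈ range N, ∑ j ∈ range N, inner ℝ (g j) (g n) *
        (if j ≤ n then a (n - j) else 0) =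
        ∑ n ∈ range N, ∑ j ∈ range (n + 1), a (n - j) * inner ℝ (g j) (g n) := by
      refine sum_congr rfl fun n hn => ?_
      have hn' := mem_range.1 hn
      rw [← sum_subset (range_subset_range.2 (by omega : n + 1 ≤ N))]
      · refine sum_congr rfl fun j hj => ?_
        have hj' : j ≤ n := by simpa [Nat.lt_succ_iff] using hj
        rw [if_pos hj', mul_comm]
      · intro j _ hj
        have hj' : ¬ j ≤ n := by simpa [Nat.lt_succ_iff] using hj
        rw [if_neg hj', mul_zero]
    have e2 : ∑ n ∈ range N, ∑ j ∈ range N, inner ℝ (g j) (g n) *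
        (if n ≤ j then a (j - n) else 0) = ∑ n ∈ range N, ∑ j ∈ range N, inner ℝ (g j) (g n) *
        (if j ≤ n then a (n - j) else 0) := by
      rw [sum_comm]
      refine sum_congr rfl fun n _ => sum_congr rfl fun j _ => ?_
      rw [real_inner_comm]
    simp only [mul_add, sum_add_distrib]
    rw [e2, e1]
    ring
  rw [hI2, hs] at hI
  have := Real.pi_pos
  by_contra! h
  nlinarith

/-- The BDF2 convolution quadrature of order `γ ∈ [-1, 1]` is a positive operator. The weights need
not be summable, and so they are damped by `ρⁿ` first, with `ρ → 1` in the end. -/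
lemma bdfWeight_positive {γ : ℝ} (h1 : -1 ≤ γ) (h2 : γ ≤ 1) (g : ℕ → E) (N : ℕ) :
    0 ≤ ∑ n ∈ range N, ∑ j ∈ range (n + 1), bdfWeight γ (n - j) * inner ℝ (g j) (g n) := by
  have key : ∀ ρ ∈ Set.Ioo (0 : ℝ) 1, 0 ≤ ∑ n ∈ range N, ∑ j ∈ range (n + 1),
      (bdfWeight γ (n - j) * ρ ^ (n - j)) * inner ℝ (g j) (g n) := by
    intro ρ hρ
    have hz : ∀ θ : ℝ, ‖(ρ : ℂ) * Complex.exp (θ * Complex.I)‖ < 1 := fun θ => by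
      rw [norm_mul, Complex.norm_exp_ofReal_mul_I, mul_one, Complex.norm_real,
        Real.norm_of_nonneg hρ.1.le]
      exact hρ.2
    refine toeplitz_nonneg_of_summable (a := fun k => bdfWeight γ k * ρ ^ k) ?_ (fun θ => ?_) g N
    · have := (hasSum_bdfWeight γ (hz 0)).summable.norm
      refine this.congr fun k => ?_
      simp [abs_mul]
    · have h := Complex.hasSum_re (hasSum_bdfWeight γ (hz θ))
      have e : ∀ k : ℕ, ((bdfWeight γ k : ℂ) * ((ρ : ℂ) * Complex.exp (θ * Complex.I)) ^ k).re =
          bdfWeight γ k * ρ ^ k * Real.cos (k * θ) := by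
        intro k
        rw [mul_pow, ← Complex.exp_nat_mul, ← mul_assoc, ← mul_assoc]
        have : (bdfWeight γ k : ℂ) * (ρ : ℂ) ^ k * Complex.exp ((k : ℂ) * θ * Complex.I) =
            ((bdfWeight γ k * ρ ^ k : ℝ) : ℂ) * Complex.exp ((k * θ : ℝ) * Complex.I) := by
          push_cast; ring
        rw [this, Complex.re_ofReal_mul, Complex.exp_ofReal_mul_I_re]
      simp only [e] at h
      rw [h.tsum_eq]
      exact re_bdf_nonneg h1 h2 (hz θ)
  have hc : Continuous fun ρ : ℝ => ∑ n ∈ range N, ∑ j ∈ range (n + 1),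
      (bdfWeight γ (n - j) * ρ ^ (n - j)) * inner ℝ (g j) (g n) := by fun_prop
  have lim := (hc.tendsto 1).mono_left (nhdsWithin_le_nhds (s := Set.Iio 1))
  have := ge_of_tendsto lim (by
    filter_upwards [Ioo_mem_nhdsLT (zero_lt_one (α := ℝ))] with ρ hρ using key ρ hρ)
  simpa using this

end FracWave

namespace FracWave

/-! ### The Poincaré inequality and the Ritz projection -/

open Filter Topology

variable {d : ℕ} {Ω : Set (EuclideanSpace ℝ (Fin d))}

lemma norm_gradient (φ : EuclideanSpace ℝ (Fin d) → ℝ) (x : EuclideanSpace ℝ (Fin d)) :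
    ‖gradient φ x‖ = ‖fderiv ℝ φ x‖ := by
  rw [gradient, LinearIsometryEquiv.norm_map]

/-- Integrate `φ²` by parts against `∂₁ x₁ = 1`. -/
lemma integral_sq_le_integral_gradient_sq (hd : 1 ≤ d) {φ : EuclideanSpace ℝ (Fin d) → ℝ}
    (hφ : ContDiff ℝ ∞ φ) (hc : HasCompactSupport φ) {R : ℝ}
    (hR : ∀ x ∈ tsupport φ, ‖x‖ ≤ R) :
    ∫ x, φ x ^ 2 ≤ (2 * R) ^ 2 * ∫ x, ‖gradient φ x‖ ^ 2 := by
  set i : Fin d := ⟨0, hd⟩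
  set e : EuclideanSpace ℝ (Fin d) := EuclideanSpace.single i 1
  have hne : ‖e‖ = 1 := by simp [e]
  have hdiff : Differentiable ℝ φ := hφ.differentiable (by simp)
  have hcf : Continuous (fderiv ℝ φ) := hφ.continuous_fderiv (by simp)
  have hcφ : Continuous φ := hφ.continuous
  set c : EuclideanSpace ℝ (Fin d) →L[ℝ] ℝ := EuclideanSpace.proj i
  have hce : ∀ x, fderiv ℝ (fun x => c x) x e = 1 := fun x => by
    rw [ContinuousLinearMap.fderiv]; simp [c, e]
  have hsq : ∀ x, fderiv ℝ (fun x => φ x ^ 2) x e = 2 * φ x * fderiv ℝ φ x e := fun x => by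
    rw [fderiv_fun_pow (n := 2) (hdiff x)]; simp
  have hsupp : ∀ g : EuclideanSpace ℝ (Fin d) → ℝ, Continuous g → (∀ x, φ x = 0 → g x = 0) →
      Integrable g := fun g hg h0 =>
    hg.integrable_of_hasCompactSupport (hc.mono' fun x hx => subset_tsupport _ fun h => hx (h0 x h))
  have i1 : Integrable fun x => φ x ^ 2 := hsupp _ (by fun_prop) fun x h => by simp [h]
  have i2 : Integrable fun x => ‖gradient φ x‖ ^ 2 := by
    simp only [norm_gradient]
    refine Continuous.integrable_of_hasCompactSupport (by fun_prop) ?_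
    exact (hc.fderiv (𝕜 := ℝ)).norm.comp_left (g := fun t : ℝ => t ^ 2) (by simp)
  have ibp := integral_mul_fderiv_eq_neg_fderiv_mul_of_integrable (μ := volume) (v := e)
    (f := fun x => φ x ^ 2) (g := fun x => c x)
    (by simp only [hsq]; exact hsupp _ (by fun_prop) fun x h => by simp [h])
    (by simp only [hce]; simpa using i1)
    (hsupp _ (by fun_prop) fun x h => by simp [h])
    (fun x _ => (hdiff x).pow 2) (fun x _ => c.differentiableAt)
  simp only [hce, hsq, mul_one] at ibp
  rw [← integral_neg] at ibp
  have hle : ∫ x, -(2 * φ x * fderiv ℝ φ x e * c x) ≤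
      ∫ x, (1 / 2 * φ x ^ 2 + 2 * R ^ 2 * ‖gradient φ x‖ ^ 2) := by
    refine integral_mono (hsupp _ (by fun_prop) fun x h => by simp [h])
      ((i1.const_mul _).add (i2.const_mul _)) fun x => ?_
    by_cases hx : x ∈ tsupport φ
    · have hcx : |c x| ≤ ‖x‖ := PiLp.norm_apply_le x i
      have h1 : |c x| ≤ R := hcx.trans (hR x hx)
      have h2 : |fderiv ℝ φ x e| ≤ ‖gradient φ x‖ := by
        have := (fderiv ℝ φ x).le_opNorm e
        rwa [hne, mul_one, ← norm_gradient, Real.norm_eq_abs] at this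
      have h3 : |fderiv ℝ φ x e * c x| ≤ R * ‖gradient φ x‖ := by
        rw [abs_mul, mul_comm]
        exact mul_le_mul h1 h2 (abs_nonneg _) ((abs_nonneg _).trans h1)
      have h4 : -(2 * φ x * fderiv ℝ φ x e * c x) ≤ 2 * |φ x| * |fderiv ℝ φ x e * c x| := by
        have := neg_abs_le (φ x * (fderiv ℝ φ x e * c x))
        rw [abs_mul] at this
        nlinarith
      have h5 : 2 * |φ x| * |fderiv ℝ φ x e * c x| ≤ 2 * |φ x| * (R * ‖gradient φ x‖) := by
        gcongr
      simp only
      nlinarith [sq_nonneg (|φ x| - 2 * (R * ‖gradient φ x‖)), sq_abs (φ x)]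
    · have : φ x = 0 := image_eq_zero_of_notMem_tsupport hx
      simp only [this]
      have : 0 ≤ R ^ 2 * ‖gradient φ x‖ ^ 2 := by positivity
      simp
      positivity
  rw [← ibp, integral_add (i1.const_mul _) (i2.const_mul _), integral_const_mul,
    integral_const_mul] at hle
  nlinarith

lemma norm_sq_eq_integral {F : Type*} [NormedAddCommGroup F] [InnerProductSpace ℝ F]
    {μ : Measure (EuclideanSpace ℝ (Fin d))} (f : Lp F 2 μ) {φ : EuclideanSpace ℝ (Fin d) → F}
    (h : f =ᵐ[μ] φ) : ‖f‖ ^ 2 = ∫ x, ‖φ x‖ ^ 2 ∂μ := by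
  rw [← real_inner_self_eq_norm_sq, L2.inner_def]
  refine integral_congr_ae ?_
  filter_upwards [h] with x hx
  rw [hx, real_inner_self_eq_norm_sq]

/-- The pairs `(φ, ∇φ)` of test functions already form a subspace. -/
lemma span_testPairs_le : ∀ w ∈ Submodule.span ℝ (testPairs Ω), w ∈ testPairs Ω := by
  intro w hw
  induction hw using Submodule.span_induction with
  | mem w hw => exact hw
  | zero =>
    refine ⟨fun _ => 0, contDiff_const, HasCompactSupport.zero, by simp [tsupport], ?_, ?_⟩
    · exact Lp.coeFn_zero _ _ _
    · have : gradient (fun _ : EuclideanSpace ℝ (Fin d) => (0 : ℝ)) = 0 := by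
        ext1 x; simp [gradient]
      rw [this]
      exact Lp.coeFn_zero _ _ _
  | add w z _ _ hw hz =>
    obtain ⟨φ, h1, h2, h3, h4, h5⟩ := hw
    obtain ⟨ψ, k1, k2, k3, k4, k5⟩ := hz
    refine ⟨φ + ψ, h1.add k1, h2.add k2,
      (tsupport_add φ ψ).trans (Set.union_subset h3 k3), ?_, ?_⟩
    · exact (Lp.coeFn_add _ _).trans (h4.add k4)
    · have : gradient (φ + ψ) = gradient φ + gradient ψ := by
        ext1 x
        simp only [gradient, Pi.add_apply]
        rw [fderiv_add (h1.differentiable (by simp) x) (k1.differentiable (by simp) x), map_add]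
      rw [this]
      exact (Lp.coeFn_add _ _).trans (h5.add k5)
  | smul a w _ hw =>
    obtain ⟨φ, h1, h2, h3, h4, h5⟩ := hw
    refine ⟨a • φ, h1.const_smul a, h2.smul_left (f := fun _ => a),
      (tsupport_smul_subset_right (fun _ => a) φ).trans h3, ?_, ?_⟩
    · exact (Lp.coeFn_smul _ _).trans (h4.const_smul a)
    · have : gradient (a • φ) = a • gradient φ := by
        ext1 x
        simp only [gradient, Pi.smul_apply]
        rw [fderiv_const_smul (h1.differentiable (by simp) x)]
        simp
      rw [this]
      exact (Lp.coeFn_smul _ _).trans (h5.const_smul a)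

/-- The **Poincaré inequality** on a bounded open set. -/
lemma exists_poincare (hd : 1 ≤ d) (hΩb : Bornology.IsBounded Ω) :
    ∃ CP > 0, ∀ w : H10 Ω, ‖toL2 Ω w‖ ≤ CP * ‖grad Ω w‖ := by
  obtain ⟨R, hR0, hR⟩ := hΩb.exists_pos_norm_le
  refine ⟨2 * R, by positivity, fun w => ?_⟩
  have hcl : IsClosed {w : L2Pair Ω | ‖w.fst‖ ≤ 2 * R * ‖w.snd‖} := by
    refine isClosed_le ?_ ?_
    · exact (WithLp.prod_continuous_ofLp 2 _ _).fst.norm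
    · exact continuous_const.mul (WithLp.prod_continuous_ofLp 2 _ _).snd.norm
  have hsub : (Submodule.span ℝ (testPairs Ω) : Set (L2Pair Ω)) ⊆
      {w | ‖w.fst‖ ≤ 2 * R * ‖w.snd‖} := by
    intro w hw
    obtain ⟨φ, h1, h2, h3, h4, h5⟩ := span_testPairs_le w hw
    have e1 := norm_sq_eq_integral w.fst h4
    have e2 := norm_sq_eq_integral w.snd h5
    rw [setIntegral_eq_integral_of_forall_compl_eq_zero fun x hx => by
      rw [image_eq_zero_of_notMem_tsupport fun h => hx (h3 h)]; simp] at e1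
    rw [setIntegral_eq_integral_of_forall_compl_eq_zero fun x hx => by
      rw [norm_gradient, image_eq_zero_of_notMem_tsupport (f := fderiv ℝ φ) fun h =>
        hx (h3 (tsupport_fderiv_subset ℝ h))]; simp] at e2
    have h := integral_sq_le_integral_gradient_sq hd h1 h2 fun x hx => hR x (h3 hx)
    simp only [Real.norm_eq_abs, sq_abs] at e1
    rw [← e1, ← e2, ← mul_pow] at h
    exact (sq_le_sq₀ (norm_nonneg _) (by positivity)).1 h
  exact closure_minimal hsub hcl w.2

lemma norm_sq_H10 (w : H10 Ω) : ‖w‖ ^ 2 = ‖toL2 Ω w‖ ^ 2 + ‖grad Ω w‖ ^ 2 :=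
  WithLp.prod_norm_sq_eq_of_L2 (w : L2Pair Ω)

lemma norm_grad_le (w : H10 Ω) : ‖grad Ω w‖ ≤ ‖w‖ := by
  have := norm_sq_H10 w
  nlinarith [norm_nonneg w, norm_nonneg (grad Ω w), sq_nonneg ‖toL2 Ω w‖]

lemma norm_H10_le {CP : ℝ} (hCP0 : 0 < CP) (hCP : ∀ w : H10 Ω, ‖toL2 Ω w‖ ≤ CP * ‖grad Ω w‖)
    (w : H10 Ω) : ‖w‖ ≤ (1 + CP) * ‖grad Ω w‖ := by
  have := norm_sq_H10 w
  have h := hCP w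
  have h0 := norm_nonneg (toL2 Ω w)
  have h1 := norm_nonneg (grad Ω w)
  refine abs_le_of_sq_le_sq' ?_ (by positivity) |>.2
  nlinarith [mul_nonneg hCP0.le (mul_nonneg h1 h1)]

section Ritz

variable (V : Submodule ℝ (H10 Ω)) [FiniteDimensional ℝ V]

lemma ritz_unique {CP : ℝ} (hCP0 : 0 < CP) (hCP : ∀ w : H10 Ω, ‖toL2 Ω w‖ ≤ CP * ‖grad Ω w‖)
    (w : H10 Ω) (r : V)
    (hr : ∀ v : V, inner ℝ (grad Ω r) (grad Ω v) = inner ℝ (grad Ω w) (grad Ω v)) :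
    ritz V w = r := by
  have h : ∀ v : V, inner ℝ (grad Ω ((ritz V w - r : V) : H10 Ω)) (grad Ω v) = 0 := fun v => by
    rw [Submodule.coe_sub, map_sub, inner_sub_left, ritz_spec, hr, sub_self]
  have h0 := inner_self_eq_zero.1 (h (ritz V w - r))
  have h1 := norm_H10_le hCP0 hCP ((ritz V w - r : V) : H10 Ω)
  rw [h0, norm_zero, mul_zero] at h1
  have h2 := norm_le_zero_iff.1 h1
  rw [ZeroMemClass.coe_eq_zero] at h2
  exact sub_eq_zero.1 h2

/-- The Ritz projection as a linear map; linearity rests on the uniqueness that the Poincaré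
inequality provides. -/
noncomputable def ritzLM {CP : ℝ} (hCP0 : 0 < CP)
    (hCP : ∀ w : H10 Ω, ‖toL2 Ω w‖ ≤ CP * ‖grad Ω w‖) : H10 Ω →ₗ[ℝ] V where
  toFun := ritz V
  map_add' w z := ritz_unique V hCP0 hCP _ _ fun v => by
    rw [Submodule.coe_add, map_add, map_add, inner_add_left, inner_add_left, ritz_spec, ritz_spec]
  map_smul' a w := ritz_unique V hCP0 hCP _ _ fun v => by
    rw [RingHom.id_apply, Submodule.coe_smul, map_smul, map_smul, real_inner_smul_left,
      real_inner_smul_left, ritz_spec]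

lemma norm_grad_ritz_le (w : H10 Ω) : ‖grad Ω (ritz V w)‖ ≤ ‖grad Ω w‖ := by
  have h := ritz_spec V w (ritz V w)
  rw [real_inner_self_eq_norm_sq] at h
  have h2 := real_inner_le_norm (grad Ω w) (grad Ω (ritz V w))
  rw [← h] at h2
  by_contra! h3
  have := norm_nonneg (grad Ω w)
  nlinarith

lemma norm_toL2_ritz_le {CP : ℝ} (hCP0 : 0 < CP)
    (hCP : ∀ w : H10 Ω, ‖toL2 Ω w‖ ≤ CP * ‖grad Ω w‖) (w : H10 Ω) :
    ‖toL2 Ω (ritz V w)‖ ≤ CP * ‖w‖ :=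
  (hCP _).trans (mul_le_mul_of_nonneg_left ((norm_grad_ritz_le V w).trans (norm_grad_le w)) hCP0.le)

lemma norm_ritz_le {CP : ℝ} (hCP0 : 0 < CP)
    (hCP : ∀ w : H10 Ω, ‖toL2 Ω w‖ ≤ CP * ‖grad Ω w‖) (w : H10 Ω) :
    ‖(ritz V w : H10 Ω)‖ ≤ (1 + CP) * ‖w‖ :=
  (norm_H10_le hCP0 hCP _).trans (mul_le_mul_of_nonneg_left
    ((norm_grad_ritz_le V w).trans (norm_grad_le w)) (by positivity))

lemma norm_l2Proj_sub_ritz_le (w : H10 Ω) :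
    ‖toL2 Ω ((l2Proj V (toL2 Ω w) - ritz V w : V) : H10 Ω)‖ ≤ ritzErrL2 V w := by
  set v : V := l2Proj V (toL2 Ω w) - ritz V w with hv
  have h := l2Proj_spec V (toL2 Ω w) v
  have h1 : inner ℝ (toL2 Ω (v : H10 Ω)) (toL2 Ω v) =
      inner ℝ (toL2 Ω (w - ritz V w)) (toL2 Ω v) := by
    have ev : toL2 Ω (v : H10 Ω) = toL2 Ω (l2Proj V (toL2 Ω w)) - toL2 Ω (ritz V w) := by
      rw [hv, Submodule.coe_sub, map_sub]
    calc inner ℝ (toL2 Ω (v : H10 Ω)) (toL2 Ω v) =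
        inner ℝ (toL2 Ω (l2Proj V (toL2 Ω w)) - toL2 Ω (ritz V w)) (toL2 Ω v) := by rw [ev]
      _ = _ := by rw [map_sub, inner_sub_left, inner_sub_left, h]
  rw [real_inner_self_eq_norm_sq] at h1
  have h2 := real_inner_le_norm (toL2 Ω (w - ritz V w)) (toL2 Ω v)
  have h3 : ritzErrL2 V w = ‖toL2 Ω (w - ritz V w)‖ := by
    rw [ritzErrL2, ← norm_neg, ← map_neg, neg_sub]
  rw [h3]
  rw [← h1] at h2
  by_contra! h4
  have := norm_nonneg (toL2 Ω (w - ritz V w))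
  nlinarith

end Ritz

end FracWave

namespace FracWave

/-! ### Difference quotients of curves with a singular third derivative -/

open Filter Topology
open Set (Icc Ioo Ioc)

variable {X : Type*} [NormedAddCommGroup X]

lemma continuousOn_comp_add {w : ℝ → X} {S : Set ℝ} {t κ : ℝ} (hw : ContinuousOn w S)
    (h : ∀ s ∈ Icc 0 κ, t + s ∈ S) : ContinuousOn (fun s => w (t + s)) (Icc 0 κ) :=
  hw.comp (by fun_prop) h

lemma continuousOn_comp_sub {w : ℝ → X} {S : Set ℝ} {t κ : ℝ} (hw : ContinuousOn w S)
    (h : ∀ s ∈ Icc 0 κ, t - s ∈ S) : ContinuousOn (fun s => w (t - s)) (Icc 0 κ) :=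
  hw.comp (by fun_prop) h

variable [NormedSpace ℝ X]

/-- A curve `u` on `[0, T]` which is `C²` up to `t = 0` and `C⁴` on `(0, T]`, with an integrable
third derivative; `u₁, …, u₄` are its derivatives. -/
structure TimeReg (T : ℝ) (u u₁ u₂ u₃ u₄ : ℝ → X) : Prop where
  cont₀ : ContinuousOn u (Icc 0 T)
  cont₁ : ContinuousOn u₁ (Icc 0 T)
  cont₂ : ContinuousOn u₂ (Icc 0 T)
  cont₃ : ContinuousOn u₃ (Ioc 0 T)
  cont₄ : ContinuousOn u₄ (Ioc 0 T)
  deriv₀ : ∀ t ∈ Ioo 0 T, HasDerivAt u (u₁ t) t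
  deriv₁ : ∀ t ∈ Ioo 0 T, HasDerivAt u₁ (u₂ t) t
  deriv₂ : ∀ t ∈ Ioo 0 T, HasDerivAt u₂ (u₃ t) t
  deriv₃ : ∀ t ∈ Ioo 0 T, HasDerivAt u₃ (u₄ t) t
  int₃ : IntervalIntegrable u₃ volume 0 T

section MeanValue

variable [CompleteSpace X]

lemma norm_sub_le_of_hasDerivAt_Ioo {f f' : ℝ → X} {b C : ℝ} (hc : ContinuousOn f (Icc 0 b))
    (hc' : ContinuousOn f' (Icc 0 b)) (hd : ∀ s ∈ Ioo 0 b, HasDerivAt f (f' s) s)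
    (hC : ∀ s ∈ Icc 0 b, ‖f' s‖ ≤ C) {s : ℝ} (hs : s ∈ Icc 0 b) : ‖f s - f 0‖ ≤ C * s := by
  have hsub : Icc 0 s ⊆ Icc 0 b := Set.Icc_subset_Icc_right hs.2
  rw [← intervalIntegral.integral_eq_sub_of_hasDerivAt_of_le hs.1 (hc.mono hsub)
    (fun x hx => hd x ⟨hx.1, hx.2.trans_le hs.2⟩)
    (ContinuousOn.intervalIntegrable_of_Icc hs.1 (hc'.mono hsub))]
  have := intervalIntegral.norm_integral_le_of_norm_le_const (a := 0) (b := s) (f := f') (C := C)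
    fun x hx => by
      rw [Set.uIoc_of_le hs.1] at hx
      exact hC x (hsub ⟨hx.1.le, hx.2⟩)
  rwa [sub_zero, abs_of_nonneg hs.1] at this

/-- A second order mean value inequality, with a generous constant. -/
lemma norm_le_of_second_deriv {f f' f'' : ℝ → X} {b C : ℝ} (hb : 0 ≤ b)
    (hc : ContinuousOn f (Icc 0 b)) (hc' : ContinuousOn f' (Icc 0 b))
    (hc'' : ContinuousOn f'' (Icc 0 b)) (hd : ∀ s ∈ Ioo 0 b, HasDerivAt f (f' s) s)
    (hd' : ∀ s ∈ Ioo 0 b, HasDerivAt f' (f'' s) s) (h0 : f 0 = 0) (h0' : f' 0 = 0)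
    (hC : ∀ s ∈ Icc 0 b, ‖f'' s‖ ≤ C) : ‖f b‖ ≤ C * b ^ 2 := by
  have hC0 : 0 ≤ C := (norm_nonneg _).trans (hC 0 ⟨le_rfl, hb⟩)
  have h1 : ∀ s ∈ Icc 0 b, ‖f' s‖ ≤ C * b := fun s hs => by
    have := norm_sub_le_of_hasDerivAt_Ioo hc' hc'' hd' hC hs
    rw [h0', sub_zero] at this
    exact this.trans (mul_le_mul_of_nonneg_left hs.2 hC0)
  have := norm_sub_le_of_hasDerivAt_Ioo hc hc' hd h1 ⟨hb, le_rfl⟩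
  rw [h0, sub_zero] at this
  linarith

end MeanValue

namespace TimeReg

variable {T : ℝ} {u u₁ u₂ u₃ u₄ : ℝ → X}

lemma intervalIntegrable₃ (H : TimeReg T u u₁ u₂ u₃ u₄) {a b : ℝ} (ha : 0 ≤ a) (hab : a ≤ b)
    (hb : b ≤ T) : IntervalIntegrable u₃ volume a b :=
  H.int₃.mono_set (by
    rw [Set.uIcc_of_le hab, Set.uIcc_of_le (ha.trans (hab.trans hb))]
    exact Set.Icc_subset_Icc ha hb)

lemma intervalIntegrable₄ (H : TimeReg T u u₁ u₂ u₃ u₄) {a b : ℝ} (ha : 0 < a) (hab : a ≤ b)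
    (hb : b ≤ T) : IntervalIntegrable u₄ volume a b :=
  (H.cont₄.mono fun _ hx => ⟨ha.trans_le hx.1, hx.2.trans hb⟩).intervalIntegrable_of_Icc hab

lemma integral₃_mono (H : TimeReg T u u₁ u₂ u₃ u₄) {a b c e : ℝ} (ha : 0 ≤ a) (hac : a ≤ c)
    (hce : c ≤ e) (heb : e ≤ b) (hb : b ≤ T) :
    ∫ t in c..e, ‖u₃ t‖ ≤ ∫ t in a..b, ‖u₃ t‖ :=
  intervalIntegral.integral_mono_interval hac hce heb
    (ae_of_all _ fun _ => norm_nonneg _)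
    (H.intervalIntegrable₃ ha (hac.trans (hce.trans heb)) hb).norm

lemma integral₄_mono (H : TimeReg T u u₁ u₂ u₃ u₄) {a b c e : ℝ} (ha : 0 < a) (hac : a ≤ c)
    (hce : c ≤ e) (heb : e ≤ b) (hb : b ≤ T) :
    ∫ t in c..e, ‖u₄ t‖ ≤ ∫ t in a..b, ‖u₄ t‖ :=
  intervalIntegral.integral_mono_interval hac hce heb
    (ae_of_all _ fun _ => norm_nonneg _)
    (H.intervalIntegrable₄ ha (hac.trans (hce.trans heb)) hb).norm

variable [CompleteSpace X]

lemma norm_sub₂_le (H : TimeReg T u u₁ u₂ u₃ u₄) {a b : ℝ} (ha : 0 ≤ a) (hab : a ≤ b)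
    (hb : b ≤ T) : ‖u₂ b - u₂ a‖ ≤ ∫ t in a..b, ‖u₃ t‖ := by
  rw [← intervalIntegral.integral_eq_sub_of_hasDerivAt_of_le hab
    (H.cont₂.mono (Set.Icc_subset_Icc ha hb))
    (fun x hx => H.deriv₂ x ⟨ha.trans_lt hx.1, hx.2.trans_le hb⟩) (H.intervalIntegrable₃ ha hab hb)]
  exact intervalIntegral.norm_integral_le_integral_norm hab

lemma norm_sub₃_le (H : TimeReg T u u₁ u₂ u₃ u₄) {a b : ℝ} (ha : 0 < a) (hab : a ≤ b)
    (hb : b ≤ T) : ‖u₃ b - u₃ a‖ ≤ ∫ t in a..b, ‖u₄ t‖ := by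
  rw [← intervalIntegral.integral_eq_sub_of_hasDerivAt_of_le hab
    (H.cont₃.mono fun _ hx => ⟨ha.trans_le hx.1, hx.2.trans hb⟩)
    (fun x hx => H.deriv₃ x ⟨ha.trans hx.1, hx.2.trans_le hb⟩) (H.intervalIntegrable₄ ha hab hb)]
  exact intervalIntegral.norm_integral_le_integral_norm hab

lemma norm_second_difference_le (H : TimeReg T u u₁ u₂ u₃ u₄) {t κ M : ℝ} (hκ : 0 < κ)
    (ht : κ ≤ t) (htT : t + κ ≤ T)
    (hM : ∀ s ∈ Icc 0 κ, ‖u₂ (t + s) + u₂ (t - s) - (2 : ℝ) • u₂ t‖ ≤ M) :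
    ‖(κ ^ 2)⁻¹ • (u (t + κ) - (2 : ℝ) • u t + u (t - κ)) - u₂ t‖ ≤ M := by
  have mp : ∀ s ∈ Icc 0 κ, t + s ∈ Icc 0 T := fun s hs =>
    ⟨by linarith [hs.1], by linarith [hs.2]⟩
  have mm : ∀ s ∈ Icc 0 κ, t - s ∈ Icc 0 T := fun s hs =>
    ⟨by linarith [hs.2], by linarith [hs.1]⟩
  have dp : ∀ s ∈ Ioo 0 κ, t + s ∈ Ioo 0 T := fun s hs =>
    ⟨by linarith [hs.1], by linarith [hs.2]⟩
  have dm : ∀ s ∈ Ioo 0 κ, t - s ∈ Ioo 0 T := fun s hs =>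
    ⟨by linarith [hs.2], by linarith [hs.1]⟩
  have h := norm_le_of_second_deriv (b := κ) (C := M)
    (f := fun s => u (t + s) + u (t - s) - (2 : ℝ) • u t - s ^ 2 • u₂ t)
    (f' := fun s => u₁ (t + s) - u₁ (t - s) - (2 * s) • u₂ t)
    (f'' := fun s => u₂ (t + s) + u₂ (t - s) - (2 : ℝ) • u₂ t) hκ.le
    ((((continuousOn_comp_add H.cont₀ mp).add (continuousOn_comp_sub H.cont₀ mm)).sub
      continuousOn_const).sub (by fun_prop))
    (((continuousOn_comp_add H.cont₁ mp).sub (continuousOn_comp_sub H.cont₁ mm)).sub (by fun_prop))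
    (((continuousOn_comp_add H.cont₂ mp).add (continuousOn_comp_sub H.cont₂ mm)).sub
      continuousOn_const)
    (fun s hs => by
      have h := ((((H.deriv₀ _ (dp s hs)).comp_const_add t s).add
        ((H.deriv₀ _ (dm s hs)).comp_const_sub t s)).sub_const ((2 : ℝ) • u t)).sub
        (((hasDerivAt_id s).pow 2).smul_const (u₂ t))
      refine h.congr_deriv ?_
      simp [sub_eq_add_neg])
    (fun s hs => by
      have h := (((H.deriv₁ _ (dp s hs)).comp_const_add t s).sub
        ((H.deriv₁ _ (dm s hs)).comp_const_sub t s)).sub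
        (((hasDerivAt_id s).const_mul 2).smul_const (u₂ t))
      refine h.congr_deriv ?_
      simp)
    (by simp [two_smul]) (by simp) hM
  have e : (κ ^ 2)⁻¹ • (u (t + κ) - (2 : ℝ) • u t + u (t - κ)) - u₂ t =
      (κ ^ 2)⁻¹ • (u (t + κ) + u (t - κ) - (2 : ℝ) • u t - κ ^ 2 • u₂ t) := by
    rw [smul_sub _ _ (κ ^ 2 • u₂ t), inv_smul_smul₀ (by positivity)]
    congr 2; abel
  rw [e, norm_smul, Real.norm_of_nonneg (by positivity), inv_mul_le_iff₀ (by positivity)]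
  linarith

/-- The bound near `t = 0`, where `u₄` need not be integrable. -/
lemma norm_second_difference_le₃ (H : TimeReg T u u₁ u₂ u₃ u₄) {t κ : ℝ} (hκ : 0 < κ)
    (ht : κ ≤ t) (htT : t + κ ≤ T) :
    ‖(κ ^ 2)⁻¹ • (u (t + κ) - (2 : ℝ) • u t + u (t - κ)) - u₂ t‖ ≤
      ∫ s in (t - κ)..(t + κ), ‖u₃ s‖ := by
  refine H.norm_second_difference_le hκ ht htT fun s hs => ?_
  have h1 := H.norm_sub₂_le (a := t) (b := t + s) (by linarith) (by linarith [hs.1])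
    (by linarith [hs.2])
  have h2 := H.norm_sub₂_le (a := t - s) (b := t) (by linarith [hs.2]) (by linarith [hs.1])
    (by linarith)
  have h3 : u₂ (t + s) + u₂ (t - s) - (2 : ℝ) • u₂ t =
      (u₂ (t + s) - u₂ t) - (u₂ t - u₂ (t - s)) := by rw [two_smul]; abel
  have h4 := intervalIntegral.integral_add_adjacent_intervals
    (H.intervalIntegrable₃ (a := t - s) (b := t) (by linarith [hs.2]) (by linarith [hs.1])
      (by linarith)).norm
    (H.intervalIntegrable₃ (a := t) (b := t + s) (by linarith) (by linarith [hs.1])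
      (by linarith [hs.2])).norm
  have h5 := H.integral₃_mono (a := t - κ) (b := t + κ) (c := t - s) (e := t + s)
    (by linarith) (by linarith [hs.2]) (by linarith [hs.1]) (by linarith [hs.2]) htT
  rw [h3]
  refine (norm_sub_le _ _).trans ?_
  linarith

/-- The bound away from `t = 0`, which gains a factor `κ` over `norm_second_difference_le₃`. -/
lemma norm_second_difference_le₄ (H : TimeReg T u u₁ u₂ u₃ u₄) {t κ : ℝ} (hκ : 0 < κ)
    (ht : κ < t) (htT : t + κ ≤ T) :
    ‖(κ ^ 2)⁻¹ • (u (t + κ) - (2 : ℝ) • u t + u (t - κ)) - u₂ t‖ ≤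
      κ * ∫ s in (t - κ)..(t + κ), ‖u₄ s‖ := by
  refine H.norm_second_difference_le hκ ht.le htT fun s hs => ?_
  have mp : ∀ s ∈ Icc 0 κ, t + s ∈ Ioc 0 T := fun s hs =>
    ⟨by linarith [hs.1], by linarith [hs.2]⟩
  have mm : ∀ s ∈ Icc 0 κ, t - s ∈ Ioc 0 T := fun s hs =>
    ⟨by linarith [hs.2], by linarith [hs.1]⟩
  have h := norm_sub_le_of_hasDerivAt_Ioo (b := κ) (C := ∫ s in (t - κ)..(t + κ), ‖u₄ s‖)
    (f := fun s => u₂ (t + s) + u₂ (t - s) - (2 : ℝ) • u₂ t)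
    (f' := fun s => u₃ (t + s) - u₃ (t - s))
    (((continuousOn_comp_add H.cont₂ fun s hs => Set.Ioc_subset_Icc_self (mp s hs)).add
      (continuousOn_comp_sub H.cont₂ fun s hs => Set.Ioc_subset_Icc_self (mm s hs))).sub
      continuousOn_const)
    ((continuousOn_comp_add H.cont₃ mp).sub (continuousOn_comp_sub H.cont₃ mm))
    (fun s hs => by
      have h := (((H.deriv₂ _ ⟨by linarith [hs.1], by linarith [hs.2]⟩).comp_const_add t s).add
        ((H.deriv₂ _ ⟨by linarith [hs.2], by linarith [hs.1]⟩).comp_const_sub t s)).sub_const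
          ((2 : ℝ) • u₂ t)
      refine h.congr_deriv ?_
      simp [sub_eq_add_neg])
    (fun s hs => (H.norm_sub₃_le (by linarith [hs.2]) (by linarith [hs.1])
      (by linarith [hs.2])).trans (H.integral₄_mono (by linarith) (by linarith [hs.2])
        (by linarith [hs.1]) (by linarith [hs.2]) htT)) hs
  simp only [add_zero, sub_zero, ← two_smul ℝ (u₂ t), sub_self] at h
  have : 0 ≤ ∫ s in (t - κ)..(t + κ), ‖u₄ s‖ :=
    intervalIntegral.integral_nonneg (by linarith) fun _ _ => norm_nonneg _
  rw [mul_comm]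
  exact h.trans (mul_le_mul_of_nonneg_left hs.2 this)

lemma norm_central_difference_le (H : TimeReg T u u₁ u₂ u₃ u₄) {t κ : ℝ} (hκ : 0 < κ)
    (ht : κ ≤ t) (htT : t + κ ≤ T) :
    ‖(2 * κ)⁻¹ • (u (t + κ) - u (t - κ)) - u₁ t‖ ≤ κ * ∫ s in (t - κ)..(t + κ), ‖u₃ s‖ := by
  have mp : ∀ s ∈ Icc 0 κ, t + s ∈ Icc 0 T := fun s hs =>
    ⟨by linarith [hs.1], by linarith [hs.2]⟩
  have mm : ∀ s ∈ Icc 0 κ, t - s ∈ Icc 0 T := fun s hs =>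
    ⟨by linarith [hs.2], by linarith [hs.1]⟩
  have dp : ∀ s ∈ Ioo 0 κ, t + s ∈ Ioo 0 T := fun s hs =>
    ⟨by linarith [hs.1], by linarith [hs.2]⟩
  have dm : ∀ s ∈ Ioo 0 κ, t - s ∈ Ioo 0 T := fun s hs =>
    ⟨by linarith [hs.2], by linarith [hs.1]⟩
  have h := norm_le_of_second_deriv (b := κ) (C := ∫ s in (t - κ)..(t + κ), ‖u₃ s‖)
    (f := fun s => u (t + s) - u (t - s) - (2 * s) • u₁ t)
    (f' := fun s => u₁ (t + s) + u₁ (t - s) - (2 : ℝ) • u₁ t)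
    (f'' := fun s => u₂ (t + s) - u₂ (t - s)) hκ.le
    (((continuousOn_comp_add H.cont₀ mp).sub (continuousOn_comp_sub H.cont₀ mm)).sub (by fun_prop))
    (((continuousOn_comp_add H.cont₁ mp).add (continuousOn_comp_sub H.cont₁ mm)).sub
      continuousOn_const)
    ((continuousOn_comp_add H.cont₂ mp).sub (continuousOn_comp_sub H.cont₂ mm))
    (fun s hs => by
      have h := (((H.deriv₀ _ (dp s hs)).comp_const_add t s).sub
        ((H.deriv₀ _ (dm s hs)).comp_const_sub t s)).sub
        (((hasDerivAt_id s).const_mul 2).smul_const (u₁ t))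
      refine h.congr_deriv ?_
      simp)
    (fun s hs => by
      have h := (((H.deriv₁ _ (dp s hs)).comp_const_add t s).add
        ((H.deriv₁ _ (dm s hs)).comp_const_sub t s)).sub_const ((2 : ℝ) • u₁ t)
      refine h.congr_deriv ?_
      simp [sub_eq_add_neg])
    (by simp) (by simp [two_smul])
    (fun s hs => (H.norm_sub₂_le (by linarith [hs.2]) (by linarith [hs.1])
      (by linarith [hs.2])).trans (H.integral₃_mono (by linarith) (by linarith [hs.2])
        (by linarith [hs.1]) (by linarith [hs.2]) htT))
  have e : (2 * κ)⁻¹ • (u (t + κ) - u (t - κ)) - u₁ t =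
      (2 * κ)⁻¹ • (u (t + κ) - u (t - κ) - (2 * κ) • u₁ t) := by
    rw [smul_sub _ _ ((2 * κ) • u₁ t), inv_smul_smul₀ (by positivity)]
  rw [e, norm_smul, Real.norm_of_nonneg (by positivity), inv_mul_le_iff₀ (by positivity)]
  have : 0 ≤ ∫ s in (t - κ)..(t + κ), ‖u₃ s‖ :=
    intervalIntegral.integral_nonneg (by linarith) fun _ _ => norm_nonneg _
  nlinarith [mul_nonneg (sq_nonneg κ) this]

/-- The increment over one time step of the error of the central difference quotient: one order
better than that error itself, at the cost of a fourth derivative. -/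
lemma norm_central_difference_sub_le (H : TimeReg T u u₁ u₂ u₃ u₄) {t κ : ℝ} (hκ : 0 < κ)
    (ht : κ < t) (htT : t + 2 * κ ≤ T) :
    ‖((2 * κ)⁻¹ • (u (t + κ + κ) - u (t + κ - κ)) - u₁ (t + κ)) -
        ((2 * κ)⁻¹ • (u (t + κ) - u (t - κ)) - u₁ t)‖ ≤
      κ ^ 2 * ∫ s in (t - κ)..(t + 2 * κ), ‖u₄ s‖ := by
  set M := ∫ s in (t - κ)..(t + 2 * κ), ‖u₄ s‖ with hM
  have hM0 : 0 ≤ M := intervalIntegral.integral_nonneg (by linarith) fun _ _ => norm_nonneg _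
  have mp : ∀ s ∈ Icc 0 κ, t + s ∈ Icc 0 T := fun s hs =>
    ⟨by linarith [hs.1], by linarith [hs.2]⟩
  have mm : ∀ s ∈ Icc 0 κ, t - s ∈ Icc 0 T := fun s hs =>
    ⟨by linarith [hs.2], by linarith [hs.1]⟩
  have mp' : ∀ s ∈ Icc 0 κ, t + κ + s ∈ Icc 0 T := fun s hs =>
    ⟨by linarith [hs.1], by linarith [hs.2]⟩
  have mm' : ∀ s ∈ Icc 0 κ, t + κ - s ∈ Icc 0 T := fun s hs =>
    ⟨by linarith [hs.2], by linarith [hs.1]⟩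
  have dp : ∀ s ∈ Ioo 0 κ, t + s ∈ Ioo 0 T := fun s hs =>
    ⟨by linarith [hs.1], by linarith [hs.2]⟩
  have dm : ∀ s ∈ Ioo 0 κ, t - s ∈ Ioo 0 T := fun s hs =>
    ⟨by linarith [hs.2], by linarith [hs.1]⟩
  have dp' : ∀ s ∈ Ioo 0 κ, t + κ + s ∈ Ioo 0 T := fun s hs =>
    ⟨by linarith [hs.1], by linarith [hs.2]⟩
  have dm' : ∀ s ∈ Ioo 0 κ, t + κ - s ∈ Ioo 0 T := fun s hs =>
    ⟨by linarith [hs.2], by linarith [hs.1]⟩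
  -- the second derivative in the half width `s` is a difference over one step of `u₂` differences
  have key : ∀ s ∈ Icc 0 κ,
      ‖(u₂ (t + κ + s) - u₂ (t + κ - s)) - (u₂ (t + s) - u₂ (t - s))‖ ≤ M * κ := by
    intro s hs
    have a1 : ∀ σ ∈ Icc 0 κ, (t + s) + σ ∈ Ioc 0 T := fun σ hσ =>
      ⟨by linarith [hs.1, hσ.1], by linarith [hs.2, hσ.2]⟩
    have a2 : ∀ σ ∈ Icc 0 κ, (t - s) + σ ∈ Ioc 0 T := fun σ hσ =>
      ⟨by linarith [hs.2, hσ.1], by linarith [hs.1, hσ.2]⟩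
    have h := norm_sub_le_of_hasDerivAt_Ioo (b := κ) (C := M)
      (f := fun σ => u₂ ((t + s) + σ) - u₂ ((t - s) + σ))
      (f' := fun σ => u₃ ((t + s) + σ) - u₃ ((t - s) + σ))
      ((continuousOn_comp_add H.cont₂ fun σ hσ => Set.Ioc_subset_Icc_self (a1 σ hσ)).sub
        (continuousOn_comp_add H.cont₂ fun σ hσ => Set.Ioc_subset_Icc_self (a2 σ hσ)))
      ((continuousOn_comp_add H.cont₃ a1).sub (continuousOn_comp_add H.cont₃ a2))
      (fun σ hσ =>
        ((H.deriv₂ _ ⟨by linarith [hs.1, hσ.1], by linarith [hs.2, hσ.2]⟩).comp_const_add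
          (t + s) σ).sub
        ((H.deriv₂ _ ⟨by linarith [hs.2, hσ.1], by linarith [hs.1, hσ.2]⟩).comp_const_add
          (t - s) σ))
      (fun σ hσ => (H.norm_sub₃_le (by linarith [hs.2, hσ.1]) (by linarith [hs.1])
        (by linarith [hs.2, hσ.2])).trans (H.integral₄_mono (by linarith)
          (by linarith [hs.2, hσ.1]) (by linarith [hs.1]) (by linarith [hs.2, hσ.2]) htT))
      (s := κ) ⟨hκ.le, le_rfl⟩
    simp only [add_zero] at h
    rwa [show t + s + κ = t + κ + s by ring, show t - s + κ = t + κ - s by ring] at h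
  have h := norm_le_of_second_deriv (b := κ) (C := M * κ)
    (f := fun s => (u (t + κ + s) - u (t + κ - s) - (2 * s) • u₁ (t + κ)) -
      (u (t + s) - u (t - s) - (2 * s) • u₁ t))
    (f' := fun s => (u₁ (t + κ + s) + u₁ (t + κ - s) - (2 : ℝ) • u₁ (t + κ)) -
      (u₁ (t + s) + u₁ (t - s) - (2 : ℝ) • u₁ t))
    (f'' := fun s => (u₂ (t + κ + s) - u₂ (t + κ - s)) - (u₂ (t + s) - u₂ (t - s))) hκ.le
    ((((continuousOn_comp_add H.cont₀ mp').sub (continuousOn_comp_sub H.cont₀ mm')).sub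
      (by fun_prop)).sub (((continuousOn_comp_add H.cont₀ mp).sub
        (continuousOn_comp_sub H.cont₀ mm)).sub (by fun_prop)))
    ((((continuousOn_comp_add H.cont₁ mp').add (continuousOn_comp_sub H.cont₁ mm')).sub
      continuousOn_const).sub (((continuousOn_comp_add H.cont₁ mp).add
        (continuousOn_comp_sub H.cont₁ mm)).sub continuousOn_const))
    (((continuousOn_comp_add H.cont₂ mp').sub (continuousOn_comp_sub H.cont₂ mm')).sub
      ((continuousOn_comp_add H.cont₂ mp).sub (continuousOn_comp_sub H.cont₂ mm)))
    (fun s hs => by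
      have h := ((((H.deriv₀ _ (dp' s hs)).comp_const_add (t + κ) s).sub
        ((H.deriv₀ _ (dm' s hs)).comp_const_sub (t + κ) s)).sub
        (((hasDerivAt_id s).const_mul 2).smul_const (u₁ (t + κ)))).sub
        ((((H.deriv₀ _ (dp s hs)).comp_const_add t s).sub
        ((H.deriv₀ _ (dm s hs)).comp_const_sub t s)).sub
        (((hasDerivAt_id s).const_mul 2).smul_const (u₁ t)))
      refine h.congr_deriv ?_
      simp)
    (fun s hs => by
      have h := ((((H.deriv₁ _ (dp' s hs)).comp_const_add (t + κ) s).add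
        ((H.deriv₁ _ (dm' s hs)).comp_const_sub (t + κ) s)).sub_const
          ((2 : ℝ) • u₁ (t + κ))).sub
        ((((H.deriv₁ _ (dp s hs)).comp_const_add t s).add
        ((H.deriv₁ _ (dm s hs)).comp_const_sub t s)).sub_const ((2 : ℝ) • u₁ t))
      refine h.congr_deriv ?_
      simp [sub_eq_add_neg])
    (by simp) (by simp [two_smul]) key
  have e : ((2 * κ)⁻¹ • (u (t + κ + κ) - u (t + κ - κ)) - u₁ (t + κ)) -
        ((2 * κ)⁻¹ • (u (t + κ) - u (t - κ)) - u₁ t) =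
      (2 * κ)⁻¹ • ((u (t + κ + κ) - u (t + κ - κ) - (2 * κ) • u₁ (t + κ)) -
      (u (t + κ) - u (t - κ) - (2 * κ) • u₁ t)) := by
    have e0 : ∀ A B : X, (2 * κ)⁻¹ • A - B = (2 * κ)⁻¹ • (A - (2 * κ) • B) := fun A B => by
      rw [smul_sub, inv_smul_smul₀ (by positivity)]
    rw [e0 _ (u₁ t), e0 _ (u₁ (t + κ)), ← smul_sub]
  rw [e, norm_smul, Real.norm_of_nonneg (by positivity), inv_mul_le_iff₀ (by positivity)]
  have : 0 ≤ κ ^ 3 * M := by positivity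
  nlinarith

lemma norm_average_sub_le (H : TimeReg T u u₁ u₂ u₃ u₄) {t s M : ℝ} (hs : 0 < s)
    (ht : s ≤ t) (htT : t + s ≤ T) (hM : ∀ t ∈ Icc 0 T, ‖u₂ t‖ ≤ M) :
    ‖(2 : ℝ)⁻¹ • (u (t + s) + u (t - s)) - u t‖ ≤ s ^ 2 * M := by
  have mp : ∀ x ∈ Icc 0 s, t + x ∈ Icc 0 T := fun x hx =>
    ⟨by linarith [hx.1], by linarith [hx.2]⟩
  have mm : ∀ x ∈ Icc 0 s, t - x ∈ Icc 0 T := fun x hx =>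
    ⟨by linarith [hx.2], by linarith [hx.1]⟩
  have dp : ∀ x ∈ Ioo 0 s, t + x ∈ Ioo 0 T := fun x hx =>
    ⟨by linarith [hx.1], by linarith [hx.2]⟩
  have dm : ∀ x ∈ Ioo 0 s, t - x ∈ Ioo 0 T := fun x hx =>
    ⟨by linarith [hx.2], by linarith [hx.1]⟩
  have h := norm_le_of_second_deriv (b := s) (C := 2 * M)
    (f := fun x => u (t + x) + u (t - x) - (2 : ℝ) • u t)
    (f' := fun x => u₁ (t + x) - u₁ (t - x))
    (f'' := fun x => u₂ (t + x) + u₂ (t - x)) hs.le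
    (((continuousOn_comp_add H.cont₀ mp).add (continuousOn_comp_sub H.cont₀ mm)).sub
      continuousOn_const)
    ((continuousOn_comp_add H.cont₁ mp).sub (continuousOn_comp_sub H.cont₁ mm))
    ((continuousOn_comp_add H.cont₂ mp).add (continuousOn_comp_sub H.cont₂ mm))
    (fun x hx => by
      have h := (((H.deriv₀ _ (dp x hx)).comp_const_add t x).add
        ((H.deriv₀ _ (dm x hx)).comp_const_sub t x)).sub_const ((2 : ℝ) • u t)
      refine h.congr_deriv ?_
      simp [sub_eq_add_neg])
    (fun x hx => by
      have h := ((H.deriv₁ _ (dp x hx)).comp_const_add t x).sub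
        ((H.deriv₁ _ (dm x hx)).comp_const_sub t x)
      refine h.congr_deriv ?_
      simp)
    (by simp [two_smul]) (by simp)
    (fun x hx => (norm_add_le _ _).trans (by linarith [hM _ (mp x hx), hM _ (mm x hx)]))
  have e : (2 : ℝ)⁻¹ • (u (t + s) + u (t - s)) - u t =
      (2 : ℝ)⁻¹ • (u (t + s) + u (t - s) - (2 : ℝ) • u t) := by
    rw [smul_sub _ _ ((2 : ℝ) • u t), inv_smul_smul₀ two_ne_zero]
  rw [e, norm_smul, Real.norm_of_nonneg (by positivity), inv_mul_le_iff₀ (by positivity)]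
  linarith

/-- The accuracy of the Taylor polynomial from which the scheme starts. -/
lemma norm_taylor_start_le (H : TimeReg T u u₁ u₂ u₃ u₄) {κ : ℝ} (hκ : 0 < κ) (hκT : κ ≤ T) :
    ‖u 0 + κ • u₁ 0 + (κ ^ 2 / 2) • u₂ 0 - u κ‖ ≤ (∫ s in (0 : ℝ)..κ, ‖u₃ s‖) * κ ^ 2 := by
  have hsub : Icc 0 κ ⊆ Icc 0 T := Set.Icc_subset_Icc_right hκT
  refine norm_le_of_second_deriv (b := κ) (C := ∫ s in (0 : ℝ)..κ, ‖u₃ s‖)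
    (f := fun s => u 0 + s • u₁ 0 + (s ^ 2 / 2) • u₂ 0 - u s)
    (f' := fun s => u₁ 0 + s • u₂ 0 - u₁ s) (f'' := fun s => u₂ 0 - u₂ s) hκ.le
    ((Continuous.continuousOn (by fun_prop)).sub (H.cont₀.mono hsub))
    ((Continuous.continuousOn (by fun_prop)).sub (H.cont₁.mono hsub))
    (continuousOn_const.sub (H.cont₂.mono hsub))
    (fun s hs => ?_) (fun s hs => ?_) (by simp) (by simp) (fun s hs => ?_)
  · have h := ((((hasDerivAt_id s).smul_const (u₁ 0)).const_add (u 0)).add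
      ((((hasDerivAt_id s).pow 2).div_const 2).smul_const (u₂ 0))).sub
      (H.deriv₀ s ⟨hs.1, hs.2.trans_le hκT⟩)
    refine h.congr_deriv ?_
    simp
  · have h := (((hasDerivAt_id s).smul_const (u₂ 0)).const_add (u₁ 0)).sub
      (H.deriv₁ s ⟨hs.1, hs.2.trans_le hκT⟩)
    refine h.congr_deriv ?_
    simp
  · rw [norm_sub_rev]
    exact (H.norm_sub₂_le le_rfl hs.1 (hs.2.trans hκT)).trans
      (H.integral₃_mono le_rfl le_rfl hs.1 hs.2 hκT)

end TimeReg

end FracWave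

namespace FracWave

/-! ### The Peano representation of the quadrature error -/

open Filter Topology Finset
open Set (Icc Ioo Ioc)

variable {X : Type*} [NormedAddCommGroup X] [NormedSpace ℝ X]

lemma continuous_sub_rpow (t : ℝ) {p : ℝ} (hp : 0 ≤ p) : Continuous fun τ : ℝ => (t - τ) ^ p :=
  (continuous_const.sub continuous_id).rpow_const fun _ => Or.inr hp

lemma hasDerivAt_sub_rpow {t τ : ℝ} (h : τ < t) (p : ℝ) :
    HasDerivAt (fun τ : ℝ => (t - τ) ^ p) (-(p * (t - τ) ^ (p - 1))) τ := by
  refine (((hasDerivAt_id τ).const_sub t).rpow_const (p := p)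
    (Or.inl (sub_pos.2 h).ne')).congr_deriv ?_
  simp

lemma intervalIntegrable_sub_rpow (t : ℝ) {r : ℝ} (hr : -1 < r) :
    IntervalIntegrable (fun τ : ℝ => (t - τ) ^ r) volume 0 t := by
  have := (intervalIntegral.intervalIntegrable_rpow' (a := t) (b := 0) hr).comp_sub_left t
  simpa using this

namespace TimeReg

variable {T : ℝ} {u u₁ u₂ u₃ u₄ : ℝ → X}

lemma intervalIntegrable_smul₃ (H : TimeReg T u u₁ u₂ u₃ u₄) {φ : ℝ → ℝ} (hφ : Continuous φ)
    {a b : ℝ} (ha : 0 ≤ a) (hab : a ≤ b) (hb : b ≤ T) :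
    IntervalIntegrable (fun τ => φ τ • u₃ τ) volume a b :=
  (H.intervalIntegrable₃ ha hab hb).continuousOn_smul hφ.continuousOn

variable [CompleteSpace X]

/-- Taylor's formula for `u₁` at `t = 0` with integral remainder. -/
lemma taylor₁ (H : TimeReg T u u₁ u₂ u₃ u₄) {t : ℝ} (ht : 0 ≤ t) (htT : t ≤ T) :
    ∫ τ in (0 : ℝ)..t, (t - τ) • u₃ τ = u₁ t - u₁ 0 - t • u₂ 0 := by
  have hsub : Icc 0 t ⊆ Icc 0 T := Set.Icc_subset_Icc_right htT
  rw [intervalIntegral.integral_eq_sub_of_hasDerivAt_of_le (f := fun τ => (t - τ) • u₂ τ + u₁ τ) ht]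
  · simp; abel
  · exact (ContinuousOn.smul (by fun_prop) (H.cont₂.mono hsub)).add (H.cont₁.mono hsub)
  · intro τ hτ
    have hτ' : τ ∈ Ioo 0 T := ⟨hτ.1, hτ.2.trans_le htT⟩
    have := (((hasDerivAt_id τ).const_sub t).smul (H.deriv₂ τ hτ')).add (H.deriv₁ τ hτ')
    refine this.congr_deriv ?_
    simp
  · exact H.intervalIntegrable_smul₃ (by fun_prop) le_rfl ht htT

/-- Taylor's formula for `u₁` with a remainder integral over an interval that does not depend on
`t`, so that it can be summed against the quadrature weights. -/
lemma taylor₁_max (H : TimeReg T u u₁ u₂ u₃ u₄) {t s : ℝ} (ht : 0 ≤ t) (hts : t ≤ s)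
    (hsT : s ≤ T) :
    ∫ τ in (0 : ℝ)..s, max (t - τ) 0 • u₃ τ = u₁ t - u₁ 0 - t • u₂ 0 := by
  have hc : Continuous fun τ : ℝ => max (t - τ) 0 := by fun_prop
  rw [← intervalIntegral.integral_add_adjacent_intervals
    (H.intervalIntegrable_smul₃ hc le_rfl ht (hts.trans hsT))
    (H.intervalIntegrable_smul₃ hc ht hts hsT), ← H.taylor₁ ht (hts.trans hsT)]
  have e2 : ∫ τ in t..s, max (t - τ) 0 • u₃ τ = 0 := by
    rw [intervalIntegral.integral_congr (g := fun _ => (0 : X)) fun τ hτ => ?_]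
    · simp
    · rw [Set.uIcc_of_le hts] at hτ
      simp [max_eq_right (sub_nonpos.2 hτ.1)]
  rw [e2, add_zero]
  refine intervalIntegral.integral_congr fun τ hτ => ?_
  rw [Set.uIcc_of_le ht] at hτ
  simp [max_eq_left (sub_nonneg.2 hτ.2)]

/-- Taylor's formula for `u₁` after the fractional derivative of order `γ > 0` is applied to it. -/
lemma fractional_taylor_pos (H : TimeReg T u u₁ u₂ u₃ u₄) {γ : ℝ} (hγ : γ ∈ Ioo (0 : ℝ) 1)
    {t : ℝ} (ht : 0 ≤ t) (htT : t ≤ T) :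
    rlIntegral (1 - γ) u₂ t = (t ^ (1 - γ) / Real.Gamma (2 - γ)) • u₂ 0 +
      ∫ τ in (0 : ℝ)..t, ((t - τ) ^ (1 - γ) / Real.Gamma (2 - γ)) • u₃ τ := by
  have hsub : Icc 0 t ⊆ Icc 0 T := Set.Icc_subset_Icc_right htT
  have h1 : (1 : ℝ) - γ ≠ 0 := by linarith [hγ.2]
  have hG : Real.Gamma (1 - γ) ≠ 0 := (Real.Gamma_pos_of_pos (by linarith [hγ.2])).ne'
  have i1 : IntervalIntegrable (fun τ => ((t - τ) ^ (1 - γ - 1)) • u₂ τ) volume 0 t := by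
    refine (intervalIntegrable_sub_rpow t (by linarith [hγ.2])).smul_continuousOn ?_
    rw [Set.uIcc_of_le ht]; exact H.cont₂.mono hsub
  have i2 := H.intervalIntegrable_smul₃ ((continuous_sub_rpow t (p := 1 - γ)
    (by linarith [hγ.2])).div_const (1 - γ)) le_rfl ht htT
  have key := intervalIntegral.integral_eq_sub_of_hasDerivAt_of_le
    (f := fun τ => -(((t - τ) ^ (1 - γ) / (1 - γ)) • u₂ τ))
    (f' := fun τ => ((t - τ) ^ (1 - γ - 1)) • u₂ τ - ((t - τ) ^ (1 - γ) / (1 - γ)) • u₃ τ) ht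
    ((((continuous_sub_rpow t (by linarith [hγ.2])).div_const _).continuousOn.smul
      (H.cont₂.mono hsub)).neg)
    (fun τ hτ => by
      have := (((hasDerivAt_sub_rpow hτ.2 (1 - γ)).div_const (1 - γ)).smul
        (H.deriv₂ τ ⟨hτ.1, hτ.2.trans_le htT⟩)).neg
      refine this.congr_deriv ?_
      rw [neg_div, mul_div_cancel_left₀ _ h1, neg_smul]
      abel)
    (i1.sub i2)
  rw [intervalIntegral.integral_sub i1 i2] at key
  simp only [sub_self, sub_zero, Real.zero_rpow h1, zero_div, zero_smul, neg_zero, zero_sub,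
    neg_neg] at key
  rw [rlIntegral, sub_eq_iff_eq_add.1 key, smul_add, smul_smul, ← intervalIntegral.integral_smul,
    Gamma_two_sub hγ.2]
  congr 1
  · congr 1; field_simp
  · refine intervalIntegral.integral_congr fun τ _ => ?_
    simp only [smul_smul]
    congr 1; field_simp

/-- Taylor's formula for `u₁` after the fractional integral of order `-γ > 0` is applied to it. -/
lemma fractional_taylor_neg (H : TimeReg T u u₁ u₂ u₃ u₄) {γ : ℝ} (hγ : γ ∈ Ioo (-1 : ℝ) 0)
    {t : ℝ} (ht : 0 ≤ t) (htT : t ≤ T) :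
    rlIntegral (-γ) u₁ t = (t ^ (-γ) / Real.Gamma (1 - γ)) • u₁ 0 +
      (t ^ (1 - γ) / Real.Gamma (2 - γ)) • u₂ 0 +
      ∫ τ in (0 : ℝ)..t, ((t - τ) ^ (1 - γ) / Real.Gamma (2 - γ)) • u₃ τ := by
  have hsub : Icc 0 t ⊆ Icc 0 T := Set.Icc_subset_Icc_right htT
  have h1 : (1 : ℝ) - γ ≠ 0 := by linarith [hγ.2]
  have h0 : -γ ≠ 0 := by linarith [hγ.2]
  have hG : Real.Gamma (-γ) ≠ 0 := (Real.Gamma_pos_of_pos (by linarith [hγ.2])).ne'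
  have hG1 : Real.Gamma (1 - γ) = -γ * Real.Gamma (-γ) := by
    rw [← Real.Gamma_add_one h0]; congr 1; ring
  have i1 : IntervalIntegrable (fun τ => ((t - τ) ^ (-γ - 1)) • u₁ τ) volume 0 t := by
    refine (intervalIntegrable_sub_rpow t (by linarith [hγ.2])).smul_continuousOn ?_
    rw [Set.uIcc_of_le ht]; exact H.cont₁.mono hsub
  have i2 := H.intervalIntegrable_smul₃ ((continuous_sub_rpow t (p := 1 - γ)
    (by linarith [hγ.2])).div_const (-γ * (1 - γ))) le_rfl ht htT
  have key := intervalIntegral.integral_eq_sub_of_hasDerivAt_of_le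
    (f := fun τ => -(((t - τ) ^ (-γ) / (-γ)) • u₁ τ) -
      ((t - τ) ^ (1 - γ) / (-γ * (1 - γ))) • u₂ τ)
    (f' := fun τ => ((t - τ) ^ (-γ - 1)) • u₁ τ - ((t - τ) ^ (1 - γ) / (-γ * (1 - γ))) • u₃ τ) ht
    (((((continuous_sub_rpow t (by linarith [hγ.2])).div_const _).continuousOn.smul
      (H.cont₁.mono hsub)).neg).sub
      (((continuous_sub_rpow t (by linarith [hγ.2])).div_const _).continuousOn.smul
      (H.cont₂.mono hsub)))
    (fun τ hτ => by
      have hτ' : τ ∈ Ioo 0 T := ⟨hτ.1, hτ.2.trans_le htT⟩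
      have := ((((hasDerivAt_sub_rpow hτ.2 (-γ)).div_const (-γ)).smul
        (H.deriv₁ τ hτ')).neg).sub
        (((hasDerivAt_sub_rpow hτ.2 (1 - γ)).div_const (-γ * (1 - γ))).smul (H.deriv₂ τ hτ'))
      refine this.congr_deriv ?_
      have e1 : -((1 - γ) * (t - τ) ^ (1 - γ - 1)) / (-γ * (1 - γ)) = -((t - τ) ^ (-γ) / -γ) := by
        rw [show 1 - γ - 1 = -γ by ring]; field_simp
      rw [neg_div, mul_div_cancel_left₀ _ h0, e1, neg_smul, neg_smul]
      abel)
    (i1.sub i2)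
  rw [intervalIntegral.integral_sub i1 i2] at key
  simp only [sub_self, sub_zero, Real.zero_rpow h1, Real.zero_rpow h0, zero_div, zero_smul,
    neg_zero, zero_sub] at key
  rw [show ∀ A B : X, -(-A - B) = A + B from fun A B => by abel] at key
  rw [rlIntegral, sub_eq_iff_eq_add.1 key, smul_add, smul_add, smul_smul, smul_smul,
    ← intervalIntegral.integral_smul, Gamma_two_sub (by linarith [hγ.2]), hG1]
  congr 1
  · congr 1
    · congr 1; field_simp
    · congr 1; field_simp
  · refine intervalIntegral.integral_congr fun τ _ => ?_
    simp only [smul_smul]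
    congr 1; field_simp

end TimeReg

/-- The Peano kernel for step size `κ`: the quadrature error at `t_n` for `t ↦ max (t - τ) 0`. -/
lemma peano_scale {κ : ℝ} (hκ : 0 < κ) (γ : ℝ) (n : ℕ) {τ : ℝ} (hτ : τ ≤ n * κ) :
    κ ^ (1 - γ) * peano γ n (n - τ / κ) = (n * κ - τ) ^ (1 - γ) / Real.Gamma (2 - γ) -
      ∑ j ∈ range (n + 1), cqWeight κ γ (n - j) * max (j * κ - τ) 0 := by
  have hs : 0 ≤ n - τ / κ := by rw [sub_nonneg, div_le_iff₀ hκ]; exact hτ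
  rw [peano, mul_sub, ← mul_div_assoc, ← Real.mul_rpow hκ.le hs, mul_sum, mul_sub,
    mul_div_cancel₀ _ hκ.ne', mul_comm κ]
  congr 1
  rw [← Finset.sum_flip]
  refine sum_congr rfl fun j hj => ?_
  have hj' : j ≤ n := by simpa [Nat.lt_succ_iff] using hj
  rw [cqWeight_eq hκ, Nat.cast_sub hj',
    show j * κ - τ = κ * (n - τ / κ - (n - j)) by field_simp; ring, ← mul_zero κ,
    ← mul_max_of_nonneg _ _ hκ.le, mul_zero, show 1 - γ = -γ + 1 by ring, Real.rpow_add hκ,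
    Real.rpow_one]
  ring

lemma peano_scale_zero {κ : ℝ} (hκ : 0 < κ) (γ : ℝ) (n : ℕ) :
    κ ^ (1 - γ) * peano γ n n = (n * κ) ^ (1 - γ) / Real.Gamma (2 - γ) -
      ∑ j ∈ range (n + 1), cqWeight κ γ (n - j) * (j * κ) := by
  have := peano_scale hκ γ n (τ := 0) (by positivity)
  simp only [zero_div, sub_zero] at this
  rw [this]
  congr 1
  refine sum_congr rfl fun j _ => ?_
  rw [max_eq_left (by positivity)]

/-- The linear correction weight is, by its definition, the quadrature error for the function `t`,
and so it decays like the Peano kernel. -/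
lemma corrWeight1_eq {κ : ℝ} (hκ : 0 < κ) {γ : ℝ} (h0 : 0 < γ) (n : ℕ) :
    corrWeight1 κ γ n = κ ^ (-γ) * peano γ n n := by
  have h := peano_scale_zero hκ γ n
  rw [← Finset.sum_flip] at h
  have e : ∑ j ∈ range (n + 1), cqWeight κ γ (n - (n - j)) * (((n - j : ℕ) : ℝ) * κ) =
      ∑ j ∈ range (n + 1), (n * κ - j * κ) * cqWeight κ γ j := by
    refine sum_congr rfl fun j hj => ?_
    have hj' : j ≤ n := by simpa [Nat.lt_succ_iff] using hj
    rw [Nat.sub_sub_self hj', Nat.cast_sub hj']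
    ring
  rw [corrWeight1, if_neg (by linarith), ← e, ← h, show 1 - γ = -γ + 1 by ring,
    Real.rpow_add hκ, Real.rpow_one]
  field_simp

namespace TimeReg

variable {T : ℝ} {u u₁ u₂ u₃ u₄ : ℝ → X} [CompleteSpace X]

/-- Peano representation of the uncorrected quadrature of `u₁`. -/
lemma peano_integral (H : TimeReg T u u₁ u₂ u₃ u₄) {γ κ : ℝ} (hγ : γ < 1) (hκ : 0 < κ) {n : ℕ}
    (hn : n * κ ≤ T) :
    ∫ τ in (0 : ℝ)..n * κ, (κ ^ (1 - γ) * peano γ n (n - τ / κ)) • u₃ τ =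
      (∫ τ in (0 : ℝ)..n * κ, ((n * κ - τ) ^ (1 - γ) / Real.Gamma (2 - γ)) • u₃ τ) -
      (∑ j ∈ range (n + 1), cqWeight κ γ (n - j) • u₁ (j * κ) -
        (∑ j ∈ range (n + 1), cqWeight κ γ j) • u₁ 0 -
        (∑ j ∈ range (n + 1), cqWeight κ γ (n - j) * (j * κ)) • u₂ 0) := by
  have hn0 : (0 : ℝ) ≤ n * κ := by positivity
  have e : ∫ τ in (0 : ℝ)..n * κ, (κ ^ (1 - γ) * peano γ n (n - τ / κ)) • u₃ τ =
      ∫ τ in (0 : ℝ)..n * κ, (((n * κ - τ) ^ (1 - γ) / Real.Gamma (2 - γ)) • u₃ τ -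
        ∑ j ∈ range (n + 1), cqWeight κ γ (n - j) • (max (j * κ - τ) 0 • u₃ τ)) := by
    refine intervalIntegral.integral_congr fun τ hτ => ?_
    rw [Set.uIcc_of_le hn0] at hτ
    rw [peano_scale hκ γ n hτ.2, sub_smul, sum_smul]
    simp only [smul_smul]
  have i0 := H.intervalIntegrable_smul₃ ((continuous_sub_rpow (n * κ) (p := 1 - γ)
    (by linarith)).div_const (Real.Gamma (2 - γ))) le_rfl hn0 hn
  have ij : ∀ j ∈ range (n + 1), IntervalIntegrable (fun τ =>
      cqWeight κ γ (n - j) • (max (j * κ - τ) 0 • u₃ τ)) volume 0 (n * κ) := fun j _ =>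
    (H.intervalIntegrable_smul₃ (by fun_prop) le_rfl hn0 hn).smul _
  have is : IntervalIntegrable (fun τ => ∑ j ∈ range (n + 1),
      cqWeight κ γ (n - j) • (max (j * κ - τ) 0 • u₃ τ)) volume 0 (n * κ) := by
    have h := IntervalIntegrable.sum _ ij
    rwa [show (∑ j ∈ range (n + 1), fun τ => cqWeight κ γ (n - j) • (max (j * κ - τ) 0 • u₃ τ)) =
      fun τ => ∑ j ∈ range (n + 1), cqWeight κ γ (n - j) • (max (j * κ - τ) 0 • u₃ τ) from by
        funext τ; simp] at h
  rw [e, intervalIntegral.integral_sub i0 is, intervalIntegral.integral_finsetSum ij]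
  congr 1
  have e3 : (∑ j ∈ range (n + 1), cqWeight κ γ j) = ∑ j ∈ range (n + 1), cqWeight κ γ (n - j) :=
    (Finset.sum_flip _).symm
  rw [e3, sum_smul, sum_smul, ← sum_sub_distrib, ← sum_sub_distrib]
  refine sum_congr rfl fun j hj => ?_
  have hj' : (j : ℝ) ≤ n := by exact_mod_cast (by simpa [Nat.lt_succ_iff] using hj : j ≤ n)
  rw [intervalIntegral.integral_smul, H.taylor₁_max (by positivity)
    (mul_le_mul_of_nonneg_right hj' hκ.le) hn, smul_sub, smul_sub, smul_smul]

/-- The Peano representation of the quadrature error for `γ < 0`. The correction does not touch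
linear functions, whence the term in `u₂ 0`. -/
lemma caputo_sub_correctedCQ_neg (H : TimeReg T u u₁ u₂ u₃ u₄) {γ κ : ℝ}
    (hγ : γ ∈ Ioo (-1 : ℝ) 0) (hκ : 0 < κ) {n : ℕ} (hn : n * κ ≤ T) :
    caputo T γ u₁ (n * κ) - correctedCQ κ γ (fun j => u₁ (j * κ)) n =
      (κ ^ (1 - γ) * peano γ n n) • u₂ 0 +
      ∫ τ in (0 : ℝ)..n * κ, (κ ^ (1 - γ) * peano γ n (n - τ / κ)) • u₃ τ := by
  rw [H.peano_integral (by linarith [hγ.2]) hκ hn, peano_scale_zero hκ γ,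
    caputo, if_pos hγ.2, H.fractional_taylor_neg hγ (by positivity) hn, correctedCQ,
    corrWeight1, if_pos hγ.2, corrWeight0, if_pos hγ.2]
  simp only [Nat.cast_zero, zero_mul, zero_smul, add_zero, sub_smul]
  abel

/-- The Peano representation of the quadrature error for `γ > 0`. The correction uses the slope of
`u₁` over the first time step in place of `u₂ 0`; the last term is the difference of the two. -/
lemma caputo_sub_correctedCQ_pos (H : TimeReg T u u₁ u₂ u₃ u₄) {γ κ : ℝ}
    (hγ : γ ∈ Ioo (0 : ℝ) 1) (hκ : 0 < κ) (hd : ∀ t ∈ Icc 0 T, derivWithin u₁ (Icc 0 T) t = u₂ t)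
    {n : ℕ} (hn1 : 1 ≤ n) (hn : n * κ ≤ T) :
    caputo T γ u₁ (n * κ) - correctedCQ κ γ (fun j => u₁ (j * κ)) n =
      (∫ τ in (0 : ℝ)..n * κ, (κ ^ (1 - γ) * peano γ n (n - τ / κ)) • u₃ τ) -
      (κ ^ (-γ) * peano γ n n) • ∫ τ in (0 : ℝ)..κ, (κ - τ) • u₃ τ := by
  have hn1' : (1 : ℝ) ≤ n := by exact_mod_cast hn1
  have hκT : κ ≤ T := by nlinarith
  have hceil : ⌈γ⌉₊ = 1 := by
    rw [Nat.ceil_eq_iff one_ne_zero]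
    simp only [Nat.sub_self, Nat.cast_zero, Nat.cast_one]
    exact ⟨hγ.1, hγ.2.le⟩
  have hcap : caputo T γ u₁ (n * κ) = rlIntegral (1 - γ) u₂ (n * κ) := by
    rw [caputo, if_neg (by linarith [hγ.1]), if_neg (by rw [hceil, Nat.cast_one]; linarith [hγ.2]),
      hceil, Nat.cast_one, rlIntegral, rlIntegral]
    congr 1
    refine intervalIntegral.integral_congr fun τ hτ => ?_
    rw [Set.uIcc_of_le (by positivity)] at hτ
    simp only [iteratedDerivWithin_one]
    rw [hd τ ⟨hτ.1, hτ.2.trans hn⟩]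
  have hs := peano_scale_zero hκ γ n
  have hw := corrWeight1_eq hκ hγ.1 n
  have hw2 : corrWeight1 κ γ n * κ = κ ^ (1 - γ) * peano γ n n := by
    rw [hw, show 1 - γ = -γ + 1 by ring, Real.rpow_add hκ, Real.rpow_one]; ring
  rw [H.peano_integral hγ.2 hκ hn, ← hw, H.taylor₁ hκ.le hκT, hcap,
    H.fractional_taylor_pos hγ (by positivity) hn, correctedCQ, corrWeight0,
    if_neg (by linarith [hγ.1])]
  rw [← hw2] at hs
  simp only [Nat.cast_zero, zero_mul, Nat.cast_one, one_mul, smul_sub, sub_smul, neg_smul,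
    smul_smul]
  rw [hs, sub_smul]
  abel

end TimeReg

end FracWave

namespace FracWave

/-! ### Summing the quadrature error over the grid -/

open Filter Topology Finset
open Set (Icc Ioo Ioc)

/-- A discrete Young inequality in `ℓ¹`. -/
lemma sum_conv_le {a b : ℕ → ℝ} (ha : ∀ n, 0 ≤ a n) (hb : ∀ n, 0 ≤ b n) (M : ℕ) :
    ∑ n ∈ range M, ∑ j ∈ range (n + 1), a (n - j) * b j ≤
      (∑ m ∈ range M, a m) * ∑ j ∈ range M, b j := by
  rw [sum_range_diag_flip M fun k l => a l * b k, mul_sum]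
  refine sum_le_sum fun j _ => ?_
  rw [← sum_mul]
  exact mul_le_mul_of_nonneg_right (sum_le_sum_of_subset_of_nonneg
    (range_subset_range.2 (Nat.sub_le M j)) fun i _ _ => ha i) (hb j)

lemma sum_brk_succ_le {e : ℝ} (he : -1 < e) (he0 : e ≤ 0) {N : ℕ} (hN : 1 ≤ N) :
    ∑ m ∈ range (N + 1), brk e m ≤ 2 * (1 + 1 / (e + 1)) * (N : ℝ) ^ (e + 1) := by
  have h1 : 0 < e + 1 := by linarith
  have hN' : (1 : ℝ) ≤ N := by exact_mod_cast hN
  refine (sum_brk_le he he0 (by omega)).trans ?_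
  have h2 : ((N + 1 : ℕ) : ℝ) ^ (e + 1) ≤ (2 * N : ℝ) ^ (e + 1) :=
    Real.rpow_le_rpow (by positivity) (by push_cast; linarith) h1.le
  rw [Real.mul_rpow (by norm_num) (by positivity)] at h2
  have h3 : (2 : ℝ) ^ (e + 1) ≤ 2 := by
    simpa using Real.rpow_le_rpow_of_exponent_le (one_le_two (α := ℝ)) (by linarith : e + 1 ≤ 1)
  have h4 : (0 : ℝ) < (N : ℝ) ^ (e + 1) := by positivity
  have h5 : 0 < 1 + 1 / (e + 1) := by positivity
  have h6 : ((N + 1 : ℕ) : ℝ) ^ (e + 1) ≤ 2 * (N : ℝ) ^ (e + 1) :=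
    h2.trans (mul_le_mul_of_nonneg_right h3 h4.le)
  calc _ ≤ (1 + 1 / (e + 1)) * (2 * (N : ℝ) ^ (e + 1)) := mul_le_mul_of_nonneg_left h6 h5.le
    _ = _ := by ring

lemma brk_antitone {e : ℝ} (he : e ≤ 0) {m n : ℕ} (h : m ≤ n) : brk e n ≤ brk e m :=
  Real.rpow_le_rpow_of_nonpos (lt_max_of_lt_left one_pos)
    (max_le_max le_rfl (by exact_mod_cast h)) he

lemma continuous_peano {γ : ℝ} (hγ : γ < 1) (n : ℕ) : Continuous (peano γ n) := by
  have : Continuous fun s : ℝ => s ^ (1 - γ) :=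
    continuous_id.rpow_const fun _ => Or.inr (by linarith)
  unfold peano
  fun_prop

lemma continuous_peano₂ {γ : ℝ} (hγ : γ < 1) (n : ℕ) : Continuous (peano₂ γ n) :=
  continuous_iff_continuousAt.2 fun s => (hasDerivAt_peano₂ hγ n s).continuousAt

variable {X : Type*} [NormedAddCommGroup X]

/-- The integral of `‖w‖` over the time step `[t_p, t_{p+1}]`. -/
noncomputable def cell (κ : ℝ) (w : ℝ → X) (p : ℕ) : ℝ :=
  ∫ τ in (p * κ)..((p + 1 : ℕ) * κ), ‖w τ‖

/-- The integral of `‖w‖` over the time step `[t_p, t_{p+1}]`, with the step at the singularity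
`t = 0` left out. -/
noncomputable def cellPos (κ : ℝ) (w : ℝ → X) (p : ℕ) : ℝ :=
  if p = 0 then 0 else cell κ w p

lemma cell_nonneg {κ : ℝ} (hκ : 0 < κ) (w : ℝ → X) (p : ℕ) : 0 ≤ cell κ w p :=
  intervalIntegral.integral_nonneg
    (mul_le_mul_of_nonneg_right (by push_cast; linarith) hκ.le) fun _ _ => norm_nonneg _

lemma cellPos_nonneg {κ : ℝ} (hκ : 0 < κ) (w : ℝ → X) (p : ℕ) : 0 ≤ cellPos κ w p := by
  unfold cellPos
  split_ifs
  · exact le_rfl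
  · exact cell_nonneg hκ w p

variable [NormedSpace ℝ X]

lemma norm_integral_le_sum_cell {κ : ℝ} (hκ : 0 < κ) {w : ℝ → X} {φ : ℝ → ℝ} (hφ : Continuous φ)
    {q n : ℕ} (hqn : q ≤ n) {B : ℕ → ℝ}
    (hw : ∀ p ∈ Finset.Ico q n, IntervalIntegrable w volume (p * κ) ((p + 1 : ℕ) * κ))
    (hB : ∀ p ∈ Finset.Ico q n, ∀ τ ∈ Icc (p * κ) ((p + 1 : ℕ) * κ), |φ τ| ≤ B p) :
    ‖∫ τ in (q * κ)..(n * κ), φ τ • w τ‖ ≤ ∑ p ∈ Finset.Ico q n, B p * cell κ w p := by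
  have hi : ∀ p ∈ Finset.Ico q n, IntervalIntegrable (fun τ => φ τ • w τ) volume
      (p * κ) ((p + 1 : ℕ) * κ) := fun p hp => (hw p hp).continuousOn_smul hφ.continuousOn
  rw [← intervalIntegral.sum_integral_adjacent_intervals_Ico (a := fun p : ℕ => (p : ℝ) * κ) hqn
    fun p hp => hi p (Finset.mem_Ico.2 hp)]
  refine norm_sum_le_of_le _ fun p hp => ?_
  have hle : (p : ℝ) * κ ≤ (p + 1 : ℕ) * κ :=
    mul_le_mul_of_nonneg_right (by push_cast; linarith) hκ.le
  rw [cell, ← intervalIntegral.integral_const_mul]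
  refine (intervalIntegral.norm_integral_le_integral_norm hle).trans ?_
  refine intervalIntegral.integral_mono_on hle (hi p hp).norm ((hw p hp).norm.const_mul _)
    fun τ hτ => ?_
  rw [norm_smul, Real.norm_eq_abs]
  exact mul_le_mul_of_nonneg_right (hB p hp τ hτ) (norm_nonneg _)

/-- The quantities through which the solution enters the consistency error on the grid
`t_n = n κ`, `n ≤ N`: a bound `h` for `u₃` on a single time step, bounds `S₃` and `S₄` for the
`L¹` norms of `u₃` and, without the first time step, of `u₄`, and a bound `M` for `u₂`. -/
structure GridBounds (T κ : ℝ) (N : ℕ) (u₂ u₃ u₄ : ℝ → X) (h S₃ S₄ M : ℝ) : Prop where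
  cell_le : ∀ p < N, cell κ u₃ p ≤ h
  first_le : κ * ‖u₃ κ‖ ≤ h
  sum₃_le : ∑ p ∈ range N, cell κ u₃ p ≤ S₃
  sum₄_le : ∑ p ∈ range N, cellPos κ u₄ p ≤ S₄
  bound₂ : ∀ t ∈ Icc 0 T, ‖u₂ t‖ ≤ M

/-- The Peano kernel of the quadrature at `t_{n+1}`, on the time step `[t_p, t_{p+1}]`. -/
lemma exists_peano_cell_bound {γ : ℝ} (hγ : γ ∈ Ioo (-1 : ℝ) 1) :
    ∃ C > 0, (∀ n : ℕ, |peano γ n n| ≤ C * brk (-γ - 1) n) ∧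
      ∀ κ : ℝ, 0 < κ → ∀ n p : ℕ, p ≤ n →
        ∀ τ ∈ Icc ((p : ℝ) * κ) (((p + 1 : ℕ) : ℝ) * κ),
      |peano γ (n + 1) ((n + 1 : ℕ) - τ / κ)| ≤ C * brk (-γ - 1) (n - p) := by
  obtain ⟨C, hC0, hC⟩ := exists_peano_bound hγ
  refine ⟨C, hC0, fun n => ?_, fun κ hκ n p hpn τ hτ => ?_⟩
  · have := hC n n 0 le_rfl le_rfl zero_le_one
    rwa [add_zero] at this
  · have h := hC (n + 1) (n - p) ((p + 1 : ℕ) - τ / κ) (by omega)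
      (by rw [sub_nonneg, div_le_iff₀ hκ]; exact hτ.2)
      (by rw [sub_le_iff_le_add, ← sub_le_iff_le_add', le_div_iff₀ hκ]; push_cast; linarith [hτ.1])
    rw [Nat.cast_sub hpn] at h
    convert h using 3
    push_cast; ring

/-- The second Peano kernel of the quadrature at `t_{n+1}`, on the time step `[t_p, t_{p+1}]`. -/
lemma exists_peano₂_cell_bound {γ : ℝ} (hγ : γ ∈ Ioo (0 : ℝ) 1) :
    ∃ C > 0, (∀ n : ℕ, |peano₂ γ (n + 1) n| ≤ C * brk (-γ) n) ∧
      ∀ κ : ℝ, 0 < κ → ∀ n p : ℕ, p ≤ n →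
        ∀ τ ∈ Icc ((p : ℝ) * κ) (((p + 1 : ℕ) : ℝ) * κ),
      |peano₂ γ (n + 1) ((n + 1 : ℕ) - τ / κ)| ≤ C * brk (-γ) (n - p) := by
  obtain ⟨C, hC0, hC⟩ := exists_peano₂_bound hγ
  refine ⟨C, hC0, fun n => ?_, fun κ hκ n p hpn τ hτ => ?_⟩
  · have := hC (n + 1) n 0 (by omega) le_rfl zero_le_one
    rwa [add_zero] at this
  · have h := hC (n + 1) (n - p) ((p + 1 : ℕ) - τ / κ) (by omega)
      (by rw [sub_nonneg, div_le_iff₀ hκ]; exact hτ.2)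
      (by rw [sub_le_iff_le_add, ← sub_le_iff_le_add', le_div_iff₀ hκ]; push_cast; linarith [hτ.1])
    rw [Nat.cast_sub hpn] at h
    convert h using 3
    push_cast; ring

namespace TimeReg

variable {T : ℝ} {u u₁ u₂ u₃ u₄ : ℝ → X}

lemma intervalIntegrable_cell₃ (H : TimeReg T u u₁ u₂ u₃ u₄) {κ : ℝ} (hκ : 0 < κ) {N p : ℕ}
    (hN : N * κ = T) (hp : p < N) :
    IntervalIntegrable u₃ volume (p * κ) ((p + 1 : ℕ) * κ) := by
  refine H.intervalIntegrable₃ (by positivity)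
    (mul_le_mul_of_nonneg_right (by push_cast; linarith) hκ.le) ?_
  rw [← hN]
  exact mul_le_mul_of_nonneg_right (by exact_mod_cast hp) hκ.le

lemma intervalIntegrable_cell₄ (H : TimeReg T u u₁ u₂ u₃ u₄) {κ : ℝ} (hκ : 0 < κ) {N p : ℕ}
    (hN : N * κ = T) (hp1 : 1 ≤ p) (hp : p < N) :
    IntervalIntegrable u₄ volume (p * κ) ((p + 1 : ℕ) * κ) := by
  have : (0 : ℝ) < p := by exact_mod_cast hp1
  refine H.intervalIntegrable₄ (by positivity)
    (mul_le_mul_of_nonneg_right (by push_cast; linarith) hκ.le) ?_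
  rw [← hN]
  exact mul_le_mul_of_nonneg_right (by exact_mod_cast hp) hκ.le

end TimeReg

/-- The quadrature error for `γ < 0`. The kernel has size `κ^(1-γ) n^(-γ-1)`, and the sum of this
over the grid is `O(κ)`. -/
lemma exists_cq_bound_neg {γ : ℝ} (hγ : γ ∈ Ioo (-1 : ℝ) 0) {T : ℝ} (hT : 0 < T)
    [CompleteSpace X] :
    ∃ K > 0, ∀ (κ : ℝ) (N : ℕ) (u u₁ u₂ u₃ u₄ : ℝ → X) (h S₃ S₄ M : ℝ), 0 < κ → N * κ = T →
      TimeReg T u u₁ u₂ u₃ u₄ → GridBounds T κ N u₂ u₃ u₄ h S₃ S₄ M →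
      κ * ∑ n ∈ range N, ‖caputo T γ u₁ ((n + 1 : ℕ) * κ) -
        correctedCQ κ γ (fun j => u₁ (j * κ)) (n + 1)‖ ≤ K * (κ ^ 2 * S₃ + κ ^ 2 * M) := by
  obtain ⟨C, hC0, hC1, hC⟩ := exists_peano_cell_bound (γ := γ) ⟨hγ.1, by linarith [hγ.2]⟩
  have hγ' : 0 < -γ := by linarith [hγ.2]
  set c := 2 * (1 + 1 / (-γ)) with hc
  have hc0 : 0 < c := by positivity
  refine ⟨C * c * T ^ (-γ), by positivity, fun κ N u u₁ u₂ u₃ u₄ h S₃ S₄ M hκ hN H G => ?_⟩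
  have hN1 : 1 ≤ N := by
    rcases Nat.eq_zero_or_pos N with rfl | h
    · simp at hN; linarith
    · exact h
  have hNpos : (0 : ℝ) < N := by exact_mod_cast hN1
  have hM0 : 0 ≤ M := (norm_nonneg _).trans (G.bound₂ 0 ⟨le_rfl, hT.le⟩)
  have hS0 : 0 ≤ S₃ := (sum_nonneg fun p _ => cell_nonneg hκ u₃ p).trans G.sum₃_le
  have hκp : 0 < κ ^ (1 - γ) := Real.rpow_pos_of_pos hκ _
  have term : ∀ n ∈ range N, ‖caputo T γ u₁ ((n + 1 : ℕ) * κ) -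
      correctedCQ κ γ (fun j => u₁ (j * κ)) (n + 1)‖ ≤
      κ ^ (1 - γ) * C * (brk (-γ - 1) (n + 1) * M +
        ∑ p ∈ range (n + 1), brk (-γ - 1) (n - p) * cell κ u₃ p) := by
    intro n hn
    have hn' : n + 1 ≤ N := mem_range.1 hn
    have hnT : ((n + 1 : ℕ) : ℝ) * κ ≤ T := by
      rw [← hN]; exact mul_le_mul_of_nonneg_right (by exact_mod_cast hn') hκ.le
    rw [H.caputo_sub_correctedCQ_neg hγ hκ hnT]
    have b1 : ‖(κ ^ (1 - γ) * peano γ (n + 1) (n + 1 : ℕ)) • u₂ 0‖ ≤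
        κ ^ (1 - γ) * C * (brk (-γ - 1) (n + 1) * M) := by
      rw [norm_smul, norm_mul, Real.norm_of_nonneg hκp.le, Real.norm_eq_abs]
      calc κ ^ (1 - γ) * |peano γ (n + 1) (n + 1 : ℕ)| * ‖u₂ 0‖
          ≤ κ ^ (1 - γ) * (C * brk (-γ - 1) (n + 1)) * M := by
            have := hC1 (n + 1)
            have h2 := G.bound₂ 0 ⟨le_rfl, hT.le⟩
            have hb := brk_pos (-γ - 1) (n + 1)
            gcongr
        _ = _ := by ring
    have b2 := norm_integral_le_sum_cell hκ (w := u₃) (q := 0) (n := n + 1)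
      (φ := fun τ => κ ^ (1 - γ) * peano γ (n + 1) ((n + 1 : ℕ) - τ / κ))
      (B := fun p => κ ^ (1 - γ) * (C * brk (-γ - 1) (n - p)))
      (continuous_const.mul ((continuous_peano (by linarith [hγ.2]) _).comp (by fun_prop)))
      (Nat.zero_le _)
      (fun p hp => H.intervalIntegrable_cell₃ hκ hN ((Finset.mem_Ico.1 hp).2.trans_le hn'))
      (fun p hp τ hτ => by
        rw [abs_mul, abs_of_pos hκp]
        exact mul_le_mul_of_nonneg_left (hC κ hκ n p
          (Nat.lt_succ_iff.1 (Finset.mem_Ico.1 hp).2) τ hτ) hκp.le)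
    rw [Nat.cast_zero, zero_mul, ← range_eq_Ico] at b2
    rw [mul_add, mul_sum]
    refine (norm_add_le _ _).trans (add_le_add b1 (b2.trans (le_of_eq ?_)))
    exact sum_congr rfl fun p _ => by ring
  have young := sum_conv_le (a := brk (-γ - 1)) (b := cell κ u₃) (fun n => (brk_pos _ n).le)
    (fun p => cell_nonneg hκ u₃ p) N
  have hbs := sum_brk_succ_le (e := -γ - 1) (by linarith) (by linarith [hγ.1]) hN1
  rw [show -γ - 1 + 1 = -γ by ring] at hbs
  set Bs := ∑ m ∈ range (N + 1), brk (-γ - 1) m with hBs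
  have s1 : ∑ n ∈ range N, brk (-γ - 1) (n + 1) ≤ Bs := by
    rw [hBs, sum_range_succ']; exact le_add_of_nonneg_right (brk_pos _ _).le
  have s2 : ∑ n ∈ range N, brk (-γ - 1) n ≤ Bs := by
    rw [hBs, sum_range_succ]; exact le_add_of_nonneg_right (brk_pos _ _).le
  have hBs0 : 0 ≤ Bs := sum_nonneg fun _ _ => (brk_pos _ _).le
  calc κ * ∑ n ∈ range N, ‖caputo T γ u₁ ((n + 1 : ℕ) * κ) -
        correctedCQ κ γ (fun j => u₁ (j * κ)) (n + 1)‖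
      ≤ κ * ∑ n ∈ range N, κ ^ (1 - γ) * C * (brk (-γ - 1) (n + 1) * M +
        ∑ p ∈ range (n + 1), brk (-γ - 1) (n - p) * cell κ u₃ p) :=
        mul_le_mul_of_nonneg_left (sum_le_sum term) hκ.le
    _ = κ * κ ^ (1 - γ) * C * ((∑ n ∈ range N, brk (-γ - 1) (n + 1)) * M +
        ∑ n ∈ range N, ∑ p ∈ range (n + 1), brk (-γ - 1) (n - p) * cell κ u₃ p) := by
        rw [← mul_sum, sum_add_distrib, sum_mul]; ring
    _ ≤ κ * κ ^ (1 - γ) * C * (Bs * M + Bs * S₃) := by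
        have h3 := young.trans (mul_le_mul s2 G.sum₃_le
          (sum_nonneg fun p _ => cell_nonneg hκ u₃ p) hBs0)
        gcongr
    _ ≤ κ * κ ^ (1 - γ) * C * (c * (N : ℝ) ^ (-γ) * M + c * (N : ℝ) ^ (-γ) * S₃) := by gcongr
    _ = C * c * T ^ (-γ) * (κ ^ 2 * S₃ + κ ^ 2 * M) := by
        have e1 : T ^ (-γ) = (N : ℝ) ^ (-γ) * κ ^ (-γ) := by
          rw [← hN, Real.mul_rpow hNpos.le hκ.le]
        have e2 : κ ^ (1 - γ) = κ * κ ^ (-γ) := by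
          rw [show 1 - γ = 1 + -γ by ring, Real.rpow_add hκ, Real.rpow_one]
        rw [e1, e2]; ring

/-- The quadrature error for `γ > 0`. Here the sum of `κ^(1-γ) n^(-γ-1)` over the grid is only
`O(κ^(1-γ))`. Away from the first time step an integration by parts replaces it by the sum of
`κ^(2-γ) n^(-γ)`, which is `O(κ)`. -/
lemma exists_cq_bound_pos {γ : ℝ} (hγ : γ ∈ Ioo (0 : ℝ) 1) {T : ℝ} (hT : 0 < T)
    [CompleteSpace X] :
    ∃ K > 0, ∀ (κ : ℝ) (N : ℕ) (u u₁ u₂ u₃ u₄ : ℝ → X) (h S₃ S₄ M : ℝ), 0 < κ → N * κ = T →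
      TimeReg T u u₁ u₂ u₃ u₄ → (∀ t ∈ Icc 0 T, derivWithin u₁ (Icc 0 T) t = u₂ t) →
      GridBounds T κ N u₂ u₃ u₄ h S₃ S₄ M →
      κ * ∑ n ∈ range N, ‖caputo T γ u₁ ((n + 1 : ℕ) * κ) -
        correctedCQ κ γ (fun j => u₁ (j * κ)) (n + 1)‖ ≤ K * (κ * h + κ ^ 2 * S₄) := by
  obtain ⟨C, hC0, hC1, hC⟩ := exists_peano_cell_bound (γ := γ) ⟨by linarith [hγ.1], hγ.2⟩
  obtain ⟨D, hD0, hD1, hD⟩ := exists_peano₂_cell_bound hγ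
  obtain ⟨B, hB0, hB⟩ := exists_sum_brk_bound (e := -γ - 1) (by linarith [hγ.1])
  have hγ' : 0 < 1 - γ := by linarith [hγ.2]
  set c := 2 * (1 + 1 / (1 - γ)) with hc
  have hc0 : 0 < c := by positivity
  refine ⟨2 * C * B * T ^ (1 - γ) + D * c * T ^ (1 - γ), by positivity,
    fun κ N u u₁ u₂ u₃ u₄ h S₃ S₄ M hκ hN H hd G => ?_⟩
  have hN1 : 1 ≤ N := by
    rcases Nat.eq_zero_or_pos N with rfl | h
    · simp at hN; linarith
    · exact h
  have hNpos : (0 : ℝ) < N := by exact_mod_cast hN1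
  have hN1' : (1 : ℝ) ≤ N := by exact_mod_cast hN1
  have hκT : κ ≤ T := by nlinarith
  have hG0 := cell_nonneg hκ u₃ 0
  have hh0 : 0 ≤ h := hG0.trans (G.cell_le 0 hN1)
  have hS0 : 0 ≤ S₄ := (sum_nonneg fun p _ => cellPos_nonneg hκ u₄ p).trans G.sum₄_le
  have hκp : 0 < κ ^ (1 - γ) := Real.rpow_pos_of_pos hκ _
  have hκp2 : 0 < κ ^ (2 - γ) := Real.rpow_pos_of_pos hκ _
  have e21 : κ ^ (2 - γ) = κ * κ ^ (1 - γ) := by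
    rw [show 2 - γ = 1 + (1 - γ) by ring, Real.rpow_add hκ, Real.rpow_one]
  have e10 : κ ^ (1 - γ) = κ ^ (-γ) * κ := by
    rw [show 1 - γ = -γ + 1 by ring, Real.rpow_add hκ, Real.rpow_one]
  have term : ∀ n ∈ range N, ‖caputo T γ u₁ ((n + 1 : ℕ) * κ) -
      correctedCQ κ γ (fun j => u₁ (j * κ)) (n + 1)‖ ≤
      κ ^ (1 - γ) * C * 2 * h * brk (-γ - 1) n + κ ^ (2 - γ) * D * (brk (-γ) n * ‖u₃ κ‖ +
        ∑ p ∈ range (n + 1), brk (-γ) (n - p) * cellPos κ u₄ p) := by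
    intro n hn
    have hn' : n + 1 ≤ N := mem_range.1 hn
    have hn1 : (1 : ℝ) ≤ (n + 1 : ℕ) := by push_cast; linarith [(Nat.cast_nonneg n : (0 : ℝ) ≤ n)]
    have hκn : κ ≤ (n + 1 : ℕ) * κ := by nlinarith
    have hnT : ((n + 1 : ℕ) : ℝ) * κ ≤ T := by
      rw [← hN]; exact mul_le_mul_of_nonneg_right (by exact_mod_cast hn') hκ.le
    rw [H.caputo_sub_correctedCQ_pos hγ hκ hd (by omega) hnT]
    have hcont : Continuous fun τ => κ ^ (1 - γ) * peano γ (n + 1) ((n + 1 : ℕ) - τ / κ) :=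
      continuous_const.mul ((continuous_peano hγ.2 _).comp (by fun_prop))
    have hcont2 : Continuous fun τ => κ ^ (2 - γ) * peano₂ γ (n + 1) ((n + 1 : ℕ) - τ / κ) :=
      continuous_const.mul ((continuous_peano₂ hγ.2 _).comp (by fun_prop))
    -- the first time step, where `u₄` need not be integrable
    have b1 := norm_integral_le_sum_cell hκ (w := u₃) (q := 0) (n := 1)
      (B := fun p => κ ^ (1 - γ) * (C * brk (-γ - 1) (n - p))) hcont (Nat.zero_le _)
      (fun p hp => H.intervalIntegrable_cell₃ hκ hN ((Finset.mem_Ico.1 hp).2.trans_le hN1))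
      (fun p hp τ hτ => by
        have := (Finset.mem_Ico.1 hp).2
        rw [abs_mul, abs_of_pos hκp]
        exact mul_le_mul_of_nonneg_left (hC κ hκ n p (by omega) τ hτ) hκp.le)
    rw [Nat.cast_zero, zero_mul, Nat.cast_one, one_mul, Nat.Ico_zero_eq_range, range_one,
      sum_singleton, Nat.sub_zero] at b1
    have b3 : ‖(κ ^ (-γ) * peano γ (n + 1) (n + 1 : ℕ)) • ∫ τ in (0 : ℝ)..κ, (κ - τ) • u₃ τ‖ ≤
        κ ^ (1 - γ) * (C * brk (-γ - 1) n) * cell κ u₃ 0 := by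
      have h1 := norm_integral_le_sum_cell hκ (w := u₃) (q := 0) (n := 1) (φ := fun τ => κ - τ)
        (B := fun _ => κ) (by fun_prop) (Nat.zero_le _)
        (fun p hp => H.intervalIntegrable_cell₃ hκ hN ((Finset.mem_Ico.1 hp).2.trans_le hN1))
        (fun p hp τ hτ => by
          have : p = 0 := by have := (Finset.mem_Ico.1 hp).2; omega
          subst this
          simp only [Nat.cast_zero, zero_mul, zero_add, Nat.cast_one, one_mul] at hτ
          rw [abs_of_nonneg (by linarith [hτ.2])]
          linarith [hτ.1])
      rw [Nat.cast_zero, zero_mul, Nat.cast_one, one_mul, Nat.Ico_zero_eq_range, range_one,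
        sum_singleton] at h1
      have h2 := (hC1 (n + 1)).trans (mul_le_mul_of_nonneg_left
        (brk_antitone (e := -γ - 1) (by linarith [hγ.1]) (Nat.le_succ n)) hC0.le)
      rw [norm_smul, norm_mul, Real.norm_of_nonneg (by positivity), Real.norm_eq_abs, e10]
      calc κ ^ (-γ) * |peano γ (n + 1) (n + 1 : ℕ)| * ‖∫ τ in (0 : ℝ)..κ, (κ - τ) • u₃ τ‖
          ≤ κ ^ (-γ) * (C * brk (-γ - 1) n) * (κ * cell κ u₃ 0) := by
            have hb := brk_pos (-γ - 1) n
            gcongr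
        _ = _ := by ring
    -- the other time steps, after an integration by parts
    have b2 : ‖∫ τ in κ..((n + 1 : ℕ) * κ),
        (κ ^ (1 - γ) * peano γ (n + 1) ((n + 1 : ℕ) - τ / κ)) • u₃ τ‖ ≤
        κ ^ (2 - γ) * D * (brk (-γ) n * ‖u₃ κ‖ +
        ∑ p ∈ range (n + 1), brk (-γ) (n - p) * cellPos κ u₄ p) := by
      have i3 := H.intervalIntegrable_smul₃ hcont hκ.le hκn hnT
      have i4 : IntervalIntegrable (fun τ =>
          (κ ^ (2 - γ) * peano₂ γ (n + 1) ((n + 1 : ℕ) - τ / κ)) • u₄ τ) volume κ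
          ((n + 1 : ℕ) * κ) :=
        (H.intervalIntegrable₄ hκ hκn hnT).continuousOn_smul hcont2.continuousOn
      have key := intervalIntegral.integral_eq_sub_of_hasDerivAt_of_le
        (f := fun τ => -((κ ^ (2 - γ) * peano₂ γ (n + 1) ((n + 1 : ℕ) - τ / κ)) • u₃ τ))
        (f' := fun τ => (κ ^ (1 - γ) * peano γ (n + 1) ((n + 1 : ℕ) - τ / κ)) • u₃ τ -
          (κ ^ (2 - γ) * peano₂ γ (n + 1) ((n + 1 : ℕ) - τ / κ)) • u₄ τ) hκn
        ((hcont2.continuousOn.smul (H.cont₃.mono fun x hx =>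
          ⟨hκ.trans_le hx.1, hx.2.trans hnT⟩)).neg)
        (fun τ hτ => by
          have hl := ((hasDerivAt_id τ).div_const κ).const_sub (((n + 1 : ℕ) : ℝ))
          have := ((((hasDerivAt_peano₂ hγ.2 (n + 1) _).comp τ hl).const_mul (κ ^ (2 - γ))).smul
            (H.deriv₃ τ ⟨hκ.trans hτ.1, hτ.2.trans_le hnT⟩)).neg
          refine this.congr_deriv ?_
          simp only [Function.comp_apply, id]
          have e3 : κ ^ (2 - γ) * (peano γ (n + 1) ((n + 1 : ℕ) - τ / κ) * -(1 / κ)) =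
              -(κ ^ (1 - γ) * peano γ (n + 1) ((n + 1 : ℕ) - τ / κ)) := by
            rw [e21]; field_simp
          rw [e3, neg_smul]
          abel)
        (i3.sub i4)
      rw [intervalIntegral.integral_sub i3 i4, sub_eq_iff_eq_add] at key
      have z0 : peano₂ γ (n + 1) 0 = 0 := by
        rw [peano₂, Real.zero_rpow (by linarith [hγ.2])]
        simp
      have hn0 : ((n + 1 : ℕ) : ℝ) - (n + 1 : ℕ) * κ / κ = 0 := by field_simp; simp
      have hn1 : ((n + 1 : ℕ) : ℝ) - κ / κ = n := by rw [div_self hκ.ne']; push_cast; ring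
      rw [hn0, hn1, z0, mul_zero, zero_smul, neg_zero, zero_sub, neg_neg] at key
      have h4 := norm_integral_le_sum_cell hκ (w := u₄) (q := 1) (n := n + 1)
        (B := fun p => κ ^ (2 - γ) * (D * brk (-γ) (n - p))) hcont2 (by omega)
        (fun p hp => H.intervalIntegrable_cell₄ hκ hN (Finset.mem_Ico.1 hp).1
          ((Finset.mem_Ico.1 hp).2.trans_le hn'))
        (fun p hp τ hτ => by
          have := (Finset.mem_Ico.1 hp).2
          rw [abs_mul, abs_of_pos hκp2]
          exact mul_le_mul_of_nonneg_left (hD κ hκ n p (by omega) τ hτ) hκp2.le)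
      rw [Nat.cast_one, one_mul] at h4
      have h5 : ∑ p ∈ Finset.Ico 1 (n + 1), κ ^ (2 - γ) * (D * brk (-γ) (n - p)) * cell κ u₄ p =
          κ ^ (2 - γ) * D * ∑ p ∈ range (n + 1), brk (-γ) (n - p) * cellPos κ u₄ p := by
        rw [range_eq_Ico, sum_eq_sum_Ico_succ_bot (Nat.succ_pos n), mul_add, mul_sum]
        simp only [cellPos, if_true, mul_zero, zero_add]
        refine sum_congr rfl fun p hp => ?_
        rw [if_neg (by have := (Finset.mem_Ico.1 hp).1; omega)]
        ring
      rw [key, mul_add]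
      refine (norm_add_le _ _).trans (add_le_add ?_ (h4.trans h5.le))
      rw [norm_smul, norm_mul, Real.norm_of_nonneg hκp2.le, Real.norm_eq_abs]
      calc κ ^ (2 - γ) * |peano₂ γ (n + 1) n| * ‖u₃ κ‖
          ≤ κ ^ (2 - γ) * (D * brk (-γ) n) * ‖u₃ κ‖ := by
            have := hD1 n
            have hb := brk_pos (-γ) n
            gcongr
        _ = _ := by ring
    have split := intervalIntegral.integral_add_adjacent_intervals
      (H.intervalIntegrable_smul₃ hcont le_rfl hκ.le hκT)
      (H.intervalIntegrable_smul₃ hcont hκ.le hκn hnT)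
    rw [← split]
    have hcell := G.cell_le 0 hN1
    have hX : κ ^ (1 - γ) * (C * brk (-γ - 1) n) * cell κ u₃ 0 ≤
        κ ^ (1 - γ) * (C * brk (-γ - 1) n) * h :=
      mul_le_mul_of_nonneg_left hcell (by have := brk_pos (-γ - 1) n; positivity)
    refine (norm_sub_le _ _).trans ((add_le_add (norm_add_le _ _) le_rfl).trans ?_)
    linarith
  have young := sum_conv_le (a := brk (-γ)) (b := cellPos κ u₄) (fun n => (brk_pos _ n).le)
    (fun p => cellPos_nonneg hκ u₄ p) N
  have hbs : ∑ m ∈ range N, brk (-γ) m ≤ c * (N : ℝ) ^ (1 - γ) := by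
    have := sum_brk_succ_le (e := -γ) (by linarith [hγ.2]) (by linarith [hγ.1]) hN1
    rw [show -γ + 1 = 1 - γ by ring, sum_range_succ] at this
    have := brk_pos (-γ) N
    linarith
  set Bs := ∑ m ∈ range N, brk (-γ) m with hBs
  have hBs0 : 0 ≤ Bs := sum_nonneg fun _ _ => (brk_pos _ _).le
  have hTκ : κ ^ (1 - γ) ≤ T ^ (1 - γ) := Real.rpow_le_rpow hκ.le hκT hγ'.le
  have eT : T ^ (1 - γ) = (N : ℝ) ^ (1 - γ) * κ ^ (1 - γ) := by
    rw [← hN, Real.mul_rpow hNpos.le hκ.le]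
  calc κ * ∑ n ∈ range N, ‖caputo T γ u₁ ((n + 1 : ℕ) * κ) -
        correctedCQ κ γ (fun j => u₁ (j * κ)) (n + 1)‖
      ≤ κ * ∑ n ∈ range N, (κ ^ (1 - γ) * C * 2 * h * brk (-γ - 1) n +
          κ ^ (2 - γ) * D * (brk (-γ) n * ‖u₃ κ‖ +
          ∑ p ∈ range (n + 1), brk (-γ) (n - p) * cellPos κ u₄ p)) :=
        mul_le_mul_of_nonneg_left (sum_le_sum term) hκ.le
    _ = κ * (κ ^ (1 - γ) * C * 2 * h * (∑ n ∈ range N, brk (-γ - 1) n) +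
        κ ^ (2 - γ) * D * (Bs * ‖u₃ κ‖ +
        ∑ n ∈ range N, ∑ p ∈ range (n + 1), brk (-γ) (n - p) * cellPos κ u₄ p)) := by
        rw [sum_add_distrib, ← mul_sum, ← mul_sum, sum_add_distrib, ← sum_mul]
    _ ≤ κ * (κ ^ (1 - γ) * C * 2 * h * B + κ ^ (2 - γ) * D * (Bs * ‖u₃ κ‖ + Bs * S₄)) := by
        have h3 := young.trans (mul_le_mul_of_nonneg_left G.sum₄_le hBs0)
        have h4 := hB N
        gcongr
    _ ≤ κ * (T ^ (1 - γ) * C * 2 * h * B + κ ^ (2 - γ) * D *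
          (c * (N : ℝ) ^ (1 - γ) * ‖u₃ κ‖ + c * (N : ℝ) ^ (1 - γ) * S₄)) := by gcongr
    _ = 2 * C * B * T ^ (1 - γ) * (κ * h) +
          D * c * T ^ (1 - γ) * (κ * (κ * ‖u₃ κ‖) + κ ^ 2 * S₄) := by
        rw [e21, eT]; ring
    _ ≤ 2 * C * B * T ^ (1 - γ) * (κ * h + κ ^ 2 * S₄) +
          D * c * T ^ (1 - γ) * (κ * h + κ ^ 2 * S₄) := by
        have h5 := G.first_le
        have h6 : κ * h ≤ κ * h + κ ^ 2 * S₄ := by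
          have : 0 ≤ κ ^ 2 * S₄ := by positivity
          linarith
        gcongr
    _ = _ := by ring

end FracWave

namespace FracWave

/-! ### The error of the difference quotients -/

open Filter Topology Finset
open Set (Icc Ioo Ioc)

variable {X : Type*} [NormedAddCommGroup X]

lemma integral_two_cells {κ : ℝ} {w : ℝ → X} {p : ℕ}
    (h0 : IntervalIntegrable w volume (p * κ) ((p + 1 : ℕ) * κ))
    (h1 : IntervalIntegrable w volume ((p + 1 : ℕ) * κ) ((p + 1 + 1 : ℕ) * κ)) :
    ∫ τ in (p * κ)..((p + 2 : ℕ) * κ), ‖w τ‖ = cell κ w p + cell κ w (p + 1) :=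
  (intervalIntegral.integral_add_adjacent_intervals h0.norm h1.norm).symm

lemma integral_three_cells {κ : ℝ} {w : ℝ → X} {p : ℕ}
    (h0 : IntervalIntegrable w volume (p * κ) ((p + 1 : ℕ) * κ))
    (h1 : IntervalIntegrable w volume ((p + 1 : ℕ) * κ) ((p + 1 + 1 : ℕ) * κ))
    (h2 : IntervalIntegrable w volume ((p + 2 : ℕ) * κ) ((p + 2 + 1 : ℕ) * κ)) :
    ∫ τ in (p * κ)..((p + 3 : ℕ) * κ), ‖w τ‖ =
      cell κ w p + cell κ w (p + 1) + cell κ w (p + 2) := by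
  rw [← integral_two_cells h0 h1]
  exact (intervalIntegral.integral_add_adjacent_intervals (h0.trans h1).norm h2.norm).symm

lemma sum_shift_le {f : ℕ → ℝ} (hf : ∀ n, 0 ≤ f n) {k M N : ℕ} (h : M + k ≤ N) :
    ∑ j ∈ range M, f (j + k) ≤ ∑ j ∈ range N, f j := by
  rw [range_eq_Ico, sum_Ico_add' f 0 M k, range_eq_Ico]
  exact sum_le_sum_of_subset_of_nonneg
    (Finset.Ico_subset_Ico (Nat.zero_le _) h) fun i _ _ => hf i

variable [NormedSpace ℝ X]

/-- The error `∂_t u (t_j) - ∂̄_t u (t_j)` of the central difference quotient, which vanishes by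
definition at `t_0`. -/
noncomputable def centralDefect (κ : ℝ) (u u₁ : ℝ → X) (j : ℕ) : X :=
  u₁ (j * κ) - centralDiff κ (u₁ 0) (fun j => u (j * κ)) j

lemma centralDefect_zero (κ : ℝ) (u u₁ : ℝ → X) : centralDefect κ u u₁ 0 = 0 := by
  simp [centralDefect, centralDiff]

lemma centralDefect_succ (κ : ℝ) (u u₁ : ℝ → X) (j : ℕ) :
    centralDefect κ u u₁ (j + 1) = -((2 * κ)⁻¹ • (u ((j + 1 : ℕ) * κ + κ) -
      u ((j + 1 : ℕ) * κ - κ)) - u₁ ((j + 1 : ℕ) * κ)) := by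
  have h1 : ((j + 2 : ℕ) : ℝ) * κ = (j + 1 : ℕ) * κ + κ := by push_cast; ring
  have h2 : (j : ℝ) * κ = (j + 1 : ℕ) * κ - κ := by push_cast; ring
  rw [centralDefect, centralDiff, h1, h2, neg_sub]

namespace TimeReg

variable [CompleteSpace X] {T : ℝ} {u u₁ u₂ u₃ u₄ : ℝ → X}

lemma norm_centralDefect_succ_le (H : TimeReg T u u₁ u₂ u₃ u₄) {κ : ℝ} (hκ : 0 < κ) {N j : ℕ}
    (hN : N * κ = T) (hj : j + 2 ≤ N) :
    ‖centralDefect κ u u₁ (j + 1)‖ ≤ κ * (cell κ u₃ j + cell κ u₃ (j + 1)) := by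
  rw [centralDefect_succ, norm_neg]
  have e1 : ((j + 1 : ℕ) : ℝ) * κ + κ = (j + 2 : ℕ) * κ := by push_cast; ring
  have e2 : ((j + 1 : ℕ) : ℝ) * κ - κ = j * κ := by push_cast; ring
  have h := H.norm_central_difference_le (t := (j + 1 : ℕ) * κ) hκ
    (by push_cast; nlinarith [(Nat.cast_nonneg j : (0 : ℝ) ≤ j)])
    (by rw [e1, ← hN]; exact mul_le_mul_of_nonneg_right (by exact_mod_cast hj) hκ.le)
  rw [← integral_two_cells (H.intervalIntegrable_cell₃ hκ hN (by omega))
    (H.intervalIntegrable_cell₃ hκ hN (by omega))]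
  rwa [e1, e2] at *

/-- The increments of the central defect away from the first two time steps. -/
lemma norm_centralDefect_sub_le (H : TimeReg T u u₁ u₂ u₃ u₄) {κ : ℝ} (hκ : 0 < κ) {N j : ℕ}
    (hN : N * κ = T) (hj : j + 4 ≤ N) :
    ‖centralDefect κ u u₁ (j + 3) - centralDefect κ u u₁ (j + 2)‖ ≤
      κ ^ 2 * (cellPos κ u₄ (j + 1) + cellPos κ u₄ (j + 2) + cellPos κ u₄ (j + 3)) := by
  rw [centralDefect_succ, centralDefect_succ, neg_sub_neg, norm_sub_rev]
  have e1 : ((j + 1 + 1 : ℕ) : ℝ) * κ - κ = (j + 1 : ℕ) * κ := by push_cast; ring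
  have e2 : ((j + 1 + 1 : ℕ) : ℝ) * κ + 2 * κ = (j + 1 + 3 : ℕ) * κ := by push_cast; ring
  have e3 : ((j + 2 + 1 : ℕ) : ℝ) * κ = (j + 1 + 1 : ℕ) * κ + κ := by push_cast; ring
  have h := H.norm_central_difference_sub_le (t := (j + 1 + 1 : ℕ) * κ) hκ
    (by push_cast; nlinarith [(Nat.cast_nonneg j : (0 : ℝ) ≤ j)])
    (by rw [e2, ← hN]; exact mul_le_mul_of_nonneg_right (by exact_mod_cast hj) hκ.le)
  rw [e3]
  refine h.trans (le_of_eq ?_)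
  rw [e1, e2, integral_three_cells (H.intervalIntegrable_cell₄ hκ hN (by omega) (by omega))
    (H.intervalIntegrable_cell₄ hκ hN (by omega) (by omega))
    (H.intervalIntegrable_cell₄ hκ hN (by omega) (by omega))]
  simp [cellPos]

/-- The error of the second difference quotient in the equation of motion, summed over the
grid. -/
lemma sum_second_difference_le (H : TimeReg T u u₁ u₂ u₃ u₄) {κ : ℝ} (hκ : 0 < κ) {N : ℕ}
    (hN : N * κ = T) {h S₃ S₄ M : ℝ} (hh : 0 ≤ h) (hS : 0 ≤ S₄)
    (G : GridBounds T κ N u₂ u₃ u₄ h S₃ S₄ M) :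
    κ * ∑ n ∈ range (N - 1), ‖(κ ^ 2)⁻¹ • (u ((n + 2 : ℕ) * κ) - (2 : ℝ) • u ((n + 1 : ℕ) * κ) +
      u (n * κ)) - u₂ ((n + 1 : ℕ) * κ)‖ ≤ 2 * (κ * h + κ ^ 2 * S₄) := by
  have e1 : ∀ n : ℕ, ((n + 1 : ℕ) : ℝ) * κ + κ = (n + 2 : ℕ) * κ := fun n => by push_cast; ring
  have e2 : ∀ n : ℕ, ((n + 1 : ℕ) : ℝ) * κ - κ = n * κ := fun n => by push_cast; ring
  have hle : ∀ n : ℕ, n + 2 ≤ N → ((n + 1 : ℕ) : ℝ) * κ + κ ≤ T := fun n hn => by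
    rw [e1, ← hN]; exact mul_le_mul_of_nonneg_right (by exact_mod_cast hn) hκ.le
  rcases hm : N - 1 with _ | m
  · simp only [range_zero, sum_empty, mul_zero]; positivity
  rw [sum_range_succ']
  have t0 : ‖(κ ^ 2)⁻¹ • (u ((0 + 2 : ℕ) * κ) - (2 : ℝ) • u ((0 + 1 : ℕ) * κ) +
      u ((0 : ℕ) * κ)) - u₂ ((0 + 1 : ℕ) * κ)‖ ≤ 2 * h := by
    have := H.norm_second_difference_le₃ (t := (0 + 1 : ℕ) * κ) hκ (by simp) (hle 0 (by omega))
    rw [e1, e2, integral_two_cells (H.intervalIntegrable_cell₃ hκ hN (by omega))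
      (H.intervalIntegrable_cell₃ hκ hN (by omega))] at this
    linarith [G.cell_le 0 (by omega), G.cell_le 1 (by omega)]
  have t1 : ∀ n ∈ range m, ‖(κ ^ 2)⁻¹ • (u ((n + 1 + 2 : ℕ) * κ) -
      (2 : ℝ) • u ((n + 1 + 1 : ℕ) * κ) + u ((n + 1 : ℕ) * κ)) - u₂ ((n + 1 + 1 : ℕ) * κ)‖ ≤
      κ * (cellPos κ u₄ (n + 1) + cellPos κ u₄ (n + 2)) := fun n hn => by
    have hn' := mem_range.1 hn
    have := H.norm_second_difference_le₄ (t := (n + 1 + 1 : ℕ) * κ) hκ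
      (by push_cast; nlinarith [(Nat.cast_nonneg n : (0 : ℝ) ≤ n)]) (hle _ (by omega))
    rw [e1, e2, integral_two_cells (H.intervalIntegrable_cell₄ hκ hN (by omega) (by omega))
      (H.intervalIntegrable_cell₄ hκ hN (by omega) (by omega))] at this
    simpa [cellPos] using this
  have s1 := (sum_shift_le (fun n => cellPos_nonneg hκ u₄ n)
    (show m + 1 ≤ N by omega)).trans G.sum₄_le
  have s2 := (sum_shift_le (fun n => cellPos_nonneg hκ u₄ n)
    (show m + 2 ≤ N by omega)).trans G.sum₄_le
  have t2 := sum_le_sum t1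
  rw [← mul_sum, sum_add_distrib] at t2
  calc _ ≤ κ * (κ * (S₄ + S₄) + 2 * h) := by
        refine mul_le_mul_of_nonneg_left (add_le_add (t2.trans ?_) t0) hκ.le
        gcongr
    _ = _ := by ring

end TimeReg

/-- Summation by parts in a discrete convolution, for a sequence that starts at zero. -/
lemma sum_conv_eq_sum_partial {w : ℕ → ℝ} {x : ℕ → X} (hx : x 0 = 0) (n : ℕ) :
    ∑ j ∈ range (n + 1), w (n - j) • x (j + 1) =
      ∑ j ∈ range (n + 1), (∑ k ∈ range (n - j + 1), w k) • (x (j + 1) - x j) := by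
  have h1 : ∀ j, x (j + 1) = ∑ i ∈ range (j + 1), (x (i + 1) - x i) := fun j => by
    rw [sum_range_sub, hx, sub_zero]
  calc ∑ j ∈ range (n + 1), w (n - j) • x (j + 1)
      = ∑ j ∈ range (n + 1), ∑ i ∈ range (j + 1), w (n - j) • (x (i + 1) - x i) := by
        refine sum_congr rfl fun j _ => ?_
        rw [h1 j, smul_sum]
    _ = ∑ i ∈ range (n + 1), ∑ j ∈ Finset.Ico i (n + 1), w (n - j) • (x (i + 1) - x i) := by
        refine sum_comm' fun j i => ?_
        simp only [mem_range, Finset.mem_Ico]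
        omega
    _ = _ := by
        refine sum_congr rfl fun i hi => ?_
        have hi' := mem_range.1 hi
        rw [← sum_smul, sum_Ico_reflect w i (le_refl (n + 1)), Nat.sub_self, ← range_eq_Ico,
          show n + 1 - i = n - i + 1 by omega]

lemma correctedCQ_of_zero {κ γ : ℝ} {x : ℕ → X} (hx : x 0 = 0) (n : ℕ) :
    correctedCQ κ γ x (n + 1) = ∑ j ∈ range (n + 1), cqWeight κ γ (n - j) • x (j + 1) +
      corrWeight1 κ γ (n + 1) • x 1 := by
  rw [correctedCQ, sum_range_succ', hx, smul_zero, smul_zero, add_zero, add_zero]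
  simp only [Nat.add_sub_add_right]

/-- The quadrature of the central defect for `γ < 0`: the weights are summable with a bound that
does not depend on `κ`. -/
lemma exists_defect_bound_neg {γ : ℝ} (hγ : γ ∈ Ioo (-1 : ℝ) 0) {T : ℝ} (hT : 0 < T)
    [CompleteSpace X] :
    ∃ K > 0, ∀ (κ : ℝ) (N : ℕ) (u u₁ u₂ u₃ u₄ : ℝ → X) (h S₃ S₄ M : ℝ), 0 < κ → N * κ = T →
      TimeReg T u u₁ u₂ u₃ u₄ → GridBounds T κ N u₂ u₃ u₄ h S₃ S₄ M →
      κ * ∑ n ∈ range (N - 1), ‖correctedCQ κ γ (centralDefect κ u u₁) (n + 1)‖ ≤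
        K * (κ ^ 2 * S₃) := by
  obtain ⟨C, hC0, hC⟩ := exists_bound_brk (bdfWeight_isBigO (γ := γ) ⟨hγ.1, by linarith [hγ.2]⟩)
  have hγ' : 0 < -γ := by linarith [hγ.2]
  set c := 2 * (1 + 1 / (-γ)) with hc
  have hc0 : 0 < c := by positivity
  refine ⟨2 * (C * c * T ^ (-γ)), by positivity, fun κ N u u₁ u₂ u₃ u₄ h S₃ S₄ M hκ hN H G => ?_⟩
  have hN1 : 1 ≤ N := by
    rcases Nat.eq_zero_or_pos N with rfl | h
    · simp at hN; linarith
    · exact h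
  have hNpos : (0 : ℝ) < N := by exact_mod_cast hN1
  have hκp : 0 < κ ^ (-γ) := Real.rpow_pos_of_pos hκ _
  set d := centralDefect κ u u₁ with hd
  have hS0 : 0 ≤ S₃ := (sum_nonneg fun p _ => cell_nonneg hκ u₃ p).trans G.sum₃_le
  have hw : ∀ n, |cqWeight κ γ n| ≤ κ ^ (-γ) * (C * brk (-γ - 1) n) := fun n => by
    rw [cqWeight_eq hκ, abs_mul, abs_of_pos hκp]
    exact mul_le_mul_of_nonneg_left (hC n) hκp.le
  have term : ∀ n ∈ range (N - 1), ‖correctedCQ κ γ d (n + 1)‖ ≤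
      ∑ j ∈ range (n + 1), κ ^ (-γ) * (C * brk (-γ - 1) (n - j)) * ‖d (j + 1)‖ := fun n _ => by
    rw [correctedCQ_of_zero (centralDefect_zero κ u u₁), corrWeight1, if_pos hγ.2, zero_smul,
      add_zero]
    refine norm_sum_le_of_le _ fun j _ => ?_
    rw [norm_smul]
    exact mul_le_mul_of_nonneg_right (hw _) (norm_nonneg _)
  have young := sum_conv_le (a := fun m => κ ^ (-γ) * (C * brk (-γ - 1) m))
    (b := fun j => ‖d (j + 1)‖) (fun n => by have := brk_pos (-γ - 1) n; positivity)
    (fun p => norm_nonneg _) (N - 1)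
  have hbs := sum_brk_succ_le (e := -γ - 1) (by linarith) (by linarith [hγ.1]) hN1
  rw [show -γ - 1 + 1 = -γ by ring] at hbs
  have hbs' : ∑ m ∈ range (N - 1), κ ^ (-γ) * (C * brk (-γ - 1) m) ≤ C * c * T ^ (-γ) := by
    rw [← mul_sum, ← mul_sum]
    have : ∑ m ∈ range (N - 1), brk (-γ - 1) m ≤ c * (N : ℝ) ^ (-γ) :=
      (sum_le_sum_of_subset_of_nonneg (range_subset_range.2 (by omega))
        fun i _ _ => (brk_pos _ i).le).trans hbs
    calc κ ^ (-γ) * (C * ∑ m ∈ range (N - 1), brk (-γ - 1) m)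
        ≤ κ ^ (-γ) * (C * (c * (N : ℝ) ^ (-γ))) := by gcongr
      _ = C * c * T ^ (-γ) := by rw [← hN, Real.mul_rpow hNpos.le hκ.le]; ring
  have hds : ∑ j ∈ range (N - 1), ‖d (j + 1)‖ ≤ κ * (2 * S₃) := by
    have : ∀ j ∈ range (N - 1), ‖d (j + 1)‖ ≤ κ * (cell κ u₃ j + cell κ u₃ (j + 1)) :=
      fun j hj => H.norm_centralDefect_succ_le hκ hN (by have := mem_range.1 hj; omega)
    refine (sum_le_sum this).trans ?_
    rw [← mul_sum, sum_add_distrib]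
    have s1 := (sum_shift_le (k := 0) (fun n => cell_nonneg hκ u₃ n)
      (show N - 1 + 0 ≤ N by omega)).trans G.sum₃_le
    have s2 := (sum_shift_le (fun n => cell_nonneg hκ u₃ n)
      (show N - 1 + 1 ≤ N by omega)).trans G.sum₃_le
    simp only [add_zero] at s1
    exact mul_le_mul_of_nonneg_left (by linarith) hκ.le
  calc κ * ∑ n ∈ range (N - 1), ‖correctedCQ κ γ d (n + 1)‖
      ≤ κ * (C * c * T ^ (-γ) * (κ * (2 * S₃))) :=
        mul_le_mul_of_nonneg_left (((sum_le_sum term).trans young).trans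
          (mul_le_mul hbs' hds (sum_nonneg fun _ _ => norm_nonneg _) (by positivity))) hκ.le
    _ = _ := by ring

/-- The quadrature of the central defect for `γ > 0`. The sum of the weights `κ^(-γ) n^(-γ-1)` is
unbounded as `κ → 0`; a summation by parts replaces the weights by their partial sums, of size
`κ^(-γ) n^(-γ)`, and the defect by its increments. -/
lemma exists_defect_bound_pos {γ : ℝ} (hγ : γ ∈ Ioo (0 : ℝ) 1) {T : ℝ} (hT : 0 < T)
    [CompleteSpace X] :
    ∃ K > 0, ∀ (κ : ℝ) (N : ℕ) (u u₁ u₂ u₃ u₄ : ℝ → X) (h S₃ S₄ M : ℝ), 0 < κ → N * κ = T →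
      TimeReg T u u₁ u₂ u₃ u₄ → GridBounds T κ N u₂ u₃ u₄ h S₃ S₄ M →
      κ * ∑ n ∈ range (N - 1), ‖correctedCQ κ γ (centralDefect κ u u₁) (n + 1)‖ ≤
        K * (κ * h + κ ^ 2 * S₄) := by
  have hγ1 : γ ∈ Ioo (-1 : ℝ) 1 := ⟨by linarith [hγ.1], hγ.2⟩
  obtain ⟨C, hC0, hC, -⟩ := exists_peano_cell_bound hγ1
  have hS : (fun n : ℕ => ∑ i ∈ range (n + 1), bdfWeight γ i) =O[atTop]
      fun n : ℕ => (n : ℝ) ^ (-γ) := by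
    obtain ⟨C₁, -, h1⟩ := exists_bound_brk (sum_bdfWeight_isBigO hγ1)
    have h2 : (fun n : ℕ => ∑ i ∈ range (n + 1), bdfWeight γ i -
        (n : ℝ) ^ (-γ) / Real.Gamma (1 - γ)) =O[atTop] fun n : ℕ => (n : ℝ) ^ (-γ) :=
      (sum_bdfWeight_isBigO hγ1).trans (Asymptotics.IsBigO.of_bound 1 (by
        filter_upwards [eventually_ge_atTop 1] with n hn
        have hn' : (1 : ℝ) ≤ n := by exact_mod_cast hn
        rw [one_mul, Real.norm_of_nonneg (by positivity), Real.norm_of_nonneg (by positivity)]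
        exact Real.rpow_le_rpow_of_exponent_le hn' (by linarith)))
    have h3 : (fun n : ℕ => (n : ℝ) ^ (-γ) / Real.Gamma (1 - γ)) =O[atTop]
        fun n : ℕ => (n : ℝ) ^ (-γ) := by
      simp only [div_eq_mul_inv, mul_comm _ (Real.Gamma (1 - γ))⁻¹]
      exact (Asymptotics.isBigO_refl _ _).const_mul_left _
    simpa using h2.add h3
  obtain ⟨D, hD0, hD⟩ := exists_bound_brk hS
  obtain ⟨B, hB0, hB⟩ := exists_sum_brk_bound (e := -γ - 1) (by linarith [hγ.1])
  have hγ' : 0 < 1 - γ := by linarith [hγ.2]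
  set c := 2 * (1 + 1 / (1 - γ)) with hc
  have hc0 : 0 < c := by positivity
  refine ⟨6 * (D * c * T ^ (1 - γ)) + 2 * C * B * T ^ (1 - γ), by positivity,
    fun κ N u u₁ u₂ u₃ u₄ h S₃ S₄ M hκ hN H G => ?_⟩
  have hN1 : 1 ≤ N := by
    rcases Nat.eq_zero_or_pos N with rfl | h
    · simp at hN; linarith
    · exact h
  have hNpos : (0 : ℝ) < N := by exact_mod_cast hN1
  have hN1' : (1 : ℝ) ≤ N := by exact_mod_cast hN1
  have hκT : κ ≤ T := by nlinarith
  have hh0 : 0 ≤ h := (cell_nonneg hκ u₃ 0).trans (G.cell_le 0 hN1)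
  have hS0 : 0 ≤ S₄ := (sum_nonneg fun p _ => cellPos_nonneg hκ u₄ p).trans G.sum₄_le
  have hκp : 0 < κ ^ (-γ) := Real.rpow_pos_of_pos hκ _
  have hκp1 : 0 < κ ^ (1 - γ) := Real.rpow_pos_of_pos hκ _
  set d := centralDefect κ u u₁ with hd
  have hd0 : d 0 = 0 := centralDefect_zero κ u u₁
  rcases Nat.lt_or_ge N 2 with hN2 | hN2
  · rw [show N - 1 = 0 by omega, range_zero, sum_empty, mul_zero]
    positivity
  have hd1 : ‖d 1‖ ≤ 2 * (κ * h) := by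
    refine (H.norm_centralDefect_succ_le (j := 0) hκ hN (by omega)).trans ?_
    have := G.cell_le 0 (by omega)
    have := G.cell_le (0 + 1) (by omega)
    nlinarith
  have hdiff : ∑ j ∈ range (N - 1), ‖d (j + 1) - d j‖ ≤ 6 * (κ * h) + 3 * (κ ^ 2 * S₄) := by
    obtain ⟨m, hm⟩ : ∃ m, N = m + 2 := ⟨N - 2, by omega⟩
    rw [show N - 1 = m + 1 by omega, sum_range_succ', hd0, sub_zero]
    rcases m with _ | m
    · rw [range_zero, sum_empty, zero_add]
      have : 0 ≤ κ ^ 2 * S₄ := by positivity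
      have : 0 ≤ κ * h := by positivity
      linarith
    have hd2 : ‖d 2‖ ≤ 2 * (κ * h) := by
      refine (H.norm_centralDefect_succ_le (j := 1) hκ hN (by omega)).trans ?_
      have := G.cell_le 1 (by omega)
      have := G.cell_le (1 + 1) (by omega)
      nlinarith
    have hdd : ∀ j ∈ range m, ‖d (j + 1 + 1 + 1) - d (j + 1 + 1)‖ ≤
        κ ^ 2 * (cellPos κ u₄ (j + 1) + cellPos κ u₄ (j + 2) + cellPos κ u₄ (j + 3)) :=
      fun j hj => H.norm_centralDefect_sub_le hκ hN (by have := mem_range.1 hj; omega)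
    have s1 := (sum_shift_le (fun n => cellPos_nonneg hκ u₄ n)
      (show m + 1 ≤ N by omega)).trans G.sum₄_le
    have s2 := (sum_shift_le (fun n => cellPos_nonneg hκ u₄ n)
      (show m + 2 ≤ N by omega)).trans G.sum₄_le
    have s3 := (sum_shift_le (fun n => cellPos_nonneg hκ u₄ n)
      (show m + 3 ≤ N by omega)).trans G.sum₄_le
    rw [sum_range_succ']
    have t := sum_le_sum hdd
    rw [← mul_sum, sum_add_distrib, sum_add_distrib] at t
    have t' : κ ^ 2 * (∑ j ∈ range m, cellPos κ u₄ (j + 1) + ∑ j ∈ range m, cellPos κ u₄ (j + 2) +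
        ∑ j ∈ range m, cellPos κ u₄ (j + 3)) ≤ κ ^ 2 * (3 * S₄) :=
      mul_le_mul_of_nonneg_left (by linarith) (by positivity)
    have t2 := norm_sub_le (d 2) (d 1)
    simp only [zero_add] at *
    change _ + ‖d 2 - d 1‖ + _ ≤ _
    linarith
  have term : ∀ n ∈ range (N - 1), ‖correctedCQ κ γ d (n + 1)‖ ≤
      ∑ j ∈ range (n + 1), κ ^ (-γ) * (D * brk (-γ) (n - j)) * ‖d (j + 1) - d j‖ +
        κ ^ (-γ) * C * (2 * (κ * h)) * brk (-γ - 1) n := fun n _ => by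
    rw [correctedCQ_of_zero hd0, sum_conv_eq_sum_partial hd0]
    refine (norm_add_le _ _).trans (add_le_add (norm_sum_le_of_le _ fun j _ => ?_) ?_)
    · rw [norm_smul]
      refine mul_le_mul_of_nonneg_right ?_ (norm_nonneg _)
      simp only [cqWeight_eq hκ]
      rw [← mul_sum, norm_mul, Real.norm_of_nonneg hκp.le]
      exact mul_le_mul_of_nonneg_left (hD _) hκp.le
    · have h2 := (hC (n + 1)).trans (mul_le_mul_of_nonneg_left
        (brk_antitone (e := -γ - 1) (by linarith [hγ.1]) (Nat.le_succ n)) hC0.le)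
      have hb := brk_pos (-γ - 1) n
      rw [norm_smul, corrWeight1_eq hκ hγ.1, norm_mul, Real.norm_of_nonneg hκp.le,
        Real.norm_eq_abs]
      calc κ ^ (-γ) * |peano γ (n + 1) (n + 1 : ℕ)| * ‖d 1‖
          ≤ κ ^ (-γ) * (C * brk (-γ - 1) n) * (2 * (κ * h)) := by gcongr
        _ = _ := by ring
  have young := sum_conv_le (a := fun m => κ ^ (-γ) * (D * brk (-γ) m))
    (b := fun j => ‖d (j + 1) - d j‖) (fun n => by have := brk_pos (-γ) n; positivity)
    (fun p => norm_nonneg _) (N - 1)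
  have hbs := sum_brk_succ_le (e := -γ) (by linarith [hγ.2]) (by linarith [hγ.1]) hN1
  rw [show -γ + 1 = 1 - γ by ring] at hbs
  have e10 : κ * κ ^ (-γ) = κ ^ (1 - γ) := by
    rw [show 1 - γ = 1 + -γ by ring, Real.rpow_add hκ, Real.rpow_one]
  have hTκ : κ ^ (1 - γ) ≤ T ^ (1 - γ) := Real.rpow_le_rpow hκ.le hκT hγ'.le
  have hbs' : κ * ∑ m ∈ range (N - 1), κ ^ (-γ) * (D * brk (-γ) m) ≤ D * c * T ^ (1 - γ) := by
    rw [← mul_sum, ← mul_sum, ← mul_assoc, e10]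
    have : ∑ m ∈ range (N - 1), brk (-γ) m ≤ c * (N : ℝ) ^ (1 - γ) :=
      (sum_le_sum_of_subset_of_nonneg (range_subset_range.2 (by omega))
        fun i _ _ => (brk_pos _ i).le).trans hbs
    calc κ ^ (1 - γ) * (D * ∑ m ∈ range (N - 1), brk (-γ) m)
        ≤ κ ^ (1 - γ) * (D * (c * (N : ℝ) ^ (1 - γ))) := by gcongr
      _ = D * c * T ^ (1 - γ) := by rw [← hN, Real.mul_rpow hNpos.le hκ.le]; ring
  have tot := sum_le_sum term
  rw [sum_add_distrib, ← mul_sum] at tot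
  have hconv : κ * ∑ n ∈ range (N - 1), ∑ j ∈ range (n + 1),
      κ ^ (-γ) * (D * brk (-γ) (n - j)) * ‖d (j + 1) - d j‖ ≤
      D * c * T ^ (1 - γ) * (6 * (κ * h) + 3 * (κ ^ 2 * S₄)) := by
    refine (mul_le_mul_of_nonneg_left young hκ.le).trans ?_
    rw [← mul_assoc]
    exact mul_le_mul hbs' hdiff (sum_nonneg fun _ _ => norm_nonneg _) (by positivity)
  have hcorr : κ * (κ ^ (-γ) * C * (2 * (κ * h)) * ∑ n ∈ range (N - 1), brk (-γ - 1) n) ≤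
      2 * C * B * T ^ (1 - γ) * (κ * h) := by
    have := hB (N - 1)
    have hb0 : 0 ≤ ∑ n ∈ range (N - 1), brk (-γ - 1) n := sum_nonneg fun n _ => (brk_pos _ n).le
    calc _ = κ ^ (1 - γ) * C * (2 * (κ * h)) * ∑ n ∈ range (N - 1), brk (-γ - 1) n := by
          rw [← e10]; ring
      _ ≤ T ^ (1 - γ) * C * (2 * (κ * h)) * B := by gcongr
      _ = _ := by ring
  have p1 : 0 ≤ D * c * T ^ (1 - γ) * (κ ^ 2 * S₄) := by positivity
  have p2 : 0 ≤ 2 * C * B * T ^ (1 - γ) * (κ ^ 2 * S₄) := by positivity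
  calc _ ≤ κ * (_ + _) := mul_le_mul_of_nonneg_left tot hκ.le
    _ ≤ D * c * T ^ (1 - γ) * (6 * (κ * h) + 3 * (κ ^ 2 * S₄)) +
        2 * C * B * T ^ (1 - γ) * (κ * h) := by rw [mul_add]; exact add_le_add hconv hcorr
    _ ≤ _ := by linarith

end FracWave

namespace FracWave

/-! ### Stability in the energy norm -/

open Finset
open Set (Icc Ioo Ioc)

/-- The damping coefficient equals `2 α₀ / sin ((γ + 1) π / 2)`, so that it is positive. -/
lemma dampingCoeff_pos {γ : ℝ} (hγ : γ ∈ Ioo (-1 : ℝ) 1) (hγ0 : γ ≠ 0) {α₀ : ℝ} (hα₀ : 0 < α₀) :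
    0 < dampingCoeff α₀ γ := by
  have hpi := Real.pi_pos
  set θ := (γ + 1) * Real.pi / 2 with hθ
  have hs : 0 < Real.sin θ := Real.sin_pos_of_pos_of_lt_pi
    (by have := hγ.1; have : 0 < γ + 1 := by linarith
        positivity) (by rw [hθ]; nlinarith [hγ.2])
  -- the reflection formula turns `Γ(γ + 2) Γ(-γ - 1)` into `π / sin (π (γ + 2))`
  have hG := Real.Gamma_mul_Gamma_one_sub (γ + 2)
  have e1 : Real.sin (Real.pi * (γ + 2)) = -(2 * Real.sin θ * Real.cos θ) := by
    rw [← Real.sin_two_mul, ← Real.sin_sub_pi, hθ,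
      show Real.pi * (γ + 2) = (2 * ((γ + 1) * Real.pi / 2) - Real.pi) + 2 * Real.pi by ring,
      Real.sin_add_two_pi]
  have hc : Real.cos θ ≠ 0 := by
    intro h
    rw [Real.cos_eq_zero_iff] at h
    obtain ⟨k, hk⟩ := h
    rw [hθ] at hk
    have h1 : γ = 2 * k := by
      have : (γ + 1) * Real.pi = (2 * k + 1) * Real.pi := by linarith
      have := mul_right_cancel₀ hpi.ne' this
      linarith
    have h2 : (-1 : ℤ) < 2 * k := by have := hγ.1; rw [h1] at this; exact_mod_cast this
    have h3 : 2 * k < (1 : ℤ) := by have := hγ.2; rw [h1] at this; exact_mod_cast this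
    have h4 : k = 0 := by omega
    exact hγ0 (by rw [h1, h4]; simp)
  rw [show 1 - (γ + 2) = -γ - 1 by ring, e1] at hG
  have : dampingCoeff α₀ γ = 2 * α₀ / Real.sin θ := by
    rw [dampingCoeff, mul_assoc (-α₀ * (4 / Real.pi)), mul_comm (Real.Gamma (-γ - 1)), hG, ← hθ]
    field_simp
    ring
  rw [this]
  positivity

/-- For small time steps the linear correction term is a small perturbation of the kinetic
energy: the weights add up to `O(κ^(-γ))`, so that the sum is `O(κ^(1-γ))`. -/
lemma exists_corrWeight1_small {γ : ℝ} (hγ : γ ∈ Ioo (-1 : ℝ) 1) (hγ0 : γ ≠ 0) {a : ℝ}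
    (ha : 0 < a) :
    ∃ κbar > 0, ∀ κ : ℝ, 0 < κ → κ < κbar → ∀ N : ℕ,
      a * (κ * ∑ n ∈ range N, |corrWeight1 κ γ (n + 1)|) ≤ 1 / 8 := by
  rcases hγ0.lt_or_gt with h | h
  · refine ⟨1, one_pos, fun κ hκ _ N => ?_⟩
    simp [corrWeight1, h]
  obtain ⟨C, hC0, hC, -⟩ := exists_peano_cell_bound hγ
  obtain ⟨B, hB0, hB⟩ := exists_sum_brk_bound (e := -γ - 1) (by linarith)
  have hγ' : 0 < 1 - γ := by linarith [hγ.2]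
  refine ⟨(1 / (8 * (a * C * B))) ^ (1 / (1 - γ)), by positivity, fun κ hκ hκb N => ?_⟩
  have h1 : κ ^ (1 - γ) ≤ 1 / (8 * (a * C * B)) := by
    have := Real.rpow_le_rpow hκ.le hκb.le hγ'.le
    rwa [← Real.rpow_mul (by positivity), one_div_mul_cancel hγ'.ne', Real.rpow_one] at this
  have hκp : 0 < κ ^ (-γ) := Real.rpow_pos_of_pos hκ _
  have h2 : ∑ n ∈ range N, |corrWeight1 κ γ (n + 1)| ≤ κ ^ (-γ) * (C * B) := by
    calc _ ≤ ∑ n ∈ range N, κ ^ (-γ) * (C * brk (-γ - 1) n) := by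
          refine sum_le_sum fun n _ => ?_
          rw [corrWeight1_eq hκ h, abs_mul, abs_of_pos hκp]
          exact mul_le_mul_of_nonneg_left ((hC (n + 1)).trans (mul_le_mul_of_nonneg_left
            (brk_antitone (by linarith) (Nat.le_succ n)) hC0.le)) hκp.le
      _ = κ ^ (-γ) * (C * ∑ n ∈ range N, brk (-γ - 1) n) := by rw [← mul_sum, ← mul_sum]
      _ ≤ _ := by have := hB N; gcongr
  have e10 : κ * κ ^ (-γ) = κ ^ (1 - γ) := by
    rw [show 1 - γ = 1 + -γ by ring, Real.rpow_add hκ, Real.rpow_one]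
  calc a * (κ * ∑ n ∈ range N, |corrWeight1 κ γ (n + 1)|)
      ≤ a * (κ * (κ ^ (-γ) * (C * B))) := by gcongr
    _ = a * C * B * κ ^ (1 - γ) := by rw [← e10]; ring
    _ ≤ a * C * B * (1 / (8 * (a * C * B))) := by gcongr
    _ = 1 / 8 := by field_simp

section Energy

variable {V E F : Type*} [AddCommGroup V] [Module ℝ V] [NormedAddCommGroup E]
  [InnerProductSpace ℝ E] [NormedAddCommGroup F] [InnerProductSpace ℝ F]

lemma map_correctedCQ {W : Type*} [AddCommGroup W] [Module ℝ W] (A : V →ₗ[ℝ] W) (κ γ : ℝ)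
    (g : ℕ → V) (n : ℕ) :
    A (correctedCQ κ γ g n) = correctedCQ κ γ (fun j => A (g j)) n := by
  simp [correctedCQ, map_sum]

lemma map_centralDiff {W : Type*} [AddCommGroup W] [Module ℝ W] (A : V →ₗ[ℝ] W) (κ : ℝ) (z : V)
    (U : ℕ → V) (j : ℕ) : A (centralDiff κ z U j) = centralDiff κ (A z) (fun j => A (U j)) j := by
  cases j <;> simp [centralDiff]

lemma correctedCQ_sub (κ γ : ℝ) (x y : ℕ → V) (n : ℕ) :
    correctedCQ κ γ (fun j => x j - y j) n = correctedCQ κ γ x n - correctedCQ κ γ y n := by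
  simp only [correctedCQ, smul_sub, sum_sub_distrib]
  abel

lemma centralDiff_sub (κ : ℝ) (z w : V) (x y : ℕ → V) (j : ℕ) :
    centralDiff κ (z - w) (fun j => x j - y j) j = centralDiff κ z x j - centralDiff κ w y j := by
  cases j
  · rfl
  · simp only [centralDiff, ← smul_sub]
    congr 1
    abel

lemma inner_sub_half_add (x y : E) :
    inner ℝ (x - y) ((2 : ℝ)⁻¹ • (x + y)) = (‖x‖ ^ 2 - ‖y‖ ^ 2) / 2 := by
  rw [real_inner_smul_right, inner_sub_left, inner_add_right, inner_add_right,
    real_inner_self_eq_norm_sq, real_inner_self_eq_norm_sq, real_inner_comm y x]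
  ring

/-- The discrete energy estimate of the leapfrog scheme with convolution quadrature damping. The
hypothesis `hCFL` is the time step restriction; the convolution itself dissipates energy, and its
correction at the first step is absorbed through `hcorr`. -/
theorem energy_estimate (A : V →ₗ[ℝ] E) (B : V →ₗ[ℝ] F) {κ γ a : ℝ} (hκ : 0 < κ)
    (hγ : γ ∈ Icc (-1 : ℝ) 1) (ha : 0 < a) {N : ℕ} {e : ℕ → V} {r : ℕ → E} (he : e 0 = 0)
    (hCFL : ∀ v, κ ^ 2 / 4 * ‖B v‖ ^ 2 ≤ 1 / 2 * ‖A v‖ ^ 2)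
    (hcorr : a * (κ * ∑ n ∈ range (N - 1), |corrWeight1 κ γ (n + 1)|) ≤ 1 / 8)
    (heq : ∀ n < N - 1, ∀ v, (κ ^ 2)⁻¹ * inner ℝ (A (e (n + 2) - (2 : ℝ) • e (n + 1) + e n)) (A v) +
      inner ℝ (B (e (n + 1))) (B v) +
      a * inner ℝ (A (correctedCQ κ γ (centralDiff κ 0 e) (n + 1))) (A v) =
      inner ℝ (r (n + 1)) (A v)) {n : ℕ} (hn : n < N) :
    ‖A (κ⁻¹ • (e (n + 1) - e n))‖ ≤
        2 * ‖A (κ⁻¹ • e 1)‖ + 8 * (κ * ∑ n ∈ range (N - 1), ‖r (n + 1)‖) ∧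
      ‖B ((2 : ℝ)⁻¹ • (e (n + 1) + e n))‖ ≤
        2 * ‖A (κ⁻¹ • e 1)‖ + 8 * (κ * ∑ n ∈ range (N - 1), ‖r (n + 1)‖) := by
  set b := ‖A (κ⁻¹ • e 1)‖ with hb
  set Θ := κ * ∑ n ∈ range (N - 1), ‖r (n + 1)‖ with hΘ
  have hΘ0 : 0 ≤ Θ := by positivity
  have hb0 : 0 ≤ b := norm_nonneg _
  set v : ℕ → E := fun n => A (κ⁻¹ • (e (n + 1) - e n)) with hv
  set g : ℕ → V := centralDiff κ 0 e with hg
  have hg1 : ∀ n, A (g (n + 1)) = (2 : ℝ)⁻¹ • (v (n + 1) + v n) := fun n => by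
    simp only [hg, hv, centralDiff]
    rw [← map_add, ← map_smul, ← smul_add, smul_smul, mul_inv, sub_add_sub_cancel]
  obtain ⟨m₀, hm₀, hmax⟩ := exists_max_image (range N) (fun n => ‖v n‖) ⟨n, mem_range.2 hn⟩
  -- the right-hand side is only `ℓ¹` in time; it is paired with the maximal velocity
  set M := ‖v m₀‖ with hM
  have hvM : ∀ k < N, ‖v k‖ ≤ M := fun k hk => hmax k (mem_range.2 hk)
  have hM0 : 0 ≤ M := norm_nonneg _
  have hgM : ∀ k < N - 1, ‖A (g (k + 1))‖ ≤ M := fun k hk => by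
    rw [hg1, norm_smul, Real.norm_of_nonneg (by norm_num)]
    have := norm_add_le (v (k + 1)) (v k)
    have := hvM (k + 1) (by omega)
    have := hvM k (by omega)
    linarith
  set En : ℕ → ℝ := fun n => ‖v n‖ ^ 2 / 2 + inner ℝ (B (e n)) (B (e (n + 1))) / 2 with hEn
  have hstep : ∀ k < N - 1, En (k + 1) - En k =
      κ * inner ℝ (r (k + 1)) (A (g (k + 1))) -
        a * κ * inner ℝ (A (correctedCQ κ γ g (k + 1))) (A (g (k + 1))) := fun k hk => by
    have h := heq k hk (g (k + 1))
    have h1 : inner ℝ (A (e (k + 2) - (2 : ℝ) • e (k + 1) + e k)) (A (g (k + 1))) =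
        κ * ((‖v (k + 1)‖ ^ 2 - ‖v k‖ ^ 2) / 2) := by
      rw [hg1, ← inner_sub_half_add, ← real_inner_smul_left]
      congr 1
      simp only [hv]
      rw [← map_sub, ← map_smul, ← smul_sub, smul_smul, mul_inv_cancel₀ hκ.ne', one_smul, two_smul]
      congr 1
      abel
    have h2 : inner ℝ (B (e (k + 1))) (B (g (k + 1))) =
        κ⁻¹ * ((inner ℝ (B (e (k + 1))) (B (e (k + 2))) -
          inner ℝ (B (e k)) (B (e (k + 1)))) / 2) := by
      simp only [hg, centralDiff]
      rw [map_smul, map_sub, real_inner_smul_right, inner_sub_right, mul_inv,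
        real_inner_comm (B (e k))]
      ring
    rw [h1, h2] at h
    simp only [hEn]
    field_simp at h
    linarith
  -- the convolution dissipates energy, its correction at the first step costs at most `M² / 8`
  have hpos : ∀ m ≤ N - 1, -(M ^ 2 / 8) ≤
      a * κ * ∑ k ∈ range m, inner ℝ (A (correctedCQ κ γ g (k + 1))) (A (g (k + 1))) := by
    intro m hm
    set w := fun n => corrWeight1 κ γ (n + 1) with hw
    have hsplit : ∑ k ∈ range m, inner ℝ (A (correctedCQ κ γ g (k + 1))) (A (g (k + 1))) =
        κ ^ (-γ) * (∑ k ∈ range m, ∑ j ∈ range (k + 1), bdfWeight γ (k - j) *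
          inner ℝ (A (g (j + 1))) (A (g (k + 1)))) +
        ∑ k ∈ range m, w k * inner ℝ (A (g 1)) (A (g (k + 1))) := by
      rw [mul_sum, ← sum_add_distrib]
      refine sum_congr rfl fun k _ => ?_
      rw [map_correctedCQ, correctedCQ_of_zero (by simp [hg, centralDiff]), inner_add_left,
        sum_inner, mul_sum, real_inner_smul_left]
      congr 1
      refine sum_congr rfl fun j _ => ?_
      rw [real_inner_smul_left, cqWeight_eq hκ]
      ring
    have h1 := bdfWeight_positive hγ.1 hγ.2 (fun j => A (g (j + 1))) m
    have h2 : |∑ k ∈ range m, w k * inner ℝ (A (g 1)) (A (g (k + 1)))| ≤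
        (∑ k ∈ range (N - 1), |w k|) * M ^ 2 := by
      refine (abs_sum_le_sum_abs _ _).trans ?_
      rw [sum_mul]
      refine (sum_le_sum fun k hk => ?_).trans (sum_le_sum_of_subset_of_nonneg
        (range_subset_range.2 hm) fun i _ _ => by positivity)
      have hk' := mem_range.1 hk
      rw [abs_mul]
      refine mul_le_mul_of_nonneg_left ((abs_real_inner_le_norm _ _).trans ?_) (abs_nonneg _)
      have i1 := hgM 0 (by omega)
      have i2 := hgM k (by omega)
      rw [zero_add] at i1
      rw [sq]
      exact mul_le_mul i1 i2 (norm_nonneg _) hM0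
    have h3 : 0 ≤ κ ^ (-γ) * (∑ k ∈ range m, ∑ j ∈ range (k + 1), bdfWeight γ (k - j) *
          inner ℝ (A (g (j + 1))) (A (g (k + 1)))) := mul_nonneg (by positivity) h1
    rw [hsplit]
    have h4 := (abs_le.1 h2).1
    have h5 : a * κ * (-((∑ k ∈ range (N - 1), |w k|) * M ^ 2)) ≤ a * κ * (κ ^ (-γ) *
        (∑ k ∈ range m, ∑ j ∈ range (k + 1), bdfWeight γ (k - j) *
          inner ℝ (A (g (j + 1))) (A (g (k + 1)))) +
        ∑ k ∈ range m, w k * inner ℝ (A (g 1)) (A (g (k + 1)))) :=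
      mul_le_mul_of_nonneg_left (by linarith) (by positivity)
    have h6 := mul_le_mul_of_nonneg_right hcorr (sq_nonneg M)
    linarith
  have hrhs : ∀ m ≤ N - 1, κ * ∑ k ∈ range m, inner ℝ (r (k + 1)) (A (g (k + 1))) ≤ Θ * M := by
    intro m hm
    rw [hΘ, mul_assoc]
    refine mul_le_mul_of_nonneg_left ?_ hκ.le
    rw [sum_mul]
    refine (sum_le_sum fun k hk => ?_).trans (sum_le_sum_of_subset_of_nonneg
        (range_subset_range.2 hm) fun i _ _ => by positivity)
    exact (real_inner_le_norm _ _).trans (mul_le_mul_of_nonneg_left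
      (hgM k (by have := mem_range.1 hk; omega)) (norm_nonneg _))
  have hE0 : En 0 = b ^ 2 / 2 := by
    simp only [hEn, hv, he, hb, zero_add, sub_zero, map_zero, inner_zero_left]
    ring
  have hEup : ∀ m ≤ N - 1, En m ≤ b ^ 2 / 2 + M ^ 2 / 8 + Θ * M := fun m hm => by
    have h := sum_congr rfl fun k hk => hstep k ((mem_range.1 hk).trans_le hm)
    rw [sum_range_sub, sum_sub_distrib, ← mul_sum, ← mul_sum, hE0] at h
    have := hpos m hm
    have := hrhs m hm
    linarith
  -- coercivity: `4 (x, y) = ‖x + y‖² - ‖x - y‖²`, and the CFL condition controls the last term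
  have hElow : ∀ m, ‖v m‖ ^ 2 / 4 + ‖B ((2 : ℝ)⁻¹ • (e (m + 1) + e m))‖ ^ 2 / 2 ≤ En m :=
    fun m => by
    have h1 := hCFL (κ⁻¹ • (e (m + 1) - e m))
    have h2 : κ ^ 2 * ‖B (κ⁻¹ • (e (m + 1) - e m))‖ ^ 2 = ‖B (e (m + 1)) - B (e m)‖ ^ 2 := by
      rw [map_smul, map_sub, norm_smul, Real.norm_of_nonneg (by positivity)]
      field_simp
    have h3 : ‖B ((2 : ℝ)⁻¹ • (e (m + 1) + e m))‖ ^ 2 = ‖B (e (m + 1)) + B (e m)‖ ^ 2 / 4 := by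
      rw [map_smul, map_add, norm_smul, Real.norm_of_nonneg (by positivity)]
      ring
    have h4 := norm_add_sq_real (B (e (m + 1))) (B (e m))
    have h5 := norm_sub_sq_real (B (e (m + 1))) (B (e m))
    have h6 := real_inner_comm (B (e (m + 1))) (B (e m))
    simp only [hEn]
    rw [h3]
    simp only [hv]
    nlinarith
  have hMle : M ≤ 2 * b + 8 * Θ := by
    have h1 := hElow m₀
    have h2 := hEup m₀ (by have := mem_range.1 hm₀; omega)
    have h3 := sq_nonneg ‖B ((2 : ℝ)⁻¹ • (e (m₀ + 1) + e m₀))‖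
    rw [← hM] at h1
    by_contra! h
    nlinarith
  refine ⟨(hvM n hn).trans hMle, ?_⟩
  have h1 := hElow n
  have h2 := hEup n (by omega)
  refine abs_le_of_sq_le_sq' ?_ (by positivity) |>.2
  have h3 : Θ * M ≤ Θ * (2 * b + 8 * Θ) := mul_le_mul_of_nonneg_left hMle hΘ0
  have h4 : M ^ 2 ≤ (2 * b + 8 * Θ) ^ 2 := pow_le_pow_left₀ hM0 hMle 2
  nlinarith [sq_nonneg ‖v n‖, mul_nonneg hb0 hΘ0]

end Energy

end FracWave

namespace FracWave

/-! ### Time regularity of the solution -/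

open Filter Topology Finset
open Set (Icc Ioo Ioc)

variable {X : Type*} [NormedAddCommGroup X]

lemma intervalIntegrable_of_norm_le_rpow {w : ℝ → X} {T α C₀ c : ℝ} (hT : 0 < T) (hα : 0 < α)
    (hw : ContinuousOn w (Ioc 0 T)) (hb : ∀ t ∈ Ioc 0 T, ‖w t‖ ≤ C₀ * (1 + c * t ^ (α - 1))) :
    IntervalIntegrable w volume 0 T := by
  have h1 : IntervalIntegrable (fun t : ℝ => C₀ * (1 + c * t ^ (α - 1))) volume 0 T :=
    (intervalIntegrable_const.add
      ((intervalIntegral.intervalIntegrable_rpow' (by linarith)).const_mul c)).const_mul C₀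
  refine h1.mono_fun ?_ ?_
  · rw [Set.uIoc_of_le hT.le]
    exact hw.aestronglyMeasurable measurableSet_Ioc
  · rw [Set.uIoc_of_le hT.le]
    filter_upwards [ae_restrict_mem measurableSet_Ioc] with t ht
    exact (hb t ht).trans (Real.le_norm_self _)

variable [NormedSpace ℝ X]

/-- The derivatives on `(0, T]` and on `[0, T]` agree at positive times. -/
lemma iteratedDerivWithin_Ioc_eq (u : ℝ → X) (k : ℕ) {T t : ℝ} (ht : 0 < t) :
    iteratedDerivWithin k u (Ioc 0 T) t = iteratedDerivWithin k u (Icc 0 T) t := by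
  have h : Ioc 0 T =ᶠ[𝓝 t] Icc 0 T := by
    filter_upwards [lt_mem_nhds ht] with s hs
    exact propext ⟨fun h => ⟨h.1.le, h.2⟩, fun h => ⟨hs, h.2⟩⟩
  rw [iteratedDerivWithin, iteratedDerivWithin, iteratedFDerivWithin_congr_set h]

lemma hasDerivAt_iteratedDerivWithin {u : ℝ → X} {s : Set ℝ} {n : WithTop ℕ∞} {k : ℕ}
    (hu : ContDiffOn ℝ n u s) (hk : (k : WithTop ℕ∞) < n) (hs : UniqueDiffOn ℝ s) {t : ℝ}
    (ht : s ∈ 𝓝 t) :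
    HasDerivAt (iteratedDerivWithin k u s) (iteratedDerivWithin (k + 1) u s t) t := by
  rw [iteratedDerivWithin_succ]
  exact ((hu.differentiableOn_iteratedDerivWithin hk hs) t
    (mem_of_mem_nhds ht)).hasDerivWithinAt.hasDerivAt ht

lemma timeReg_of_contDiffOn {T α C₀ c₃ : ℝ} (hT : 0 < T) (hα : 0 < α) {u : ℝ → X}
    (h2 : ContDiffOn ℝ 2 u (Icc 0 T)) (h4 : ContDiffOn ℝ 4 u (Ioc 0 T))
    (hb : ∀ t ∈ Ioc 0 T, ‖iteratedDerivWithin 3 u (Ioc 0 T) t‖ ≤ C₀ * (1 + c₃ * t ^ (α - 1))) :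
    TimeReg T u (derivWithin u (Icc 0 T)) (iteratedDerivWithin 2 u (Icc 0 T))
      (iteratedDerivWithin 3 u (Ioc 0 T)) (iteratedDerivWithin 4 u (Ioc 0 T)) := by
  have hs2 : UniqueDiffOn ℝ (Icc 0 T) := uniqueDiffOn_Icc hT
  have hs4 : UniqueDiffOn ℝ (Ioc 0 T) := uniqueDiffOn_Ioc 0 T
  have n2 : ∀ t ∈ Ioo 0 T, Icc 0 T ∈ 𝓝 t := fun t ht => Icc_mem_nhds ht.1 ht.2
  have n4 : ∀ t ∈ Ioo 0 T, Ioc 0 T ∈ 𝓝 t := fun t ht => Ioc_mem_nhds ht.1 ht.2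
  have c3 : ContinuousOn (iteratedDerivWithin 3 u (Ioc 0 T)) (Ioc 0 T) :=
    h4.continuousOn_iteratedDerivWithin (m := 3) (by norm_cast) hs4
  refine ⟨h2.continuousOn, ?_, h2.continuousOn_iteratedDerivWithin (m := 2) (by norm_cast) hs2, c3,
    h4.continuousOn_iteratedDerivWithin (m := 4) (by norm_cast) hs4, fun t ht => ?_, fun t ht => ?_,
    fun t ht => ?_, fun t ht => hasDerivAt_iteratedDerivWithin h4 (k := 3) (by norm_cast) hs4
      (n4 t ht), intervalIntegrable_of_norm_le_rpow hT hα c3 hb⟩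
  · rw [← iteratedDerivWithin_one]
    exact h2.continuousOn_iteratedDerivWithin (m := 1) (by norm_cast) hs2
  · have := hasDerivAt_iteratedDerivWithin h2 (k := 0) (by norm_cast) hs2 (n2 t ht)
    rwa [iteratedDerivWithin_zero, zero_add, iteratedDerivWithin_one] at this
  · have := hasDerivAt_iteratedDerivWithin h2 (k := 1) (by norm_cast) hs2 (n2 t ht)
    rwa [iteratedDerivWithin_one] at this
  · refine (hasDerivAt_iteratedDerivWithin h4 (k := 2) (by norm_cast) hs4
      (n4 t ht)).congr_of_eventuallyEq ?_
    filter_upwards [lt_mem_nhds ht.1] with s hs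
    exact (iteratedDerivWithin_Ioc_eq u 2 hs).symm

lemma derivWithin_derivWithin (u : ℝ → X) (s : Set ℝ) (t : ℝ) :
    derivWithin (derivWithin u s) s t = iteratedDerivWithin 2 u s t := by
  rw [iteratedDerivWithin_succ, iteratedDerivWithin_one]

/-- The Caputo derivative of order `γ + 1` is that of order `γ` of the velocity. -/
lemma caputo_add_one {γ : ℝ} (hγ : γ ∈ Ioo (-1 : ℝ) 1) (hγ0 : γ ≠ 0) (T : ℝ) (u : ℝ → X) (t : ℝ) :
    caputo T (γ + 1) u t = caputo T γ (derivWithin u (Icc 0 T)) t := by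
  rcases hγ0.lt_or_gt with h | h
  · have hc : ⌈γ + 1⌉₊ = 1 := by
      rw [Nat.ceil_eq_iff one_ne_zero]
      exact ⟨by norm_num; linarith [hγ.1], by norm_num; linarith⟩
    rw [caputo, if_neg (by linarith [hγ.1]), hc, Nat.cast_one, if_neg (by linarith), caputo,
      if_pos h, iteratedDerivWithin_one, show 1 - (γ + 1) = -γ by ring]
  · have hc : ⌈γ + 1⌉₊ = 2 := by
      rw [Nat.ceil_eq_iff two_ne_zero]
      exact ⟨by norm_num; linarith, by norm_num; linarith [hγ.2]⟩
    have hc' : ⌈γ⌉₊ = 1 := by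
      rw [Nat.ceil_eq_iff one_ne_zero]
      exact ⟨by norm_num; linarith, by norm_num; linarith [hγ.2]⟩
    rw [caputo, if_neg (by linarith), hc, Nat.cast_two, if_neg (by linarith [hγ.2]), caputo,
      if_neg (by linarith), hc', Nat.cast_one, if_neg (by linarith [hγ.2]),
      iteratedDerivWithin_succ', show (2 : ℝ) - (γ + 1) = 1 - γ by ring]

namespace TimeReg

variable {T α C₀ : ℝ} {u u₁ u₂ u₃ u₄ : ℝ → X}

lemma integral₃_le (H : TimeReg T u u₁ u₂ u₃ u₄) (hα : 0 < α) {c : ℝ}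
    (hb : ∀ t ∈ Ioc 0 T, ‖u₃ t‖ ≤ C₀ * (1 + c * t ^ (α - 1))) {a b : ℝ} (ha : 0 ≤ a) (hab : a ≤ b)
    (hbT : b ≤ T) :
    ∫ t in a..b, ‖u₃ t‖ ≤ C₀ * ((b - a) + c * ((b ^ α - a ^ α) / α)) := by
  have hi : IntervalIntegrable (fun t : ℝ => t ^ (α - 1)) volume a b :=
    intervalIntegral.intervalIntegrable_rpow' (by linarith)
  have h1 : IntervalIntegrable (fun t : ℝ => C₀ * (1 + c * t ^ (α - 1))) volume a b :=
    (intervalIntegrable_const.add (hi.const_mul c)).const_mul C₀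
  calc ∫ t in a..b, ‖u₃ t‖ ≤ ∫ t in a..b, C₀ * (1 + c * t ^ (α - 1)) :=
        intervalIntegral.integral_mono_on_of_le_Ioo hab (H.intervalIntegrable₃ ha hab hbT).norm h1
          fun t ht => hb t ⟨ha.trans_lt ht.1, ht.2.le.trans hbT⟩
    _ = _ := by
        rw [intervalIntegral.integral_const_mul, intervalIntegral.integral_add
          intervalIntegrable_const (hi.const_mul c), intervalIntegral.integral_const_mul,
          integral_rpow (Or.inl (by linarith)), intervalIntegral.integral_const, sub_add_cancel]
        simp

lemma integral₄_le (H : TimeReg T u u₁ u₂ u₃ u₄) (hα : α ≠ 1) (hC₀ : 0 ≤ C₀) {c : ℝ} (hc : 0 ≤ c)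
    (hb : ∀ t ∈ Ioc 0 T, ‖u₄ t‖ ≤ C₀ * (1 + c * t ^ (α - 2))) {a b : ℝ} (ha : 0 < a) (hab : a ≤ b)
    (hbT : b ≤ T) :
    ∫ t in a..b, ‖u₄ t‖ ≤ C₀ * (b + c * ((b ^ (α - 1) + a ^ (α - 1)) / |α - 1|)) := by
  have h0 : (0 : ℝ) ∉ Set.uIcc a b := by
    rw [Set.uIcc_of_le hab]
    exact fun h => absurd h.1 (not_le.2 ha)
  have hi : IntervalIntegrable (fun t : ℝ => t ^ (α - 2)) volume a b :=
    intervalIntegral.intervalIntegrable_rpow (Or.inr h0)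
  have h1 : IntervalIntegrable (fun t : ℝ => C₀ * (1 + c * t ^ (α - 2))) volume a b :=
    (intervalIntegrable_const.add (hi.const_mul c)).const_mul C₀
  have hα' : α - 1 ≠ 0 := sub_ne_zero.2 hα
  have hquot : (b ^ (α - 1) - a ^ (α - 1)) / (α - 1) ≤ (b ^ (α - 1) + a ^ (α - 1)) / |α - 1| := by
    refine (le_abs_self _).trans ?_
    rw [abs_div]
    refine div_le_div_of_nonneg_right ((abs_sub _ _).trans (le_of_eq ?_)) (abs_nonneg _)
    rw [abs_of_pos (Real.rpow_pos_of_pos ha _),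
      abs_of_pos (Real.rpow_pos_of_pos (ha.trans_le hab) _)]
  calc ∫ t in a..b, ‖u₄ t‖ ≤ ∫ t in a..b, C₀ * (1 + c * t ^ (α - 2)) :=
        intervalIntegral.integral_mono_on_of_le_Ioo hab (H.intervalIntegrable₄ ha hab hbT).norm h1
          fun t ht => hb t ⟨ha.trans ht.1, ht.2.le.trans hbT⟩
    _ = C₀ * ((b - a) + c * ((b ^ (α - 1) - a ^ (α - 1)) / (α - 1))) := by
        rw [intervalIntegral.integral_const_mul, intervalIntegral.integral_add
          intervalIntegrable_const (hi.const_mul c), intervalIntegral.integral_const_mul,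
          integral_rpow (Or.inr ⟨fun h => hα' (by linarith), h0⟩),
          intervalIntegral.integral_const, show α - 2 + 1 = α - 1 by ring]
        simp
    _ ≤ _ := by gcongr; linarith

/-- The powers of `κ` in the error. The singularity at `t = 0` is felt through the first time step,
where `∫ ‖u₃‖` is of order `κ^α`, and through `∫_κ^T ‖u₄‖`, of order `1 + κ^(α-1)`; the hypothesis
`α ≠ 1` excludes a logarithm in the latter. -/
lemma exists_gridBounds (H : TimeReg T u u₁ u₂ u₃ u₄) (hT : 0 < T) (hα : 0 < α) (hα1 : α ≠ 1)
    (hC₀ : 0 < C₀) {c₂ c₃ c₄ : ℝ} (hc₂ : 0 ≤ c₂) (hc₃ : 0 ≤ c₃) (hc₄ : 0 ≤ c₄)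
    (b2 : ∀ t ∈ Ioc 0 T, ‖u₂ t‖ ≤ C₀ * (1 + c₂ * t ^ α))
    (b3 : ∀ t ∈ Ioc 0 T, ‖u₃ t‖ ≤ C₀ * (1 + c₃ * t ^ (α - 1)))
    (b4 : ∀ t ∈ Ioc 0 T, ‖u₄ t‖ ≤ C₀ * (1 + c₄ * t ^ (α - 2))) {κ : ℝ} (hκ : 0 < κ) {N : ℕ}
    (hN : N * κ = T) :
    ∃ h S₃ S₄ M : ℝ, 0 ≤ h ∧ 0 ≤ S₃ ∧ 0 ≤ S₄ ∧ 0 ≤ M ∧ GridBounds T κ N u₂ u₃ u₄ h S₃ S₄ M ∧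
      κ * h + κ ^ 2 * S₃ + κ ^ 2 * S₄ + κ ^ 2 * M ≤
        C₀ * (1 + 1 / α + 1 / |α - 1|) * (c₃ + c₄) * κ ^ (1 + α) +
        C₀ * (2 + 2 * T + c₂ * T ^ α + c₃ * (T ^ (α - 1) + T ^ α / α) +
          c₄ * (T ^ (α - 1) / |α - 1|)) * κ ^ 2 := by
  have hN1 : 1 ≤ N := by
    rcases Nat.eq_zero_or_pos N with rfl | h
    · simp at hN; linarith
    · exact h
  have hN1' : (1 : ℝ) ≤ N := by exact_mod_cast hN1
  have hκT : κ ≤ T := by nlinarith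
  have hα' : 0 < |α - 1| := abs_pos.2 (sub_ne_zero.2 hα1)
  have p1 : 0 < κ ^ α := Real.rpow_pos_of_pos hκ _
  have p2 : 0 < T ^ α := Real.rpow_pos_of_pos hT _
  have p3 : 0 < T ^ (α - 1) := Real.rpow_pos_of_pos hT _
  have p4 : 0 < κ ^ (α - 1) := Real.rpow_pos_of_pos hκ _
  have ek : κ * κ ^ (α - 1) = κ ^ α := by
    conv_lhs => rw [mul_comm, ← Real.rpow_add_one hκ.ne', sub_add_cancel]
  have ek' : κ * κ ^ α = κ ^ (1 + α) := by rw [Real.rpow_add hκ, Real.rpow_one]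
  set h := C₀ * (κ + c₃ * (κ ^ α * (1 + 1 / α) + κ * T ^ (α - 1))) with hh
  set S₃ := C₀ * (T + c₃ * (T ^ α / α)) with hS₃
  set S₄ := C₀ * (T + c₄ * ((T ^ (α - 1) + κ ^ (α - 1)) / |α - 1|)) with hS₄
  set M := C₀ * (1 + c₂ * T ^ α) with hM
  have key : C₀ * (κ + c₃ * κ ^ α) ≤ h := by
    refine mul_le_mul_of_nonneg_left (add_le_add le_rfl (mul_le_mul_of_nonneg_left ?_ hc₃)) hC₀.le
    have : 0 < κ ^ α * (1 / α) + κ * T ^ (α - 1) := by positivity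
    linarith
  refine ⟨h, S₃, S₄, M, by positivity, by positivity, by positivity, by positivity,
    ⟨fun p hp => ?_, ?_, ?_, ?_, ?_⟩, ?_⟩
  · have hpT : ((p + 1 : ℕ) : ℝ) * κ ≤ T := by
      rw [← hN]; exact mul_le_mul_of_nonneg_right (by exact_mod_cast hp) hκ.le
    have hle : (p : ℝ) * κ ≤ (p + 1 : ℕ) * κ :=
      mul_le_mul_of_nonneg_right (by push_cast; linarith) hκ.le
    rcases Nat.eq_zero_or_pos p with rfl | hp0
    · refine (H.integral₃_le hα b3 (by positivity) hle hpT).trans ?_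
      rw [zero_add, Nat.cast_one, one_mul, Nat.cast_zero, zero_mul, Real.zero_rpow hα.ne', sub_zero,
        sub_zero]
      refine mul_le_mul_of_nonneg_left (add_le_add le_rfl (mul_le_mul_of_nonneg_left ?_ hc₃)) hC₀.le
      have : 0 < κ ^ α + κ * T ^ (α - 1) := by positivity
      rw [div_eq_mul_one_div]
      linarith
    · have hp1 : (1 : ℝ) ≤ p := by exact_mod_cast hp0
      have hb : ∀ t ∈ Icc ((p : ℝ) * κ) ((p + 1 : ℕ) * κ),
          ‖u₃ t‖ ≤ C₀ * (1 + c₃ * (κ ^ (α - 1) + T ^ (α - 1))) := fun t ht => by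
        have ht1 : κ ≤ t := le_trans (by nlinarith) ht.1
        have ht0 : 0 < t := hκ.trans_le ht1
        refine (b3 t ⟨ht0, ht.2.trans hpT⟩).trans ?_
        gcongr
        rcases le_total 1 α with h1 | h1
        · have := Real.rpow_le_rpow ht0.le (ht.2.trans hpT) (by linarith : 0 ≤ α - 1)
          linarith
        · have := Real.rpow_le_rpow_of_nonpos hκ ht1 (by linarith : α - 1 ≤ 0)
          linarith
      have h1 := intervalIntegral.integral_mono_on hle
        (H.intervalIntegrable_cell₃ hκ hN hp).norm intervalIntegrable_const hb
      rw [intervalIntegral.integral_const, smul_eq_mul,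
        show ((p + 1 : ℕ) : ℝ) * κ - p * κ = κ by push_cast; ring] at h1
      refine h1.trans (le_of_sub_nonneg ?_)
      have : 0 ≤ C₀ * (c₃ * (κ ^ α * (1 / α))) := by positivity
      rw [hh, ← ek] at *
      linarith
  · refine le_trans ?_ key
    calc κ * ‖u₃ κ‖ ≤ κ * (C₀ * (1 + c₃ * κ ^ (α - 1))) :=
          mul_le_mul_of_nonneg_left (b3 κ ⟨hκ, hκT⟩) hκ.le
      _ = _ := by rw [← ek]; ring
  · have := intervalIntegral.sum_integral_adjacent_intervals (a := fun p : ℕ => (p : ℝ) * κ)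
      (n := N) (μ := volume) (f := fun t => ‖u₃ t‖) fun p hp =>
        (H.intervalIntegrable_cell₃ hκ hN hp).norm
    simp only [Nat.cast_zero, zero_mul] at this
    simp only [cell]
    rw [this, hN]
    refine (H.integral₃_le hα b3 le_rfl hT.le le_rfl).trans (le_of_eq ?_)
    rw [Real.zero_rpow hα.ne', sub_zero, sub_zero]
  · have := intervalIntegral.sum_integral_adjacent_intervals_Ico (a := fun p : ℕ => (p : ℝ) * κ)
      (m := 1) (n := N) (μ := volume) (f := fun t => ‖u₄ t‖) hN1 fun p hp =>
        (H.intervalIntegrable_cell₄ hκ hN hp.1 hp.2).norm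
    rw [Nat.cast_one, one_mul, hN] at this
    have h5 : ∑ p ∈ range N, cellPos κ u₄ p = ∑ p ∈ Finset.Ico 1 N, cell κ u₄ p := by
      rw [range_eq_Ico, sum_eq_sum_Ico_succ_bot hN1]
      simp only [cellPos, if_true, zero_add]
      refine sum_congr rfl fun p hp => ?_
      rw [if_neg (by have := (Finset.mem_Ico.1 hp).1; omega)]
    rw [h5]
    simp only [cell]
    rw [this]
    exact H.integral₄_le hα1 hC₀.le hc₄ b4 hκ hκT le_rfl
  · have hpos : ∀ t ∈ Ioc 0 T, ‖u₂ t‖ ≤ M := fun t ht => (b2 t ht).trans (by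
      exact mul_le_mul_of_nonneg_left (add_le_add le_rfl (mul_le_mul_of_nonneg_left
        (Real.rpow_le_rpow ht.1.le ht.2 hα.le) hc₂)) hC₀.le)
    intro t ht
    rcases ht.1.eq_or_lt with h0 | h0
    · have hc := (H.cont₂ t ht).norm
      have : (𝓝[Ioc 0 T] t).NeBot := by
        rw [← h0, nhdsWithin_Ioc_eq_nhdsGT hT]
        infer_instance
      refine le_of_tendsto (x := 𝓝[Ioc 0 T] t) (hc.mono_left (nhdsWithin_mono _
        fun s hs => ⟨hs.1.le, hs.2⟩)) ?_
      filter_upwards [self_mem_nhdsWithin] with s hs using hpos s hs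
    · exact hpos t ⟨h0, ht.2⟩
  · have ek2 : κ ^ 2 * κ ^ (α - 1) = κ ^ (1 + α) := by rw [← ek', ← ek]; ring
    have expand : κ * h + κ ^ 2 * S₃ + κ ^ 2 * S₄ + κ ^ 2 * M =
        C₀ * (c₃ * (1 + 1 / α) + c₄ * (1 / |α - 1|)) * κ ^ (1 + α) +
        C₀ * (2 + 2 * T + c₂ * T ^ α + c₃ * (T ^ (α - 1) + T ^ α / α) +
          c₄ * (T ^ (α - 1) / |α - 1|)) * κ ^ 2 := by
      have : c₄ * (1 / |α - 1|) * κ ^ (1 + α) = c₄ * (κ ^ 2 * κ ^ (α - 1)) / |α - 1| := by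
        rw [ek2]; ring
      rw [hh, hS₃, hS₄, hM, mul_assoc C₀, add_mul _ _ (κ ^ (1 + α)), this, ← ek']
      ring
    rw [expand]
    refine add_le_add (mul_le_mul_of_nonneg_right ?_ (by positivity)) le_rfl
    rw [mul_assoc]
    refine mul_le_mul_of_nonneg_left ?_ hC₀.le
    have q1 : 0 ≤ c₃ * (1 / |α - 1|) := by positivity
    have q2 : 0 ≤ c₄ * (1 / α) := by positivity
    linarith

end TimeReg

end FracWave

namespace FracWave

/-! ### Consistency -/

open Finset
open Set (Icc Ioo Ioc)

/-- Consistency of the quadrature of the difference quotient with the fractional derivative. -/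
lemma exists_consistency_bound {X : Type*} [NormedAddCommGroup X] [NormedSpace ℝ X]
    [CompleteSpace X] {γ : ℝ} (hγ : γ ∈ Ioo (-1 : ℝ) 1) (hγ0 : γ ≠ 0) {T : ℝ} (hT : 0 < T) :
    ∃ K > 0, ∀ (κ : ℝ) (N : ℕ) (u u₁ u₂ u₃ u₄ : ℝ → X) (h S₃ S₄ M : ℝ), 0 < κ → N * κ = T →
      0 ≤ h → 0 ≤ S₃ → 0 ≤ S₄ → 0 ≤ M →
      TimeReg T u u₁ u₂ u₃ u₄ → (∀ t ∈ Icc 0 T, derivWithin u₁ (Icc 0 T) t = u₂ t) →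
      GridBounds T κ N u₂ u₃ u₄ h S₃ S₄ M →
      κ * ∑ n ∈ range (N - 1), ‖caputo T γ u₁ ((n + 1 : ℕ) * κ) -
        correctedCQ κ γ (centralDiff κ (u₁ 0) fun j => u (j * κ)) (n + 1)‖ ≤
        K * (κ * h + κ ^ 2 * S₃ + κ ^ 2 * S₄ + κ ^ 2 * M) := by
  have comb : ∃ K > 0, ∀ (κ : ℝ) (N : ℕ) (u u₁ u₂ u₃ u₄ : ℝ → X) (h S₃ S₄ M : ℝ), 0 < κ →
      N * κ = T → 0 ≤ h → 0 ≤ S₃ → 0 ≤ S₄ → 0 ≤ M →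
      TimeReg T u u₁ u₂ u₃ u₄ → (∀ t ∈ Icc 0 T, derivWithin u₁ (Icc 0 T) t = u₂ t) →
      GridBounds T κ N u₂ u₃ u₄ h S₃ S₄ M →
      κ * ∑ n ∈ range N, ‖caputo T γ u₁ ((n + 1 : ℕ) * κ) -
        correctedCQ κ γ (fun j => u₁ (j * κ)) (n + 1)‖ +
      κ * ∑ n ∈ range (N - 1), ‖correctedCQ κ γ (centralDefect κ u u₁) (n + 1)‖ ≤
        K * (κ * h + κ ^ 2 * S₃ + κ ^ 2 * S₄ + κ ^ 2 * M) := by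
    rcases hγ0.lt_or_gt with h0 | h0
    · obtain ⟨K₁, hK₁, H₁⟩ := exists_cq_bound_neg (X := X) ⟨hγ.1, h0⟩ hT
      obtain ⟨K₂, hK₂, H₂⟩ := exists_defect_bound_neg (X := X) ⟨hγ.1, h0⟩ hT
      refine ⟨K₁ + K₂, by positivity,
        fun κ N u u₁ u₂ u₃ u₄ h S₃ S₄ M hκ hN a1 a2 a3 a4 H hd G => ?_⟩
      have q1 := H₁ κ N u u₁ u₂ u₃ u₄ h S₃ S₄ M hκ hN H G
      have q2 := H₂ κ N u u₁ u₂ u₃ u₄ h S₃ S₄ M hκ hN H G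
      have r1 : 0 ≤ κ * h := by positivity
      have r2 : 0 ≤ κ ^ 2 * S₄ := by positivity
      have r3 : 0 ≤ κ ^ 2 * M := by positivity
      rw [add_mul]
      exact add_le_add (q1.trans (mul_le_mul_of_nonneg_left (by linarith) hK₁.le))
        (q2.trans (mul_le_mul_of_nonneg_left (by linarith) hK₂.le))
    · obtain ⟨K₁, hK₁, H₁⟩ := exists_cq_bound_pos (X := X) ⟨h0, hγ.2⟩ hT
      obtain ⟨K₂, hK₂, H₂⟩ := exists_defect_bound_pos (X := X) ⟨h0, hγ.2⟩ hT
      refine ⟨K₁ + K₂, by positivity,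
        fun κ N u u₁ u₂ u₃ u₄ h S₃ S₄ M hκ hN a1 a2 a3 a4 H hd G => ?_⟩
      have q1 := H₁ κ N u u₁ u₂ u₃ u₄ h S₃ S₄ M hκ hN H hd G
      have q2 := H₂ κ N u u₁ u₂ u₃ u₄ h S₃ S₄ M hκ hN H G
      have r2 : 0 ≤ κ ^ 2 * S₃ := by positivity
      have r3 : 0 ≤ κ ^ 2 * M := by positivity
      rw [add_mul]
      exact add_le_add (q1.trans (mul_le_mul_of_nonneg_left (by linarith) hK₁.le))
        (q2.trans (mul_le_mul_of_nonneg_left (by linarith) hK₂.le))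
  obtain ⟨K, hK, H₀⟩ := comb
  refine ⟨K, hK, fun κ N u u₁ u₂ u₃ u₄ h S₃ S₄ M hκ hN a1 a2 a3 a4 H hd G => ?_⟩
  refine le_trans ?_ (H₀ κ N u u₁ u₂ u₃ u₄ h S₃ S₄ M hκ hN a1 a2 a3 a4 H hd G)
  rw [← mul_add]
  refine mul_le_mul_of_nonneg_left ?_ hκ.le
  have h1 : ∑ n ∈ range (N - 1), ‖caputo T γ u₁ ((n + 1 : ℕ) * κ) -
      correctedCQ κ γ (fun j => u₁ (j * κ)) (n + 1)‖ ≤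
      ∑ n ∈ range N, ‖caputo T γ u₁ ((n + 1 : ℕ) * κ) -
        correctedCQ κ γ (fun j => u₁ (j * κ)) (n + 1)‖ :=
    sum_le_sum_of_subset_of_nonneg (range_subset_range.2 (Nat.sub_le _ _))
      fun _ _ _ => norm_nonneg _
  refine le_trans ?_ (add_le_add h1 le_rfl)
  rw [← sum_add_distrib]
  refine sum_le_sum fun n _ => ?_
  have e : correctedCQ κ γ (centralDefect κ u u₁) (n + 1) =
      correctedCQ κ γ (fun j => u₁ (j * κ)) (n + 1) -
      correctedCQ κ γ (centralDiff κ (u₁ 0) fun j => u (j * κ)) (n + 1) :=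
    correctedCQ_sub κ γ _ _ _
  rw [e]
  exact norm_sub_le_norm_sub_add_norm_sub _ _ _

variable {d : ℕ} {Ω : Set (EuclideanSpace ℝ (Fin d))}

section Scheme

variable (V : Submodule ℝ (H10 Ω)) [FiniteDimensional ℝ V]

lemma ritzErrL2_nonneg (w : H10 Ω) : 0 ≤ ritzErrL2 V w := norm_nonneg _

/-- A consistency error `w - z` enters the scheme as `w - R_h z`; this separates it from the Ritz
error of `w`. -/
lemma norm_toL2_sub_ritz_le {CP : ℝ} (hCP0 : 0 < CP)
    (hCP : ∀ w : H10 Ω, ‖toL2 Ω w‖ ≤ CP * ‖grad Ω w‖) (w z : H10 Ω) :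
    ‖toL2 Ω (w - (ritz V z : H10 Ω))‖ ≤ ritzErrL2 V w + CP * ‖w - z‖ := by
  have e : w - (ritz V z : H10 Ω) = (ritz V (w - z) : H10 Ω) - ((ritz V w : H10 Ω) - w) := by
    have := (ritzLM V hCP0 hCP).map_sub w z
    change ritz V (w - z) = ritz V w - ritz V z at this
    rw [this, Submodule.coe_sub]
    abel
  rw [e, map_sub, add_comm]
  exact (norm_sub_le _ _).trans (add_le_add (norm_toL2_ritz_le V hCP0 hCP _) le_rfl)

end Scheme

end FracWave

namespace FracWave

/-! ### The error equation -/

open Finset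
open Set (Icc Ioo Ioc)

variable {d : ℕ} {Ω : Set (EuclideanSpace ℝ (Fin d))} {V : Submodule ℝ (H10 Ω)}
  [FiniteDimensional ℝ V]

set_option maxHeartbeats 1000000 in
/-- The discrete solution differs from the Ritz projection of the exact one by a solution of the
homogeneous scheme with the consistency error as its right-hand side. -/
lemma IsCorrectedScheme.error_equation {CP : ℝ} (hCP0 : 0 < CP)
    (hCP : ∀ w : H10 Ω, ‖toL2 Ω w‖ ≤ CP * ‖grad Ω w‖) {γ α₀ κ T : ℝ} {N : ℕ} {f : ℝ → L2 Ω}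
    {u u₁ u₂ : ℝ → H10 Ω} {U : ℕ → V} (hκ : 0 < κ) (hN : N * κ = T)
    (hU : IsCorrectedScheme γ α₀ κ N f (u 0) (u₁ 0) (u₂ 0) V U)
    (hu : ∀ t ∈ Ioc 0 T, ∀ v : H10 Ω, inner ℝ (toL2 Ω (u₂ t)) (toL2 Ω v) +
      inner ℝ (grad Ω (u t)) (grad Ω v) +
      dampingCoeff α₀ γ * inner ℝ (toL2 Ω (caputo T γ u₁ t)) (toL2 Ω v) =
      inner ℝ (f t) (toL2 Ω v)) {n : ℕ} (hn : n < N - 1) (v : V) :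
    let e : ℕ → V := fun n => U n - ritz V (u (n * κ))
    (κ ^ 2)⁻¹ * inner ℝ (toL2 Ω (e (n + 2) - (2 : ℝ) • e (n + 1) + e n : V)) (toL2 Ω v) +
      inner ℝ (grad Ω (e (n + 1))) (grad Ω v) +
      dampingCoeff α₀ γ *
        inner ℝ (toL2 Ω (correctedCQ κ γ (centralDiff κ 0 e) (n + 1) : V)) (toL2 Ω v) =
    inner ℝ (toL2 Ω (u₂ ((n + 1 : ℕ) * κ) - (ritz V ((κ ^ 2)⁻¹ • (u ((n + 2 : ℕ) * κ) -
        (2 : ℝ) • u ((n + 1 : ℕ) * κ) + u (n * κ))) : H10 Ω)) +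
      dampingCoeff α₀ γ • toL2 Ω (caputo T γ u₁ ((n + 1 : ℕ) * κ) -
        (ritz V (correctedCQ κ γ (centralDiff κ (u₁ 0) fun j => u (j * κ)) (n + 1)) : H10 Ω)))
      (toL2 Ω v) := by
  intro e
  set a := dampingCoeff α₀ γ with ha
  set R := ritzLM V hCP0 hCP with hR
  have hRw : ∀ w, ritz V w = R w := fun _ => rfl
  have ht : ((n + 1 : ℕ) : ℝ) * κ ∈ Ioc 0 T :=
    ⟨by positivity, by
      rw [← hN]; exact mul_le_mul_of_nonneg_right (by exact_mod_cast (by omega)) hκ.le⟩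
  have h1 := hU.step (n + 1) (by omega) (by omega) v
  have h2 := hu _ ht v
  have h3 := ritz_spec V (u ((n + 1 : ℕ) * κ)) v
  rw [Nat.add_sub_cancel, show n + 1 + 1 = n + 2 from rfl] at h1
  have e1 : e (n + 2) - (2 : ℝ) • e (n + 1) + e n =
      (U (n + 2) - (2 : ℝ) • U (n + 1) + U n) - R (u ((n + 2 : ℕ) * κ) -
        (2 : ℝ) • u ((n + 1 : ℕ) * κ) + u (n * κ)) := by
    simp only [e, hRw, map_add, map_sub, map_smul, smul_sub]
    abel
  have e2 : correctedCQ κ γ (centralDiff κ 0 e) (n + 1) =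
      correctedCQ κ γ (centralDiff κ (ritz V (u₁ 0)) U) (n + 1) -
        R (correctedCQ κ γ (centralDiff κ (u₁ 0) fun j => u (j * κ)) (n + 1)) := by
    rw [map_correctedCQ, ← correctedCQ_sub]
    congr 1
    funext j
    rw [map_centralDiff, hRw, ← centralDiff_sub, sub_self]
    rfl
  have e3 : e (n + 1) = U (n + 1) - ritz V (u ((n + 1 : ℕ) * κ)) := rfl
  rw [e1, e2, e3]
  simp only [hRw, Submodule.coe_sub, map_sub, inner_sub_left, inner_add_left, map_smul,
    Submodule.coe_smul, real_inner_smul_left] at *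
  rw [h3]
  linarith

/-- The error of the starting value. -/
lemma IsCorrectedScheme.norm_start_le {CP : ℝ} (hCP0 : 0 < CP)
    (hCP : ∀ w : H10 Ω, ‖toL2 Ω w‖ ≤ CP * ‖grad Ω w‖) {γ α₀ κ T : ℝ} {N : ℕ} {f : ℝ → L2 Ω}
    {u u₁ u₂ u₃ u₄ : ℝ → H10 Ω} {U : ℕ → V} (hκ : 0 < κ) (hκT : κ ≤ T)
    (hU : IsCorrectedScheme γ α₀ κ N f (u 0) (u₁ 0) (u₂ 0) V U) (H : TimeReg T u u₁ u₂ u₃ u₄)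
    {h : ℝ} (hh : ∫ s in (0 : ℝ)..κ, ‖u₃ s‖ ≤ h) :
    ‖toL2 Ω (κ⁻¹ • (U 1 - ritz V (u κ)) : V)‖ ≤ CP * (κ * h) + κ / 2 * ritzErrL2 V (u₂ 0) := by
  set R := ritzLM V hCP0 hCP with hR
  have hRw : ∀ w, ritz V w = R w := fun _ => rfl
  have e1 : κ⁻¹ • (U 1 - ritz V (u κ)) =
      κ⁻¹ • R (u 0 + κ • u₁ 0 + (κ ^ 2 / 2) • u₂ 0 - u κ) +
        (κ / 2) • (l2Proj V (toL2 Ω (u₂ 0)) - ritz V (u₂ 0)) := by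
    have : κ / 2 = κ⁻¹ * (κ ^ 2 / 2) := by field_simp
    rw [hU.start_one, this, mul_smul, ← smul_add]
    congr 1
    simp only [hRw, map_add, map_sub, map_smul, smul_sub]
    abel
  rw [e1, Submodule.coe_add, map_add]
  refine (norm_add_le _ _).trans (add_le_add ?_ ?_)
  · rw [Submodule.coe_smul, map_smul, norm_smul, Real.norm_of_nonneg (by positivity)]
    have h1 := norm_toL2_ritz_le V hCP0 hCP (u 0 + κ • u₁ 0 + (κ ^ 2 / 2) • u₂ 0 - u κ)
    have h2 := H.norm_taylor_start_le hκ hκT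
    have h3 : ‖u 0 + κ • u₁ 0 + (κ ^ 2 / 2) • u₂ 0 - u κ‖ ≤ h * κ ^ 2 :=
      h2.trans (mul_le_mul_of_nonneg_right hh (by positivity))
    calc _ ≤ κ⁻¹ * (CP * (h * κ ^ 2)) := mul_le_mul_of_nonneg_left
          (h1.trans (mul_le_mul_of_nonneg_left h3 hCP0.le)) (by positivity)
      _ = _ := by field_simp
  · rw [Submodule.coe_smul, map_smul, norm_smul, Real.norm_of_nonneg (by positivity)]
    exact mul_le_mul_of_nonneg_left (norm_l2Proj_sub_ritz_le V _) (by positivity)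

set_option maxHeartbeats 1000000 in
/-- The scheme follows the Ritz projection of the exact solution in the energy norm. -/
theorem exists_energy_error_bound
    (hΩ : ∃ CP > 0, ∀ w : H10 Ω, ‖toL2 Ω w‖ ≤ CP * ‖grad Ω w‖) {γ : ℝ}
    (hγ : γ ∈ Ioo (-1 : ℝ) 1) (hγ0 : γ ≠ 0) {α₀ : ℝ} (hα₀ : 0 < α₀) {T : ℝ} (hT : 0 < T) :
    ∃ κbar > 0, ∃ K > 0, ∃ L > 0, ∀ (f : ℝ → L2 Ω) (u u₁ u₂ u₃ u₄ : ℝ → H10 Ω),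
      TimeReg T u u₁ u₂ u₃ u₄ → (∀ t ∈ Icc 0 T, derivWithin u₁ (Icc 0 T) t = u₂ t) →
      (∀ t ∈ Ioc 0 T, ∀ v : H10 Ω, inner ℝ (toL2 Ω (u₂ t)) (toL2 Ω v) +
        inner ℝ (grad Ω (u t)) (grad Ω v) +
        dampingCoeff α₀ γ * inner ℝ (toL2 Ω (caputo T γ u₁ t)) (toL2 Ω v) =
        inner ℝ (f t) (toL2 Ω v)) →
      ∀ (V : Submodule ℝ (H10 Ω)) [FiniteDimensional ℝ V] (κ : ℝ) (N : ℕ), 0 < κ → κ < κbar →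
      N * κ = T → (∀ v : V, κ ^ 2 / 4 * ‖grad Ω v‖ ^ 2 ≤ 1 / 2 * ‖toL2 Ω v‖ ^ 2) →
      ∀ U : ℕ → V, IsCorrectedScheme γ α₀ κ N f (u 0) (u₁ 0) (u₂ 0) V U →
      ∀ h S₃ S₄ M : ℝ, 0 ≤ h → 0 ≤ S₃ → 0 ≤ S₄ → 0 ≤ M → GridBounds T κ N u₂ u₃ u₄ h S₃ S₄ M →
      ∀ n < N, ∀ Q, Q = K * (κ * ∑ j ∈ Finset.Icc 1 (N - 1), ritzErrL2 V (u₂ (j * κ)) +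
          ritzErrL2 V (u₁ 0) + κ / 2 * ritzErrL2 V (u₂ 0) +
          κ * ∑ j ∈ Finset.Icc 1 (N - 1), ritzErrL2 V (caputo T γ u₁ (j * κ))) +
          L * (κ * h + κ ^ 2 * S₃ + κ ^ 2 * S₄ + κ ^ 2 * M) →
        ‖toL2 Ω (κ⁻¹ • ((U (n + 1) - ritz V (u ((n + 1 : ℕ) * κ))) -
          (U n - ritz V (u (n * κ)))) : V)‖ ≤ Q ∧
        ‖grad Ω ((2 : ℝ)⁻¹ • ((U (n + 1) - ritz V (u ((n + 1 : ℕ) * κ))) +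
          (U n - ritz V (u (n * κ)))) : V)‖ ≤ Q := by
  obtain ⟨CP, hCP0, hCP⟩ := hΩ
  have ha := dampingCoeff_pos hγ hγ0 hα₀
  set a := dampingCoeff α₀ γ with hadef
  obtain ⟨κbar, hκbar, hsmall⟩ := exists_corrWeight1_small hγ hγ0 ha
  obtain ⟨K₁, hK₁, hcons⟩ := exists_consistency_bound (X := H10 Ω) hγ hγ0 hT
  refine ⟨κbar, hκbar, 8 + 8 * a, by positivity, CP * (2 + 8 * (2 + a * K₁)), by positivity,
    fun f u u₁ u₂ u₃ u₄ H hd hu V _ κ N hκ hκb hN hCFL U hU h S₃ S₄ M a1 a2 a3 a4 G n hn Q hQ => ?_⟩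
  have hN1 : 1 ≤ N := by omega
  have hN1' : (1 : ℝ) ≤ N := by exact_mod_cast hN1
  have hκT : κ ≤ T := by nlinarith
  set reg := κ * h + κ ^ 2 * S₃ + κ ^ 2 * S₄ + κ ^ 2 * M with hreg
  have r1 : 0 ≤ κ * h := by positivity
  have r2 : 0 ≤ κ ^ 2 * S₃ := by positivity
  have r3 : 0 ≤ κ ^ 2 * S₄ := by positivity
  have r4 : 0 ≤ κ ^ 2 * M := by positivity
  set e : ℕ → V := fun n => U n - ritz V (u (n * κ)) with he
  set cq : ℕ → H10 Ω := fun n =>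
    correctedCQ κ γ (centralDiff κ (u₁ 0) fun j => u (j * κ)) n with hcq
  set D : ℕ → H10 Ω := fun n => (κ ^ 2)⁻¹ • (u ((n + 2 : ℕ) * κ) -
        (2 : ℝ) • u ((n + 1 : ℕ) * κ) + u (n * κ)) with hD
  -- the residual, indexed by the time level at which the scheme is evaluated
  set r : ℕ → L2 Ω := fun m => toL2 Ω (u₂ (m * κ) - (ritz V (D (m - 1)) : H10 Ω)) +
      a • toL2 Ω (caputo T γ u₁ (m * κ) - (ritz V (cq m) : H10 Ω)) with hr
  have he0 : e 0 = 0 := by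
    simp only [he]
    rw [hU.start_zero, Nat.cast_zero, zero_mul, sub_self]
  have est := energy_estimate ((toL2 Ω).comp V.subtype) ((grad Ω).comp V.subtype) hκ
    ⟨hγ.1.le, hγ.2.le⟩ ha he0 (r := r) hCFL (hsmall κ hκ hκb (N - 1))
    (fun n hn v => hU.error_equation hCP0 hCP hκ hN hu hn v) hn
  have hstart : ‖toL2 Ω (κ⁻¹ • e 1 : V)‖ ≤ CP * (κ * h) + κ / 2 * ritzErrL2 V (u₂ 0) := by
    have h0 := G.cell_le 0 hN1
    rw [cell, Nat.cast_zero, zero_mul, zero_add, Nat.cast_one, one_mul] at h0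
    have := hU.norm_start_le hCP0 hCP hκ hκT H h0
    simpa only [he, Nat.cast_one, one_mul] using this
  set S₁ := κ * ∑ j ∈ Finset.Icc 1 (N - 1), ritzErrL2 V (u₂ (j * κ)) with hS₁
  set S₂ := κ * ∑ j ∈ Finset.Icc 1 (N - 1), ritzErrL2 V (caputo T γ u₁ (j * κ)) with hS₂
  have hshift : ∀ F : ℕ → ℝ, ∑ n ∈ range (N - 1), F (n + 1) = ∑ j ∈ Finset.Icc 1 (N - 1), F j :=
    fun F => by
    rw [range_eq_Ico, sum_Ico_add' F 0 (N - 1) 1, zero_add]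
    rfl
  have hres : κ * ∑ n ∈ range (N - 1), ‖r (n + 1)‖ ≤
      S₁ + a * S₂ + CP * ((2 + a * K₁) * reg) := by
    have hterm : ∀ n ∈ range (N - 1), ‖r (n + 1)‖ ≤
        (ritzErrL2 V (u₂ ((n + 1 : ℕ) * κ)) + CP * ‖D n - u₂ ((n + 1 : ℕ) * κ)‖) +
        a * (ritzErrL2 V (caputo T γ u₁ ((n + 1 : ℕ) * κ)) +
          CP * ‖caputo T γ u₁ ((n + 1 : ℕ) * κ) - cq (n + 1)‖) := fun n _ => by
      simp only [hr]
      refine (norm_add_le _ _).trans (add_le_add ?_ ?_)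
      · rw [norm_sub_rev (D n)]
        exact norm_toL2_sub_ritz_le V hCP0 hCP _ _
      · rw [norm_smul, Real.norm_of_nonneg ha.le]
        exact mul_le_mul_of_nonneg_left (norm_toL2_sub_ritz_le V hCP0 hCP _ _) ha.le
    have h1 := mul_le_mul_of_nonneg_left (sum_le_sum hterm) hκ.le
    have h2 := H.sum_second_difference_le hκ hN a1 a3 G
    have h3 := hcons κ N u u₁ u₂ u₃ u₄ h S₃ S₄ M hκ hN a1 a2 a3 a4 H hd G
    rw [sum_add_distrib, sum_add_distrib, ← mul_sum, ← mul_sum, sum_add_distrib, ← mul_sum,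
      hshift fun j => ritzErrL2 V (u₂ (j * κ)),
      hshift fun j => ritzErrL2 V (caputo T γ u₁ (j * κ))] at h1
    refine h1.trans ?_
    have h4 := mul_le_mul_of_nonneg_left h2 hCP0.le
    have h5 := mul_le_mul_of_nonneg_left h3 (mul_nonneg ha.le hCP0.le)
    have h6 : CP * (2 * (κ * h + κ ^ 2 * S₄)) ≤ CP * (2 * reg) :=
      mul_le_mul_of_nonneg_left (by linarith) hCP0.le
    linarith
  have b0 : 0 ≤ S₁ := mul_nonneg hκ.le (sum_nonneg fun _ _ => ritzErrL2_nonneg V _)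
  have b1 : 0 ≤ S₂ := mul_nonneg hκ.le (sum_nonneg fun _ _ => ritzErrL2_nonneg V _)
  have b2 := ritzErrL2_nonneg V (u₁ 0)
  have b3 : 0 ≤ κ / 2 * ritzErrL2 V (u₂ 0) :=
    mul_nonneg (by positivity) (ritzErrL2_nonneg V (u₂ 0))
  have hle : 2 * ‖toL2 Ω (κ⁻¹ • e 1 : V)‖ + 8 * (κ * ∑ n ∈ range (N - 1), ‖r (n + 1)‖) ≤ Q := by
    have c1 : CP * (κ * h) ≤ CP * reg := mul_le_mul_of_nonneg_left (by linarith) hCP0.le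
    have c2 := mul_nonneg ha.le b0
    have c3 := mul_nonneg ha.le b2
    have c4 := mul_nonneg ha.le b3
    rw [hQ]
    linarith
  exact ⟨est.1.trans hle, est.2.trans hle⟩

end FracWave

namespace FracWave

/-! ### The error estimate -/

open Set (Icc Ioo Ioc)

variable {d : ℕ} {Ω : Set (EuclideanSpace ℝ (Fin d))}

/-- The CFL condition in the form used by `energy_estimate`. -/
lemma sq_mul_norm_grad_le_of_inverse {V : Submodule ℝ (H10 Ω)} {h Cinv κ : ℝ} (hh : 0 < h)
    (hC : 0 < Cinv) (hinv : ∀ v : V, ‖grad Ω v‖ ≤ Cinv * h⁻¹ * ‖toL2 Ω v‖) (hκ : 0 < κ)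
    (hCFL : κ ≤ Real.sqrt 2 * h / Cinv) (v : V) :
    κ ^ 2 / 4 * ‖grad Ω v‖ ^ 2 ≤ 1 / 2 * ‖toL2 Ω v‖ ^ 2 := by
  have h1 : κ * Cinv * h⁻¹ ≤ Real.sqrt 2 := by
    rw [le_div_iff₀ hC] at hCFL
    rwa [← div_eq_mul_inv, div_le_iff₀ hh]
  have h2 : κ * ‖grad Ω v‖ ≤ Real.sqrt 2 * ‖toL2 Ω v‖ :=
    calc κ * ‖grad Ω v‖ ≤ κ * (Cinv * h⁻¹ * ‖toL2 Ω v‖) := mul_le_mul_of_nonneg_left (hinv v) hκ.le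
      _ = κ * Cinv * h⁻¹ * ‖toL2 Ω v‖ := by ring
      _ ≤ _ := mul_le_mul_of_nonneg_right h1 (norm_nonneg _)
  have h3 := pow_le_pow_left₀ (by positivity) h2 2
  rw [mul_pow, mul_pow, Real.sq_sqrt (by norm_num)] at h3
  linarith

/-- Passage from the error against the Ritz projection at the grid points to the error at the
midpoint `t - s`, `t + s` being consecutive grid points. -/
lemma midpoint_error {CP : ℝ} (hCP0 : 0 < CP)
    (hCP : ∀ w : H10 Ω, ‖toL2 Ω w‖ ≤ CP * ‖grad Ω w‖) (V : Submodule ℝ (H10 Ω))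
    [FiniteDimensional ℝ V] (x y : V) (p q w w' : H10 Ω) {κ Q δ δ' : ℝ}
    (hv : ‖toL2 Ω (κ⁻¹ • ((x - ritz V p) - (y - ritz V q)) : V)‖ ≤ Q)
    (hg : ‖grad Ω ((2 : ℝ)⁻¹ • ((x - ritz V p) + (y - ritz V q)) : V)‖ ≤ Q)
    (h' : ‖κ⁻¹ • (p - q) - w'‖ ≤ δ') (h : ‖(2 : ℝ)⁻¹ • (p + q) - w‖ ≤ δ) :
    ‖toL2 Ω (κ⁻¹ • ((x : H10 Ω) - y) - w')‖ ≤ Q + CP * δ' + ritzErrL2 V w' ∧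
    ‖toL2 Ω ((2 : ℝ)⁻¹ • ((x : H10 Ω) + y) - w)‖ ≤ CP * Q + CP * δ + ritzErrL2 V w ∧
    ‖(2 : ℝ)⁻¹ • ((x : H10 Ω) + y) - w‖ ≤ (1 + CP) * Q + (1 + CP) * δ + ritzErrH1 V w := by
  set R := ritzLM V hCP0 hCP with hR
  have hRw : ∀ z, ritz V z = R z := fun _ => rfl
  have e1 : κ⁻¹ • ((x : H10 Ω) - y) - w' =
      ((κ⁻¹ • ((x - ritz V p) - (y - ritz V q)) : V) : H10 Ω) +
        (ritz V (κ⁻¹ • (p - q) - w') : H10 Ω) + ((ritz V w' : H10 Ω) - w') := by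
    simp only [hRw, map_sub, map_smul, Submodule.coe_sub, Submodule.coe_smul, smul_sub]
    abel
  have e2 : (2 : ℝ)⁻¹ • ((x : H10 Ω) + y) - w =
      (((2 : ℝ)⁻¹ • ((x - ritz V p) + (y - ritz V q)) : V) : H10 Ω) +
        (ritz V ((2 : ℝ)⁻¹ • (p + q) - w) : H10 Ω) + ((ritz V w : H10 Ω) - w) := by
    simp only [hRw, map_sub, map_add, map_smul, Submodule.coe_sub, Submodule.coe_add,
      Submodule.coe_smul, smul_sub, smul_add]
    abel
  refine ⟨?_, ?_, ?_⟩
  · rw [e1, map_add, map_add]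
    refine norm_add₃_le.trans (add_le_add (add_le_add hv ?_) le_rfl)
    exact (norm_toL2_ritz_le V hCP0 hCP _).trans (mul_le_mul_of_nonneg_left h' hCP0.le)
  · rw [e2, map_add, map_add]
    refine norm_add₃_le.trans (add_le_add (add_le_add ?_ ?_) le_rfl)
    · exact (hCP _).trans (mul_le_mul_of_nonneg_left hg hCP0.le)
    · exact (norm_toL2_ritz_le V hCP0 hCP _).trans (mul_le_mul_of_nonneg_left h hCP0.le)
  · rw [e2]
    refine norm_add₃_le.trans (add_le_add (add_le_add ?_ ?_) le_rfl)
    · exact (norm_H10_le hCP0 hCP _).trans (mul_le_mul_of_nonneg_left hg (by positivity))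
    · exact (norm_ritz_le V hCP0 hCP _).trans (mul_le_mul_of_nonneg_left h (by positivity))

end FracWave

open FracWave
set_option maxHeartbeats 1000000 in
theorem mainTheorem2 (d : ℕ) (hd : 1 ≤ d) (Ω : Set (EuclideanSpace ℝ (Fin d)))
    (hΩ : IsOpen Ω) (hΩb : Bornology.IsBounded Ω)
    (γ : ℝ) (hγ : γ ∈ Set.Ioo (-1 : ℝ) 1) (hγ0 : γ ≠ 0)
    (α₀ : ℝ) (hα₀ : 0 < α₀) (T : ℝ) (hT : 0 < T) :
    ∃ κbar > 0, ∃ K > 0,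
    ∀ α C₀ : ℝ, (γ < 0 → -γ ≤ α) → (0 < γ → 1 - γ ≤ α) → α ≠ 1 → 0 < C₀ →
    ∃ C > 0, ∀ c₁ c₂ c₃ c₄ : ℝ, 0 ≤ c₁ → 0 ≤ c₂ → 0 ≤ c₃ → 0 ≤ c₄ →
    ∃ Ctilde > 0, ∀ c₀ : ℝ, 0 ≤ c₀ →
    ∀ (f : ℝ → L2 Ω) (u₀ v₀ : H10 Ω) (u : ℝ → H10 Ω),
      IsWeakSolution Ω γ α₀ T f u₀ v₀ u →
      IsSmooth T α C₀ ![c₀, c₁, c₂, c₃, c₄] u →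
    ∀ (V : Submodule ℝ (H10 Ω)) [FiniteDimensional ℝ V] (h Cinv : ℝ), 0 < h → 0 < Cinv →
      (∀ v : V, ‖grad Ω v‖ ≤ Cinv * h⁻¹ * ‖toL2 Ω v‖) →
    ∀ (κ : ℝ) (N : ℕ), 0 < κ → κ < κbar → N * κ = T → κ ≤ Real.sqrt 2 * h / Cinv →
    ∀ U : ℕ → V,
      IsCorrectedScheme γ α₀ κ N f u₀ v₀ (iteratedDerivWithin 2 u (Set.Icc 0 T) 0) V U →
    ∀ n : ℕ, 1 ≤ n → n ≤ N →
      ‖toL2 Ω (κ⁻¹ • ((U n : H10 Ω) - U (n - 1)) -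
            derivWithin u (Set.Icc 0 T) (n * κ - κ / 2))‖ +
          ‖toL2 Ω ((2 : ℝ)⁻¹ • ((U n : H10 Ω) + U (n - 1)) - u (n * κ - κ / 2))‖ ≤
        K * spatialError γ T κ N v₀ u V +
          ritzErrL2 V (derivWithin u (Set.Icc 0 T) (n * κ - κ / 2)) +
          ritzErrL2 V (u (n * κ - κ / 2)) +
          C * (c₃ + c₄) * κ ^ (1 + α) + Ctilde * κ ^ 2 ∧
      ‖(2 : ℝ)⁻¹ • ((U n : H10 Ω) + U (n - 1)) - u (n * κ - κ / 2)‖ ≤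
        K * spatialError γ T κ N v₀ u V +
          ritzErrH1 V (u (n * κ - κ / 2)) +
          C * (c₃ + c₄) * κ ^ (1 + α) + Ctilde * κ ^ 2 := by
  obtain ⟨CP, hCP0, hCP⟩ := exists_poincare (Ω := Ω) hd hΩb
  obtain ⟨κbar, hκbar, K, hK, L, hL, main⟩ :=
    exists_energy_error_bound ⟨CP, hCP0, hCP⟩ hγ hγ0 hα₀ hT
  refine ⟨κbar, hκbar, (1 + CP) * K, by positivity, fun α C₀ hα1 hα2 hα hC₀ => ?_⟩
  have hα0 : 0 < α := by
    rcases hγ0.lt_or_gt with h | h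
    · linarith [hα1 h]
    · linarith [hα2 h, hγ.2]
  have hα' : 0 < |α - 1| := abs_pos.2 (sub_ne_zero.2 hα)
  refine ⟨(1 + CP) * (L + 1) * (C₀ * (1 + 1 / α + 1 / |α - 1|)), by positivity,
    fun c₁ c₂ c₃ c₄ hc₁ hc₂ hc₃ hc₄ => ⟨(1 + CP) * (L + 1) *
      (C₀ * (2 + 2 * T + c₂ * T ^ α + c₃ * (T ^ (α - 1) + T ^ α / α) +
          c₄ * (T ^ (α - 1) / |α - 1|))), by positivity,
      fun c₀ hc₀ f u₀ v₀ u hu hs V _ h Cinv hh hCinv hinv κ N hκ hκb hN hCFL U hU n hn1 hnN => ?_⟩⟩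
  set u₁ := derivWithin u (Set.Icc 0 T) with hu₁
  set u₂ := iteratedDerivWithin 2 u (Set.Icc 0 T) with hu₂
  set u₃ := iteratedDerivWithin 3 u (Set.Ioc 0 T) with hu₃
  set u₄ := iteratedDerivWithin 4 u (Set.Ioc 0 T) with hu₄
  have b2 : ∀ t ∈ Set.Ioc 0 T, ‖u₂ t‖ ≤ C₀ * (1 + c₂ * t ^ α) := fun t ht => by
    have := hs.bound 2 t ht
    change ‖iteratedDerivWithin 2 u (Set.Ioc 0 T) t‖ ≤
      C₀ * (1 + c₂ * t ^ (2 + α - ((2 : ℕ) : ℝ))) at this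
    rw [iteratedDerivWithin_Ioc_eq u 2 ht.1,
      show 2 + α - ((2 : ℕ) : ℝ) = α by push_cast; ring] at this
    exact this
  have b3 : ∀ t ∈ Set.Ioc 0 T, ‖u₃ t‖ ≤ C₀ * (1 + c₃ * t ^ (α - 1)) := fun t ht => by
    have := hs.bound 3 t ht
    change ‖u₃ t‖ ≤ C₀ * (1 + c₃ * t ^ (2 + α - ((3 : ℕ) : ℝ))) at this
    rwa [show 2 + α - ((3 : ℕ) : ℝ) = α - 1 by push_cast; ring] at this
  have b4 : ∀ t ∈ Set.Ioc 0 T, ‖u₄ t‖ ≤ C₀ * (1 + c₄ * t ^ (α - 2)) := fun t ht => by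
    have := hs.bound 4 t ht
    change ‖u₄ t‖ ≤ C₀ * (1 + c₄ * t ^ (2 + α - ((4 : ℕ) : ℝ))) at this
    rwa [show 2 + α - ((4 : ℕ) : ℝ) = α - 2 by push_cast; ring] at this
  have H : TimeReg T u u₁ u₂ u₃ u₄ :=
    timeReg_of_contDiffOn hT hα0 hs.contDiffOn_two hs.contDiffOn_four b3
  obtain ⟨η, S₃, S₄, M, a1, a2, a3, a4, G, hreg⟩ :=
    H.exists_gridBounds hT hα0 hα hC₀ hc₂ hc₃ hc₄ b2 b3 b4 hκ hN
  have heq : ∀ t ∈ Set.Ioc 0 T, ∀ v : H10 Ω, inner ℝ (toL2 Ω (u₂ t)) (toL2 Ω v) +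
      inner ℝ (grad Ω (u t)) (grad Ω v) +
      dampingCoeff α₀ γ * inner ℝ (toL2 Ω (caputo T γ u₁ t)) (toL2 Ω v) =
      inner ℝ (f t) (toL2 Ω v) := fun t ht v => by
    rw [← caputo_add_one hγ hγ0]
    exact hu.equation t ht v
  have hv₀ : u₁ 0 = v₀ := hu.initial_deriv
  rw [← hu.initial, ← hv₀] at hU
  obtain ⟨m, rfl⟩ : ∃ m, n = m + 1 := ⟨n - 1, by omega⟩
  rw [Nat.add_sub_cancel]
  have hm : m < N := by omega
  have est := main f u u₁ u₂ u₃ u₄ H (fun t _ => derivWithin_derivWithin u _ t) heq V κ N hκ hκb hN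
    (sq_mul_norm_grad_le_of_inverse hh hCinv hinv hκ hCFL) U hU η S₃ S₄ M a1 a2 a3 a4 G m hm _ rfl
  set t := ((m + 1 : ℕ) : ℝ) * κ - κ / 2 with ht
  have et1 : t + κ / 2 = (m + 1 : ℕ) * κ := by rw [ht]; ring
  have et2 : t - κ / 2 = m * κ := by rw [ht]; push_cast; ring
  have hmκ : 0 ≤ (m : ℝ) * κ := by positivity
  have htT : t + κ / 2 ≤ T := by
    rw [et1, ← hN]; exact mul_le_mul_of_nonneg_right (by exact_mod_cast hm) hκ.le
  -- the midpoint is the centre of a difference quotient of half the step size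
  have d1 := H.norm_central_difference_le (t := t) (κ := κ / 2) (by positivity) (by linarith) htT
  have d2 := H.norm_average_sub_le (t := t) (s := κ / 2) (by positivity) (by linarith) htT G.bound₂
  rw [et1, et2] at d1 d2
  rw [mul_div_cancel₀ _ (two_ne_zero)] at d1
  have d1' := d1.trans (mul_le_mul_of_nonneg_left (G.cell_le m hm) (by positivity))
  obtain ⟨g1, g2, g3⟩ := midpoint_error hCP0 hCP V _ _ _ _ _ _ est.1 est.2 d1' d2
  set reg := κ * η + κ ^ 2 * S₃ + κ ^ 2 * S₄ + κ ^ 2 * M with hregdef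
  have r1 : 0 ≤ κ * η := by positivity
  have r2 : 0 ≤ κ ^ 2 * S₃ := by positivity
  have r3 : 0 ≤ κ ^ 2 * S₄ := by positivity
  have r4 : 0 ≤ κ ^ 2 * M := by positivity
  have hδ' : κ / 2 * η + (κ / 2) ^ 2 * M ≤ reg := by linarith
  have hδ : (κ / 2) ^ 2 * M ≤ reg := by linarith
  have hSE : κ * ∑ j ∈ Finset.Icc 1 (N - 1), ritzErrL2 V (u₂ (j * κ)) +
      ritzErrL2 V (u₁ 0) + κ / 2 * ritzErrL2 V (u₂ 0) +
      κ * ∑ j ∈ Finset.Icc 1 (N - 1), ritzErrL2 V (caputo T γ u₁ (j * κ)) =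
      spatialError γ T κ N v₀ u V := by rw [hv₀]; rfl
  rw [hSE] at g1 g2 g3
  have hR := mul_le_mul_of_nonneg_left hreg (by positivity : 0 ≤ (1 + CP) * (L + 1))
  have hq1 := mul_le_mul_of_nonneg_left hδ' hCP0.le
  have hq2 := mul_le_mul_of_nonneg_left hδ (by positivity : 0 ≤ 1 + CP)
  have hreg0 : 0 ≤ reg := by linarith
  constructor
  · linarith
  · linarith
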